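/- Notation. For $n\ge 0$ let $W_n$ be the space of homogeneous polynomials of degree $n$ in $\mathbb C[T_1,T_2]$, with rational and real forms $W_n(\mathbb Q)\subset W_n(\mathbb R)$, let $\mathrm{Re}:W_n\to W_n(\mathbb R)$ take real parts of coefficients, and let $g=\begin{pmatrix}a&b\\c&d\end{pmatrix}\in \mathrm{GL}^+(2,\mathbb Q)$ act by $(g\cdot P)(T_1,T_2)=\det(g)^{-n/2}P(aT_1+cT_2,\,bT_1+dT_2)$. Put $F(z)=(zT_1+T_2)^{m-2}$, $\check F(z)=\int_0^zF(\zeta)\,d\zeta$, and $(f|_w\gamma)(z)=\det(\gamma)^{w/2}(cz+d)^{-w}f(\gamma z)$. For $f:\mathbb H\to\mathbb C$ with limit (constant term) ${\bf a}_0(f)$ at $i\infty$, put $\tilde f=f-{\bf a}_0(f)$. Monomials $fU_\gamma$ ($f$ of weight $w(f)$, $\gamma\in\mathrm{GL}^+(2,\mathbb Q)$) multiply by $f^0U_\alpha\, f^1U_\beta=f^0\,(f^1|\alpha^{-1})\,U_{\alpha\beta}$. Fix $z_0\in\mathbb H$. For $w(f^0)+w(f^1)=m$ and $\gamma_0\gamma_1=1$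 set, with $g=f^0\,(f^1|\gamma_1)$ and $h=(f^0|\gamma_0)\,f^1$, $$\tilde\tau(f^0U_{\gamma_0},f^1U_{\gamma_1})=\int_{z_0}^{\gamma_0z_0}F g\,dz+{\bf a}_0(g)\check F(z_0)-{\bf a}_0(h)\,\gamma_0\cdot\check F(z_0)-\int_{z_0}^{i\infty}F\tilde g\,dz+\int_{z_0}^{i\infty}(\gamma_0\cdot F)\,\tilde h\,dz ,$$ and $\tilde\tau=0$ otherwise. For $\omega$ of weight $m$ put $\widetilde{\delta_1}(a)=\omega a-a\omega$ (the operator by which $\delta_1\in\mathcal H_1$ acts in the degenerate action defined by $\omega$), $gv_\omega(a^0,a^1,a^2)=\tilde\tau(a^0\widetilde{\delta_1}(a^1),a^2)$, $tgv_\omega(a^0,a^1)=-\tilde\tau(a^0,\omega a^1)$, and $\Psi_\omega(\gamma)=\tilde\tau(\omega U_\gamma,U_{\gamma^{-1}})$ for $\gamma\in\mathrm{GL}^+(2,\mathbb Q)$. For a $1$-cochain $\varphi$ let $b\varphi(a^0,a^1,a^2)=\varphi(a^0a^1,a^2)-\varphi(a^0,a^1a^2)+\gamma_2^{-1}\cdot\varphi(a^2a^0,a^1)$,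 where $a^2=f^2U_{\gamma_2}$. For ${\bf x}=(x_1,x_2)\in(\frac1N\mathbb Z/\mathbb Z)^2$ let $$\phi^{(m)}_{\bf x}(z)=\frac{(m-1)!}{(2\pi iN)^m}\sum_{{\bf a}\in(\mathbb Z/N\mathbb Z)^2}e^{2\pi i(a_2x_1-a_1x_2)}\sum_{{\bf k}\in\mathbb Q^2\setminus 0,\ {\bf k}\equiv {\bf a}/N\ (\mathrm{mod}\ 1)}(k_1z+k_2)^{-m},$$ where for $m=2$ one inserts $|k_1z+k_2|^{-s}$ and takes the value at $s=0$ of the analytic continuation from $\mathrm{Re}\,s>0$ (the limit $s\to0^+$). Let ${\bf B}_j(y)=B_j(y-[y])$ be the periodic Bernoulli functions, with the convention ${\bf B}_1(y)=0$ for $y\in\mathbb Z$, and for coprime $a,c$ with $c\ge1$ let $$S^{(p,k)}_{\bf x}\Big(\frac ac\Big)=\sum_{r=0}^{c-1}\frac{{\bf B}_p\big(\frac{x_1+r}{c}\big)}{p}\,\frac{{\bf B}_k\big(x_2+a\frac{x_1+r}{c}\big)}{k}.$$ Theorem. Let $m\ge2$, $N\ge1$ and ${\bf x}\in(\frac1N\mathbb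 Z/\mathbb Z)^2$, with ${\bf x}\ne0$ if $m=2$. Then $\omega=\phi^{(m)}_{\bf x}$ is a modular form of weight $m$ for $\Gamma(N)$, and $\Psi_{\bf x}:=\Psi_\omega$ does not depend on $z_0$. One has $gv_\omega=b(tgv_\omega)$ on $(U_{\gamma_0},U_{\gamma_1},U_{\gamma_2})$ whenever $\gamma_0\gamma_1\gamma_2=1$ in $\mathrm{GL}^+(2,\mathbb Q)$, and $\Psi_{\bf x}(\gamma)=-tgv_\omega(U_\gamma,U_{\gamma^{-1}})$ for $\gamma\in\Gamma(N)$. For all $\alpha,\beta\in\mathrm{GL}^+(2,\mathbb Q)$, $\Psi_{\bf x}(\alpha\beta)=\Psi_{\bf x}(\alpha)+\alpha\cdot\Psi_{\phi^{(m)}_{\bf x}|\alpha}(\beta)$, where $\phi^{(m)}_{\bf x}|\alpha=\phi^{(m)}_{{\bf x}\alpha}$ for $\alpha\in\mathrm{SL}(2,\mathbb Z)$. The function $\Phi^{(m)}_{\bf x}=\mathrm{Re}\,\Psi_{\bf x}$ is a $1$-cocycle on $\Gamma(N)$, i.e. $\Phi^{(m)}_{\bf x}(\alpha\beta)=\Phi^{(m)}_{\bf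 x}(\alpha)+\alpha\cdot\Phi^{(m)}_{\bf x}(\beta)$, it takes values in $W_{m-2}(\mathbb Q)$ on $\mathrm{SL}(2,\mathbb Z)$, and it is given by the following formulas (those of the generalized Rademacher function). $1^0$. For $\beta=\begin{pmatrix}a&b\\0&d\end{pmatrix}\in\mathrm{GL}^+(2,\mathbb Q)$, $$\Phi^{(m)}_{\bf x}(\beta)=-\frac{{\bf B}_m(x_1)}{m}\int_0^{b/d}(tT_1+T_2)^{m-2}\,dt .$$ $2^0$. For $\sigma=\begin{pmatrix}a&b\\c&d\end{pmatrix}\in\mathrm{SL}(2,\mathbb Z)$ with $c>0$, $$\begin{aligned}\Phi^{(m)}_{\bf x}(\sigma)=&-\frac{{\bf B}_m(x_1)}{m}\int_0^{a/c}(tT_1+T_2)^{m-2}\,dt-\frac{{\bf B}_m(ax_1+cx_2)}{m}\int_{-d/c}^0\big(t(aT_1+cT_2)+bT_1+dT_2\big)^{m-2}\,dt\\&+\sum_{k=0}^{m-2}(-1)^k\binom{m-2}{k}S^{(m-k-1,k+1)}_{\bf x}\Big(\frac ac\Big)\,T_1^k\,(aT_1+cT_2)^{m-k-2}.\end{aligned}$$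 -/

import Mathlib

open UpperHalfPlane MatrixGroups Filter Topology MeasureTheory

namespace Transgress

noncomputable section

/-- The real matrix underlying an element of `GL⁺(2, ℚ)`. -/
def toReal (γ : GL(2, ℚ)⁺) : GL (Fin 2) ℝ :=
  Matrix.GeneralLinearGroup.map (algebraMap ℚ ℝ) (γ : GL (Fin 2) ℚ)

/-- The inclusion `SL(2, ℤ) → GL⁺(2, ℚ)`. -/
def ofSL (σ : SL(2, ℤ)) : GL(2, ℚ)⁺ :=
  Matrix.SpecialLinearGroup.toGLPos (Matrix.SpecialLinearGroup.map (Int.castRingHom ℚ) σ)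

/-- The (rational) entries of an element of `GL⁺(2, ℚ)`. -/
def entry (γ : GL(2, ℚ)⁺) (i j : Fin 2) : ℚ := ((γ : GL (Fin 2) ℚ) : Matrix (Fin 2) (Fin 2) ℚ) i j

/-- The determinant of an element of `GL⁺(2, ℚ)`, as a (positive) real number. -/
def realDet (γ : GL(2, ℚ)⁺) : ℝ :=
  (((γ : GL (Fin 2) ℚ) : Matrix (Fin 2) (Fin 2) ℚ).det : ℝ)

/-- The action of `γ` on the upper half plane by fractional linear transformations. -/
def moeb (γ : GL(2, ℚ)⁺) (z : ℍ) : ℍ := toReal γ • z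

/-- The weight `w` slash operator
`(f | γ)(z) = det(γ)^{w/2} (cz + d)^{-w} f(γ z)`. -/
def slash (w : ℤ) (γ : GL(2, ℚ)⁺) (f : ℍ → ℂ) : ℍ → ℂ := fun z =>
  ((realDet γ ^ ((w : ℝ) / 2) : ℝ) : ℂ) * denom (toReal γ) z ^ (-w) * f (moeb γ z)

/-! ### The modules `W_n`

`W_n` is the space of homogeneous polynomials of degree `n` in `T₁ = X 0` and `T₂ = X 1`;
its elements are written as elements of `MvPolynomial (Fin 2) ℂ`, those of `W_n(ℝ)` and `W_n(ℚ)`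
as elements of `MvPolynomial (Fin 2) ℝ` and `MvPolynomial (Fin 2) ℚ`. -/

open MvPolynomial in
/-- The action `(g · P)(T₁, T₂) = det(g)^{-n/2} P(a T₁ + c T₂, b T₁ + d T₂)` on `W_n`
(for `K = ℂ`) or on `W_n(ℝ)` (for `K = ℝ`). -/
def act {K : Type} [Field K] [Algebra ℝ K] (n : ℕ) (g : GL(2, ℚ)⁺) (P : MvPolynomial (Fin 2) K) :
    MvPolynomial (Fin 2) K :=
  C (algebraMap ℝ K (realDet g ^ (-(n : ℝ) / 2))) *
    aeval ![C (entry g 0 0 : K) * X 0 + C (entry g 1 0 : K) * X 1,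
            C (entry g 0 1 : K) * X 0 + C (entry g 1 1 : K) * X 1] P

/-- The exponent of the monomial `T₁^k T₂^l`. -/
def expo (k l : ℕ) : Fin 2 →₀ ℕ := Finsupp.single 0 k + Finsupp.single 1 l

open MvPolynomial in
/-- The homogeneous polynomial `∑_{k ≤ n} c_k T₁^k T₂^{n-k}`. -/
def homog {K : Type} [Field K] (n : ℕ) (c : ℕ → K) : MvPolynomial (Fin 2) K :=
  ∑ k ∈ Finset.range (n + 1), C (c k) * X 0 ^ k * X 1 ^ (n - k)

/-- The projection `Re : W_n → W_n(ℝ)`, the real parts of the coefficients. -/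
def rePoly (n : ℕ) (P : MvPolynomial (Fin 2) ℂ) : MvPolynomial (Fin 2) ℝ :=
  homog n fun k => (P.coeff (expo k (n - k))).re

/-- The integral `∫_a^b G(t) dt` of a `W_n(ℝ)`-valued function of a real variable
(coefficient by coefficient). -/
def realInt (n : ℕ) (G : ℝ → MvPolynomial (Fin 2) ℝ) (a b : ℝ) : MvPolynomial (Fin 2) ℝ :=
  homog n fun k => ∫ t in a..b, (G t).coeff (expo k (n - k))

/-- The integral `∫_z^w G(ζ) dζ` of a `W_n`-valued function on the upper half plane, along the
line segment from `z` to `w` (coefficient by coefficient). -/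
def segInt (n : ℕ) (G : ℍ → MvPolynomial (Fin 2) ℂ) (z w : ℍ) : MvPolynomial (Fin 2) ℂ :=
  homog n fun k => ∫ t in (0 : ℝ)..1,
    ((w : ℂ) - z) * (G (ofComplex ((z : ℂ) + t * ((w : ℂ) - z)))).coeff (expo k (n - k))

/-- The integral `∫_z^{i∞} G(ζ) dζ` of a `W_n`-valued function on the upper half plane, along the
vertical ray from `z` (coefficient by coefficient). -/
def rayInt (n : ℕ) (G : ℍ → MvPolynomial (Fin 2) ℂ) (z : ℍ) : MvPolynomial (Fin 2) ℂ :=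
  homog n fun k => ∫ t in Set.Ioi (0 : ℝ),
    Complex.I * (G (ofComplex ((z : ℂ) + t * Complex.I))).coeff (expo k (n - k))

open MvPolynomial in
/-- `F_n(z) = (z T₁ + T₂)^n`. -/
def F (n : ℕ) (z : ℍ) : MvPolynomial (Fin 2) ℂ := (C (z : ℂ) * X 0 + X 1) ^ n

/-- `F̌_n(z) = ∫_0^z F_n(ζ) dζ = ∑_k n! / ((k+1)! (n-k)!) z^{k+1} T₁^k T₂^{n-k}`. -/
def Fcheck (n : ℕ) (z : ℍ) : MvPolynomial (Fin 2) ℂ :=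
  homog n fun k => (n.factorial : ℂ) / ((k + 1).factorial * (n - k).factorial) * (z : ℂ) ^ (k + 1)

/-! ### The crossed product and the transgressed cochain -/

/-- The monomials `f U_γ`, with `f` of weight `wt`, which span the crossed product algebra of the
functions on the upper half plane by `GL⁺(2, ℚ)`. -/
structure Mono where
  /-- the weight of the coefficient -/
  wt : ℤ
  /-- the coefficient -/
  fn : ℍ → ℂ
  /-- the group element -/
  grp : GL(2, ℚ)⁺

/-- The convolution product `(f⁰ U_α) (f¹ U_β) = f⁰ (f¹ | α⁻¹) U_{αβ}`. -/
instance : Mul Mono :=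
  ⟨fun a b => ⟨a.wt + b.wt, a.fn * slash b.wt a.grp⁻¹ b.fn, a.grp * b.grp⟩⟩

/-- The monomial `U_γ`. -/
def U (γ : GL(2, ℚ)⁺) : Mono := ⟨0, 1, γ⟩

/-- The constant term `a₀(f)` at the cusp `∞`. -/
def a0 (f : ℍ → ℂ) : ℂ := valueAtInfty f

/-- `f̃ = f - a₀(f)`. -/
def tilde (f : ℍ → ℂ) : ℍ → ℂ := fun z => f z - a0 f

open MvPolynomial Classical in
/-- The regularized modular symbol `1`-cocycle `τ̃_{m-2}` with values in `W_{m-2}`, on a pair of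
monomials `f⁰ U_{γ₀}`, `f¹ U_{γ₁}`; it vanishes unless `w(f⁰) + w(f¹) = m` and `γ₀ γ₁ = 1`. -/
def tauTilde (m : ℕ) (z₀ : ℍ) (a b : Mono) : MvPolynomial (Fin 2) ℂ :=
  if a.wt + b.wt = m ∧ a.grp * b.grp = 1 then
    let g : ℍ → ℂ := a.fn * slash b.wt b.grp b.fn
    let h : ℍ → ℂ := slash a.wt a.grp a.fn * b.fn
    segInt (m - 2) (fun z => C (g z) * F (m - 2) z) z₀ (moeb a.grp z₀)
      + C (a0 g) * Fcheck (m - 2) z₀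
      - C (a0 h) * act (m - 2) a.grp (Fcheck (m - 2) z₀)
      - rayInt (m - 2) (fun z => C (tilde g z) * F (m - 2) z) z₀
      + rayInt (m - 2) (fun z => C (tilde h z) * act (m - 2) a.grp (F (m - 2) z)) z₀
  else 0

/-- A function `f` of weight `m`, regarded as the element `f = f U_1` of the crossed product. -/
def coeffMono (m : ℕ) (f : ℍ → ℂ) : Mono := ⟨m, f, 1⟩

/-- The cup product `gv_ω(a⁰, a¹, a²) = τ̃(a⁰ δ̃₁(a¹), a²)` of `δ₁` and `τ̃_{m-2}` for the degenerate
action defined by `ω`, in which `δ̃₁(a) = [ω, a] = ω a - a ω`. -/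
def gv (m : ℕ) (z₀ : ℍ) (ω : ℍ → ℂ) (a b c : Mono) : MvPolynomial (Fin 2) ℂ :=
  tauTilde m z₀ (a * (coeffMono m ω * b)) c - tauTilde m z₀ (a * (b * coeffMono m ω)) c

/-- The transgression cochain `tgv_ω(a⁰, a¹) = - τ̃(a⁰, ω a¹)`. -/
def tgv (m : ℕ) (z₀ : ℍ) (ω : ℍ → ℂ) (a b : Mono) : MvPolynomial (Fin 2) ℂ :=
  - tauTilde m z₀ a (coeffMono m ω * b)

/-- The Hochschild coboundary of a `1`-cochain with coefficients in `W_n`, on monomials: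
`(bφ)(a⁰, a¹, a²) = φ(a⁰a¹, a²) - φ(a⁰, a¹a²) + γ₂⁻¹ · φ(a²a⁰, a¹)` where `a² = f² U_{γ₂}`. -/
def hochB (n : ℕ) (φ : Mono → Mono → MvPolynomial (Fin 2) ℂ) (a b c : Mono) :
    MvPolynomial (Fin 2) ℂ :=
  φ (a * b) c - φ a (b * c) + act n c.grp⁻¹ (φ (c * a) b)

/-- `Ψ_f(γ) = τ̃_{m-2}(f U_γ, U_γ⁻¹)`, for `f` of weight `m` and `γ ∈ GL⁺(2, ℚ)`. -/
def Psi (m : ℕ) (z₀ : ℍ) (f : ℍ → ℂ) (γ : GL(2, ℚ)⁺) : MvPolynomial (Fin 2) ℂ :=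
  tauTilde m z₀ ⟨m, f, γ⟩ (U γ⁻¹)

/-- `Φ_f(γ) = Re Ψ_f(γ)`. -/
def Phi (m : ℕ) (z₀ : ℍ) (f : ℍ → ℂ) (γ : GL(2, ℚ)⁺) : MvPolynomial (Fin 2) ℝ :=
  rePoly (m - 2) (Psi m z₀ f γ)

/-! ### Eisenstein series -/

/-- `G^{(m)}_a(z, s) = ∑_{k ≡ a mod 1, k ≠ 0} (k₁ z + k₂)^{-m} |k₁ z + k₂|^{-s}`. -/
def eisG (m : ℕ) (a : ℚ × ℚ) (z : ℍ) (s : ℝ) : ℂ :=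
  ∑' n : ℤ × ℤ, if a.1 + n.1 = 0 ∧ a.2 + n.2 = 0 then 0 else
    (((a.1 + n.1 : ℚ) : ℂ) * z + ((a.2 + n.2 : ℚ) : ℂ)) ^ (-(m : ℤ)) *
      ((‖((a.1 + n.1 : ℚ) : ℂ) * z + ((a.2 + n.2 : ℚ) : ℂ)‖ ^ (-s) : ℝ) : ℂ)

/-- The character `χ_x(a/N) = exp(2πi (a₂ x₁ - a₁ x₂))`, for integers `a₁`, `a₂`. -/
def chi (x : ℚ × ℚ) (a : ℕ × ℕ) : ℂ :=
  Complex.exp (2 * Real.pi * Complex.I * ((a.2 * x.1 - a.1 * x.2 : ℚ) : ℂ))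

/-- `(m-1)! / (2πiN)^m ∑_{a mod N} χ_x(a/N) G^{(m)}_{a/N}(z, s)`. -/
def eisPhiS (m N : ℕ) (x : ℚ × ℚ) (z : ℍ) (s : ℝ) : ℂ :=
  ((m - 1).factorial : ℂ) / (2 * Real.pi * Complex.I * N) ^ m *
    ∑ a ∈ Finset.range N ×ˢ Finset.range N,
      chi x a * eisG m ((a.1 : ℚ) / N, (a.2 : ℚ) / N) z s

/-- The Eisenstein series `φ^{(m)}_x`. For `m > 2` the series converge absolutely at `s = 0`; for
`m = 2` they are summed by Hecke's method: the value at `s = 0` of the analytic continuation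
from `Re s > 0` is the limit as `s → 0⁺`. -/
def eisPhi (m N : ℕ) (x : ℚ × ℚ) (z : ℍ) : ℂ :=
  if m = 2 then limUnder (𝓝[>] (0 : ℝ)) (eisPhiS m N x z) else eisPhiS m N x z 0

/-! ### Bernoulli functions and Rademacher-Dedekind sums -/

/-- The periodic Bernoulli function `𝐁_j(y) = B_j(y - [y])`, with the usual convention that
`𝐁_1` vanishes at the integers. -/
def bern (j : ℕ) (y : ℚ) : ℚ :=
  if j = 1 ∧ Int.fract y = 0 then 0 else (Polynomial.bernoulli j).eval (Int.fract y)

/-- The generalized higher Rademacher-Dedekind sum `S^{(p,k)}_x(a/c)`: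
`∑_{r=0}^{c-1} 𝐁_p((x₁ + r)/c)/p · 𝐁_k(x₂ + a (x₁ + r)/c)/k`. -/
def dedekindS (p k : ℕ) (x : ℚ × ℚ) (a c : ℤ) : ℚ :=
  ∑ r ∈ Finset.range c.toNat,
    bern p ((x.1 + r) / c) / p * (bern k (x.2 + a * ((x.1 + r) / c)) / k)

end

end Transgress

namespace Transgress
noncomputable section

/-! ### Matrices, the slash operator and the action on polynomials -/

/-! Call `f` good if every `f | γ` is holomorphic and tends to a constant exponentially fast at
`i∞`. For such `f`, the form `f(z) (z T₁ + T₂)^(m-2) dz` has a primitive `Eprim` regularized at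
`i∞`: the constant term is integrated by `F̌`, the decaying rest along the vertical ray. The five
terms of `τ̃` regroup (`eval_Psi`) into `Ψ_f(γ)(T) = E_{f,T}(γ z₀) - det(γ)^{-(m-2)/2} E_{f|γ,
Tγ}(z₀)`. The two primitives have the same derivative in `z₀`, so `Ψ` does not depend on `z₀`, and
the cocycle relation follows by choosing base points (`Psi_cocycle`). The identity `gv = b(tgv)` is
a formal consequence, because `τ̃` depends only on the product `f⁰ (f¹ | γ₁)` and on `γ₀`
(`tauTilde_eq_Psi`).

The Eisenstein series is a sum over `ℤ²` twisted by a character. For `s > 0`, or at `s = 0` if `m >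
2`, the transformation law under `SL(2, ℤ)` is a reindexing. The rows of the sum are evaluated by
the Lipschitz formula, which gives the Fourier expansion `fourierPhi`. In weight `2` a summation by
parts against the nontrivial character controls the limit `s → 0⁺` (`tendsto_latS`). Goodness at
every cusp then follows from `GL⁺(2, ℚ) = SL(2, ℤ) B`, with `B` the upper triangular matrices.

On `B` the ray integrals cancel by a change of variable and only `a₀ F̌(b/d)` survives. For `σ = (a,
b; c, d)` with `c > 0`, the identity `σ (1, -d; 0, c) = (1, a; 0, c) S` and two uses of the cocycle
relation express `Ψ(σ)` by two values on `B` and by the value at `S` of `Ψ` for `φ_x | (1, a; 0,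
c)`. By the distribution relation `slash_upper_fourierPhi` this last form is a multiple of a sum
over `r mod c` of Eisenstein series, and the sum over `r` becomes the Dedekind sum.

It remains to find the real part of `Ψ(S)`. The coefficients of `Ψ(S)` are, up to powers of `i` and
binomials, the values at `k + 1` of the completed `L`-function of `φ_x` on the imaginary axis.
Complex conjugation replaces `(x₁, x₂)` by `(x₁, -x₂)`. The combination giving the real part factors
into a periodic zeta function times a Hurwitz zeta function of definite parity (`dirL_add`), and its
values at the integers in question are products of Bernoulli functions (`Λ_value`). The imaginary
part has no such factorization, which is why only `Re Ψ` is given in closed form. Rationality is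
then read off from the formulas. -/

lemma realDet_pos (γ : GL(2, ℚ)⁺) : 0 < realDet γ := by
  have h := γ.2
  rw [Matrix.mem_glpos] at h
  unfold realDet
  exact_mod_cast h

lemma realDet_eq (γ : GL(2, ℚ)⁺) :
    realDet γ = entry γ 0 0 * entry γ 1 1 - entry γ 0 1 * entry γ 1 0 := by
  simp only [realDet, Matrix.det_fin_two, entry]
  push_cast
  ring

lemma entry_mul (α β : GL(2, ℚ)⁺) (i j : Fin 2) :
    entry (α * β) i j = entry α i 0 * entry β 0 j + entry α i 1 * entry β 1 j := by
  simp [entry, Matrix.mul_apply, Fin.sum_univ_two]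

lemma entry_one (i j : Fin 2) : entry 1 i j = if i = j then 1 else 0 := by
  simp [entry, Matrix.one_apply]

lemma glpos_ext {α β : GL(2, ℚ)⁺} (h : ∀ i j, entry α i j = entry β i j) : α = β := by
  apply Subtype.ext
  apply Units.ext
  ext i j
  exact h i j

lemma realDet_mul (α β : GL(2, ℚ)⁺) : realDet (α * β) = realDet α * realDet β := by
  simp [realDet, Matrix.det_mul]

@[simp] lemma realDet_one : realDet 1 = 1 := by
  simp [realDet]

lemma toReal_apply (γ : GL(2, ℚ)⁺) (i j : Fin 2) : toReal γ i j = (entry γ i j : ℝ) := by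
  simp [toReal, entry]

lemma toReal_mul (α β : GL(2, ℚ)⁺) : toReal (α * β) = toReal α * toReal β := by
  simp [toReal]

@[simp] lemma toReal_one : toReal 1 = 1 := by
  simp [toReal]

lemma toReal_det (γ : GL(2, ℚ)⁺) : (toReal γ).det.val = realDet γ := by
  rw [Matrix.GeneralLinearGroup.val_det_apply, Matrix.det_fin_two, realDet_eq]
  simp [toReal_apply]

lemma entry_ofSL (σ : SL(2, ℤ)) (i j : Fin 2) : entry (ofSL σ) i j = (σ i j : ℚ) := rfl

lemma realDet_ofSL (σ : SL(2, ℤ)) : realDet (ofSL σ) = 1 := by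
  have h := σ.det_coe
  rw [Matrix.det_fin_two] at h
  rw [realDet_eq]
  simp only [entry_ofSL, Rat.cast_intCast]
  exact_mod_cast h

lemma ofSL_mul (σ τ : SL(2, ℤ)) : ofSL (σ * τ) = ofSL σ * ofSL τ := by
  simp [ofSL]

lemma ofSL_inv (σ : SL(2, ℤ)) : ofSL σ⁻¹ = (ofSL σ)⁻¹ := by
  rw [eq_inv_iff_mul_eq_one, ← ofSL_mul, inv_mul_cancel]
  simp [ofSL]

lemma denom_toReal (γ : GL(2, ℚ)⁺) (z : ℂ) :
    denom (toReal γ) z = (entry γ 1 0 : ℂ) * z + (entry γ 1 1 : ℂ) := by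
  simp [denom, toReal_apply]

lemma denom_toReal_ne (γ : GL(2, ℚ)⁺) (z : ℍ) :
    (entry γ 1 0 : ℂ) * z + (entry γ 1 1 : ℂ) ≠ 0 := by
  rw [← denom_toReal]
  exact denom_ne_zero _ z

lemma coe_moeb (γ : GL(2, ℚ)⁺) (z : ℍ) :
    (moeb γ z : ℂ) = ((entry γ 0 0 : ℂ) * z + (entry γ 0 1 : ℂ)) /
      ((entry γ 1 0 : ℂ) * z + (entry γ 1 1 : ℂ)) := by
  rw [moeb, coe_smul_of_det_pos (by rw [toReal_det]; exact realDet_pos γ)]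
  simp [num, denom, toReal_apply]

lemma moeb_mul (α β : GL(2, ℚ)⁺) (z : ℍ) : moeb (α * β) z = moeb α (moeb β z) := by
  simp [moeb, toReal_mul, mul_smul]

@[simp] lemma moeb_one (z : ℍ) : moeb 1 z = z := by
  simp [moeb]

lemma denom_toReal_mul (α β : GL(2, ℚ)⁺) (z : ℍ) :
    denom (toReal (α * β)) z = denom (toReal α) (moeb β z) * denom (toReal β) z := by
  have h := denom_toReal_ne β z
  rw [denom_toReal, denom_toReal, denom_toReal, coe_moeb, entry_mul, entry_mul]
  rw [add_mul, mul_div_assoc', div_mul_cancel_of_imp (fun h' => absurd h' h)]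
  push_cast
  ring

lemma slash_apply (w : ℤ) (γ : GL(2, ℚ)⁺) (f : ℍ → ℂ) (z : ℍ) :
    slash w γ f z =
      ((realDet γ ^ ((w : ℝ) / 2) : ℝ) : ℂ) * denom (toReal γ) z ^ (-w) * f (moeb γ z) := rfl

lemma slash_mul_group (w : ℤ) (α β : GL(2, ℚ)⁺) (f : ℍ → ℂ) :
    slash w (α * β) f = slash w β (slash w α f) := by
  funext z
  simp only [slash_apply, moeb_mul, denom_toReal_mul, realDet_mul]
  rw [Real.mul_rpow (realDet_pos α).le (realDet_pos β).le, mul_zpow]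
  push_cast
  ring

@[simp] lemma slash_one_group (w : ℤ) (f : ℍ → ℂ) : slash w 1 f = f := by
  funext z
  simp [slash_apply]

@[simp] lemma slash_zero_one (γ : GL(2, ℚ)⁺) : slash 0 γ 1 = 1 := by
  funext z
  simp [slash_apply]

lemma slash_mul_fun (v w : ℤ) (γ : GL(2, ℚ)⁺) (f g : ℍ → ℂ) :
    slash (v + w) γ (f * g) = slash v γ f * slash w γ g := by
  funext z
  have h := denom_ne_zero (toReal γ) z
  simp only [slash_apply, Pi.mul_apply]
  rw [neg_add, zpow_add₀ h, Int.cast_add, add_div, Real.rpow_add (realDet_pos γ)]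
  push_cast
  ring

lemma slash_inv_slash (w : ℤ) (γ : GL(2, ℚ)⁺) (f : ℍ → ℂ) :
    slash w γ (slash w γ⁻¹ f) = f := by
  rw [← slash_mul_group, inv_mul_cancel, slash_one_group]

/-! ### The action on homogeneous polynomials, seen through evaluation. -/

section Poly

open MvPolynomial

variable {K : Type} [Field K] [Algebra ℝ K]

/-- The row vector `T γ`. -/
def rowMul (T : Fin 2 → K) (γ : GL(2, ℚ)⁺) : Fin 2 → K :=
  ![(entry γ 0 0 : K) * T 0 + (entry γ 1 0 : K) * T 1,
    (entry γ 0 1 : K) * T 0 + (entry γ 1 1 : K) * T 1]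

/-- The factor `det(γ)^{-n/2}`. -/
def detFac (K : Type) [Field K] [Algebra ℝ K] (n : ℕ) (γ : GL(2, ℚ)⁺) : K :=
  algebraMap ℝ K (realDet γ ^ (-(n : ℝ) / 2))

/-- Identities between polynomials are proved below by evaluation at row vectors `T`. There the
action becomes the translation `T ↦ T γ`, up to the determinant factor. -/
lemma eval_act (n : ℕ) (γ : GL(2, ℚ)⁺) (P : MvPolynomial (Fin 2) K) (T : Fin 2 → K) :
    eval T (act n γ P) = detFac K n γ * eval (rowMul T γ) P := by
  simp only [act, map_mul, eval_C, detFac]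
  congr 1
  rw [aeval_def, ← eval₂_comp_left' T P]
  where
  eval₂_comp_left' {γ : GL(2, ℚ)⁺} (T : Fin 2 → K) (P : MvPolynomial (Fin 2) K) :
      eval (rowMul T γ) P = eval T (eval₂ (algebraMap K (MvPolynomial (Fin 2) K))
        ![C (entry γ 0 0 : K) * X 0 + C (entry γ 1 0 : K) * X 1,
          C (entry γ 0 1 : K) * X 0 + C (entry γ 1 1 : K) * X 1] P) := by
    induction P using MvPolynomial.induction_on with
    | C a => simp [algebraMap_eq]
    | add p q hp hq => simp [hp, hq]
    | mul_X p i hp =>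
      simp only [eval₂_mul, eval₂_X, map_mul, hp, eval_X]
      congr 1
      fin_cases i <;> simp [rowMul]

lemma eval_homog {K : Type} [Field K] (n : ℕ) (c : ℕ → K) (T : Fin 2 → K) :
    eval T (homog n c) = ∑ k ∈ Finset.range (n + 1), c k * T 0 ^ k * T 1 ^ (n - k) := by
  simp [homog]

lemma isHomogeneous_homog {K : Type} [Field K] (n : ℕ) (c : ℕ → K) :
    (homog n c).IsHomogeneous n := by
  refine IsHomogeneous.sum _ _ _ fun k hk => ?_
  have hk' : k ≤ n := Nat.lt_succ_iff.mp (Finset.mem_range.mp hk)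
  have h := ((isHomogeneous_C (Fin 2) (c k)).mul (isHomogeneous_X_pow (R := K) (0 : Fin 2) k)).mul
    (isHomogeneous_X_pow (R := K) (1 : Fin 2) (n - k))
  rwa [zero_add, Nat.add_sub_cancel' hk'] at h

lemma eq_homog {K : Type} [Field K] {n : ℕ} {P : MvPolynomial (Fin 2) K} (hP : P.IsHomogeneous n) :
    P = homog n fun k => P.coeff (expo k (n - k)) := by
  have hX : ∀ (c : K) k l, C c * X 0 ^ k * X 1 ^ l = monomial (expo k l) c := by
    intro c k l
    rw [mul_assoc, X_pow_eq_monomial, X_pow_eq_monomial, monomial_mul, C_mul_monomial, expo]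
    simp
  ext d
  simp only [homog, hX, coeff_sum, coeff_monomial]
  by_cases hd : d 0 + d 1 = n
  · have hde : ∀ k ∈ Finset.range (n + 1), (expo k (n - k) = d ↔ k = d 0) := by
      intro k hk
      constructor
      · intro h
        rw [← h]
        simp [expo]
      · rintro rfl
        ext i
        fin_cases i <;> (simp [expo]; try omega)
    rw [Finset.sum_congr rfl fun k hk => by rw [if_congr (hde k hk) rfl rfl]]
    rw [Finset.sum_ite_eq' (Finset.range (n + 1)) (d 0), if_pos (by simp; omega),
      (hde (d 0) (by simp; omega)).2 rfl]
  · rw [hP.coeff_eq_zero (by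
      rw [Finsupp.degree_eq_sum, Fin.sum_univ_two]; exact hd)]
    symm
    refine Finset.sum_eq_zero fun k hk => if_neg ?_
    rintro rfl
    apply hd
    simp [expo] at hk ⊢
    omega

lemma eval_eq_sum {K : Type} [Field K] {n : ℕ} {P : MvPolynomial (Fin 2) K} (hP : P.IsHomogeneous n) (T : Fin 2 → K) :
    eval T P = ∑ k ∈ Finset.range (n + 1), P.coeff (expo k (n - k)) * T 0 ^ k * T 1 ^ (n - k) := by
  conv_lhs => rw [eq_homog hP, eval_homog]

lemma isHomogeneous_act {n : ℕ} {P : MvPolynomial (Fin 2) K} (hP : P.IsHomogeneous n)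
    (γ : GL(2, ℚ)⁺) : (act n γ P).IsHomogeneous n := by
  have h : ∀ a b : K, (C a * X 0 + C b * X 1 : MvPolynomial (Fin 2) K).IsHomogeneous 1 := by
    intro a b
    have h0 := (isHomogeneous_C (Fin 2) a).mul (isHomogeneous_X K (0 : Fin 2))
    have h1 := (isHomogeneous_C (Fin 2) b).mul (isHomogeneous_X K (1 : Fin 2))
    rw [zero_add] at h0 h1
    exact h0.add h1
  have h2 := (isHomogeneous_C (Fin 2) (algebraMap ℝ K (realDet γ ^ (-(n : ℝ) / 2)))).mul
    (hP.aeval ![C (entry γ 0 0 : K) * X 0 + C (entry γ 1 0 : K) * X 1,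
      C (entry γ 0 1 : K) * X 0 + C (entry γ 1 1 : K) * X 1] (n := 1)
      (fun i => by fin_cases i <;> exact h _ _))
  rw [zero_add, one_mul] at h2
  exact h2

lemma isHomogeneous_F (n : ℕ) (z : ℍ) : (F n z).IsHomogeneous n := by
  have h0 := (isHomogeneous_C (Fin 2) (z : ℂ)).mul (isHomogeneous_X ℂ (0 : Fin 2))
  rw [zero_add] at h0
  have h1 := (h0.add (isHomogeneous_X ℂ (1 : Fin 2))).pow n
  rwa [one_mul] at h1

lemma eval_F (n : ℕ) (z : ℍ) (T : Fin 2 → ℂ) : eval T (F n z) = ((z : ℂ) * T 0 + T 1) ^ n := by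
  simp [F]

lemma detFac_mul (n : ℕ) (α β : GL(2, ℚ)⁺) : detFac K n (α * β) = detFac K n α * detFac K n β := by
  simp only [detFac, realDet_mul]
  rw [Real.mul_rpow (realDet_pos α).le (realDet_pos β).le, map_mul]

@[simp] lemma detFac_one (n : ℕ) : detFac K n 1 = 1 := by
  simp [detFac]

lemma rowMul_mul {K : Type} [Field K] [CharZero K] (T : Fin 2 → K) (α β : GL(2, ℚ)⁺) :
    rowMul T (α * β) = rowMul (rowMul T α) β := by
  ext i
  fin_cases i <;> simp [rowMul, entry_mul] <;> ring

@[simp] lemma rowMul_one {K : Type} [Field K] (T : Fin 2 → K) : rowMul T 1 = T := by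
  ext i
  fin_cases i <;> simp [rowMul, entry_one]

lemma act_mul [CharZero K] (n : ℕ) (α β : GL(2, ℚ)⁺) (P : MvPolynomial (Fin 2) K) :
    act n (α * β) P = act n α (act n β P) := by
  refine MvPolynomial.funext fun T => ?_
  rw [eval_act, eval_act, eval_act, detFac_mul, rowMul_mul, mul_assoc]

lemma act_neg (n : ℕ) (α : GL(2, ℚ)⁺) (P : MvPolynomial (Fin 2) K) :
    act n α (-P) = -act n α P := by
  simp [act]

end Poly

/-! ### Real parts of coefficients. -/

section Re

open MvPolynomial

/-- A real row vector as a complex row vector. -/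
def cvec (T : Fin 2 → ℝ) : Fin 2 → ℂ := fun i => (T i : ℂ)

lemma rowMul_cvec (T : Fin 2 → ℝ) (γ : GL(2, ℚ)⁺) : rowMul (cvec T) γ = cvec (rowMul T γ) := by
  ext i
  fin_cases i <;> simp [rowMul, cvec]

lemma eval_rePoly {n : ℕ} {P : MvPolynomial (Fin 2) ℂ} (hP : P.IsHomogeneous n) (T : Fin 2 → ℝ) :
    eval T (rePoly n P) = (eval (cvec T) P).re := by
  rw [eval_eq_sum hP, rePoly, eval_homog, Complex.re_sum]
  refine Finset.sum_congr rfl fun k _ => ?_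
  simp only [cvec]
  rw [mul_assoc, mul_assoc, ← Complex.ofReal_pow, ← Complex.ofReal_pow, ← Complex.ofReal_mul,
    Complex.re_mul_ofReal]

/-- Taking real parts of coefficients amounts to taking the real part of the values at real vectors,
and `T ↦ T γ` preserves real vectors. -/
lemma rePoly_act {n : ℕ} {P : MvPolynomial (Fin 2) ℂ} (hP : P.IsHomogeneous n) (γ : GL(2, ℚ)⁺) :
    rePoly n (act n γ P) = act n γ (rePoly n P) := by
  refine MvPolynomial.funext fun T => ?_
  rw [eval_rePoly (isHomogeneous_act hP γ), eval_act, eval_act, eval_rePoly hP, rowMul_cvec]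
  simp [detFac]

lemma rePoly_add (n : ℕ) (P Q : MvPolynomial (Fin 2) ℂ) :
    rePoly n (P + Q) = rePoly n P + rePoly n Q := by
  simp [rePoly, homog, add_mul, Finset.sum_add_distrib]

end Re

/-! ### The regularized cocycle in terms of `Psi` -/

/-- Since `γ₁ = γ₀⁻¹`, the function `h = (f⁰ | γ₀) f¹` equals `g | γ₀`. Hence both functions
entering `τ̃` are determined by `g` and `γ₀`. -/
lemma tauTilde_eq_Psi (m : ℕ) (z₀ : ℍ) (a b : Mono) (hw : a.wt + b.wt = m)
    (hg : a.grp * b.grp = 1) :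
    tauTilde m z₀ a b = Psi m z₀ (a.fn * slash b.wt b.grp b.fn) a.grp := by
  have hb : b.grp = a.grp⁻¹ := (inv_eq_of_mul_eq_one_right hg).symm
  have h : slash m a.grp (a.fn * slash b.wt b.grp b.fn) * 1 = slash a.wt a.grp a.fn * b.fn := by
    rw [← hw, slash_mul_fun, hb, slash_inv_slash, mul_one]
  rw [Psi, tauTilde, tauTilde, if_pos ⟨hw, hg⟩, if_pos ⟨by simp [U], by simp [U]⟩]
  simp only [U, slash_zero_one, h, mul_one]

/-- All five values of `τ̃` are values of `Ψ` for slashes of `ω`. The second term of `gv` equals the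
first term of the coboundary and cancels. What is left is the cocycle relation for `ω | γ₀⁻¹` at `γ₀
γ₁`, with `Ψ_ω(γ₁)` rewritten through `γ₁ γ₁⁻¹ = 1`. -/
lemma hochB_tgv {m : ℕ} {z₀ : ℍ} {ω : ℍ → ℂ}
    (hcocycle : ∀ δ α β : GL(2, ℚ)⁺, Psi m z₀ (slash m δ ω) (α * β) =
      Psi m z₀ (slash m δ ω) α + act (m - 2) α (Psi m z₀ (slash m α (slash m δ ω)) β))
    (hone : Psi m z₀ ω 1 = 0)
    {γ₀ γ₁ γ₂ : GL(2, ℚ)⁺} (h : γ₀ * γ₁ * γ₂ = 1) :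
    gv m z₀ ω (U γ₀) (U γ₁) (U γ₂) = hochB (m - 2) (tgv m z₀ ω) (U γ₀) (U γ₁) (U γ₂) := by
  have h2 : γ₂ = (γ₀ * γ₁)⁻¹ := (inv_eq_of_mul_eq_one_right h).symm
  have e1 : tauTilde m z₀ (U γ₀ * (coeffMono m ω * U γ₁)) (U γ₂) =
      Psi m z₀ (slash m γ₀⁻¹ ω) (γ₀ * γ₁) := by
    rw [tauTilde_eq_Psi]
    · change Psi m z₀ (1 * slash (m + 0) γ₀⁻¹ (ω * slash 0 1⁻¹ 1) * slash 0 γ₂ 1)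
        (γ₀ * (1 * γ₁)) = _
      simp
    · change (0 : ℤ) + (m + 0) + 0 = m
      simp
    · change γ₀ * (1 * γ₁) * γ₂ = 1
      simpa using h
  have e2 : tauTilde m z₀ (U γ₀ * (U γ₁ * coeffMono m ω)) (U γ₂) =
      Psi m z₀ (slash m (γ₀ * γ₁)⁻¹ ω) (γ₀ * γ₁) := by
    rw [tauTilde_eq_Psi]
    · change Psi m z₀ (1 * slash (0 + m) γ₀⁻¹ (1 * slash m γ₁⁻¹ ω) * slash 0 γ₂ 1)
        (γ₀ * (γ₁ * 1)) = _
      simp [slash_mul_group]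
    · change (0 : ℤ) + (0 + m) + 0 = m
      simp
    · change γ₀ * (γ₁ * 1) * γ₂ = 1
      simpa using h
  have e3 : tauTilde m z₀ (U γ₀ * U γ₁) (coeffMono m ω * U γ₂) =
      Psi m z₀ (slash m (γ₀ * γ₁)⁻¹ ω) (γ₀ * γ₁) := by
    rw [tauTilde_eq_Psi]
    · change Psi m z₀ (1 * slash 0 γ₀⁻¹ 1 * slash (m + 0) (1 * γ₂) (ω * slash 0 1⁻¹ 1))
        (γ₀ * γ₁) = _
      simp [h2]
    · change (0 + 0 : ℤ) + (m + 0) = m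
      simp
    · change γ₀ * γ₁ * (1 * γ₂) = 1
      simpa using h
  have e4 : tauTilde m z₀ (U γ₀) (coeffMono m ω * (U γ₁ * U γ₂)) =
      Psi m z₀ (slash m γ₀⁻¹ ω) γ₀ := by
    rw [tauTilde_eq_Psi]
    · change Psi m z₀ (1 * slash (m + (0 + 0)) (1 * (γ₁ * γ₂))
        (ω * slash (0 + 0) 1⁻¹ (1 * slash 0 γ₁⁻¹ 1))) γ₀ = _
      have : γ₁ * γ₂ = γ₀⁻¹ := by rw [h2]; group
      simp [this]
    · change (0 : ℤ) + (m + (0 + 0)) = m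
      simp
    · change γ₀ * (1 * (γ₁ * γ₂)) = 1
      rw [one_mul, ← mul_assoc, h]
  have e5 : tauTilde m z₀ (U γ₂ * U γ₀) (coeffMono m ω * U γ₁) =
      Psi m z₀ (slash m γ₁ ω) γ₁⁻¹ := by
    have h20 : γ₂ * γ₀ = γ₁⁻¹ := by rw [h2]; group
    rw [tauTilde_eq_Psi]
    · change Psi m z₀ (1 * slash 0 γ₂⁻¹ 1 * slash (m + 0) (1 * γ₁) (ω * slash 0 1⁻¹ 1))
        (γ₂ * γ₀) = _
      simp [h20]
    · change (0 + 0 : ℤ) + (m + 0) = m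
      simp
    · change γ₂ * γ₀ * (1 * γ₁) = 1
      rw [h20]; group
  have c1 := hcocycle γ₀⁻¹ γ₀ γ₁
  rw [slash_inv_slash] at c1
  have c2 := hcocycle 1 γ₁ γ₁⁻¹
  rw [slash_one_group, mul_inv_cancel, hone] at c2
  have hg2 : (U γ₂).grp⁻¹ = γ₀ * γ₁ := by
    change γ₂⁻¹ = _
    rw [h2, inv_inv]
  rw [gv, hochB, tgv, tgv, tgv, hg2, e1, e2, e3, e4, e5, c1, act_neg, act_mul,
    eq_neg_of_add_eq_zero_left c2.symm, act_neg]
  ring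

lemma Psi_eq_neg_tgv {m : ℕ} {z₀ : ℍ} {ω : ℍ → ℂ} {γ : GL(2, ℚ)⁺} (h : slash m γ⁻¹ ω = ω) :
    Psi m z₀ ω γ = -tgv m z₀ ω (U γ) (U γ⁻¹) := by
  rw [tgv, neg_neg, tauTilde_eq_Psi]
  · change _ = Psi m z₀ (1 * slash (m + 0) (1 * γ⁻¹) (ω * slash 0 1⁻¹ 1)) γ
    simp [h]
  · change (0 : ℤ) + (m + 0) = m
    simp
  · change γ * (1 * γ⁻¹) = 1
    simp

/-! ### Integrals along vertical rays -/

/-- The open upper half plane as a subset of `ℂ`. -/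
abbrev Hset : Set ℂ := {z | 0 < z.im}

lemma isOpen_Hset : IsOpen Hset := isOpen_lt continuous_const Complex.continuous_im

lemma isPreconnected_Hset : IsPreconnected Hset := (convex_halfSpace_im_gt 0).isPreconnected

/-- Exponential decay on vertical rays, uniformly near `z`. -/
def RayDecay (G : ℂ → ℂ) (z : ℂ) : Prop :=
  ∃ C ε r : ℝ, 0 < ε ∧ 0 < r ∧ ∀ w ∈ Metric.ball z r, ∀ t : ℝ, 0 ≤ t →
    ‖G (w + t * Complex.I)‖ ≤ C * Real.exp (-ε * t)

lemma add_mul_I_mem {z : ℂ} (hz : z ∈ Hset) {t : ℝ} (ht : 0 ≤ t) : z + t * Complex.I ∈ Hset := by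
  simp only [Set.mem_ofPred_eq] at hz
  simp
  linarith

lemma continuousOn_ray {G : ℂ → ℂ} (hG : ContinuousOn G Hset) {z : ℂ} (hz : z ∈ Hset) :
    ContinuousOn (fun t : ℝ => G (z + t * Complex.I)) (Set.Ici 0) :=
  hG.comp (by fun_prop) fun _ ht => add_mul_I_mem hz ht

lemma RayDecay.integrableOn {G : ℂ → ℂ} {z : ℂ} (h : RayDecay G z) (hG : ContinuousOn G Hset)
    (hz : z ∈ Hset) : IntegrableOn (fun t : ℝ => G (z + t * Complex.I)) (Set.Ioi 0) := by
  obtain ⟨C, ε, r, hε, hr, h⟩ := h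
  refine Integrable.mono' ((exp_neg_integrableOn_Ioi 0 hε).const_mul C)
    (((continuousOn_ray hG hz).mono Set.Ioi_subset_Ici_self).aestronglyMeasurable
      measurableSet_Ioi) ?_
  filter_upwards [self_mem_ae_restrict measurableSet_Ioi] with t ht
  exact h z (Metric.mem_ball_self hr) t (le_of_lt ht)

/-- Differentiating under the integral sign gives `∫ i G'(z + it) dt`, whose integrand is the
`t`-derivative of `G(z + it)`, so the integral telescopes to `-G(z)`. The dominating function for
`G'` comes from the Cauchy estimate, which is why the decay of `G` is required uniformly near `z`.
-/
lemma hasDerivAt_ray {G : ℂ → ℂ} (hG : DifferentiableOn ℂ G Hset) {z : ℂ} (hz : z ∈ Hset)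
    (h : RayDecay G z) :
    HasDerivAt (fun w => ∫ t in Set.Ioi (0 : ℝ), Complex.I * G (w + t * Complex.I)) (-G z) z := by
  have hint := h.integrableOn hG.continuousOn hz
  obtain ⟨C, ε, r, hε, hr, h⟩ := h
  have hz' : 0 < z.im := hz
  -- The factor `2` leaves room for discs of radius `ρ` around every point of the `ρ`-ball: they
  -- stay inside the `r`-ball and inside the half plane.
  obtain ⟨ρ, hρ, hρr, hρz⟩ : ∃ ρ : ℝ, 0 < ρ ∧ 2 * ρ < r ∧ 2 * ρ < z.im :=
    ⟨min r z.im / 4, by positivity, by linarith [min_le_left r z.im], by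
      linarith [min_le_right r z.im]⟩
  have hball : ∀ w ∈ Metric.ball z ρ, w ∈ Hset := by
    intro w hw
    have h1 : |(w - z).im| ≤ ‖w - z‖ := Complex.abs_im_le_norm _
    rw [Metric.mem_ball, dist_eq_norm] at hw
    have h2 := (abs_lt.mp (h1.trans_lt hw)).1
    rw [Complex.sub_im] at h2
    change 0 < w.im
    linarith
  have hball2 : ∀ w ∈ Metric.ball z ρ, ∀ t : ℝ, 0 ≤ t →
      ∀ u ∈ Metric.closedBall (w + t * Complex.I) ρ, u ∈ Hset ∧ ‖G u‖ ≤ C * Real.exp (-ε * t) := by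
    intro w hw t ht u hu
    have hu1 : u - t * Complex.I ∈ Metric.ball z (2 * ρ) := by
      rw [Metric.mem_ball, dist_eq_norm] at *
      rw [Metric.mem_closedBall, dist_eq_norm] at hu
      calc ‖u - t * Complex.I - z‖ = ‖(u - (w + t * Complex.I)) + (w - z)‖ := by congr 1; ring
        _ ≤ _ := norm_add_le _ _
        _ < 2 * ρ := by linarith
    have hmem : u - t * Complex.I ∈ Hset := by
      have h1 : |(u - t * Complex.I - z).im| ≤ ‖u - t * Complex.I - z‖ := Complex.abs_im_le_norm _
      rw [Metric.mem_ball, dist_eq_norm] at hu1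
      have h2 := (abs_lt.mp (h1.trans_lt hu1)).1
      rw [Complex.sub_im] at h2
      change 0 < (u - t * Complex.I).im
      linarith
    constructor
    · simpa using add_mul_I_mem hmem ht
    · simpa using h (u - t * Complex.I) (Metric.ball_subset_ball hρr.le hu1) t ht
  have hderiv : ∀ w ∈ Metric.ball z ρ, ∀ t : ℝ, 0 ≤ t →
      ‖deriv G (w + t * Complex.I)‖ ≤ C * Real.exp (-ε * t) / ρ := by
    intro w hw t ht
    refine Complex.norm_deriv_le_of_forall_mem_sphere_norm_le hρ ?_
      fun u hu => (hball2 w hw t ht u (Metric.sphere_subset_closedBall hu)).2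
    refine DifferentiableOn.diffContOnCl ?_
    rw [closure_ball _ hρ.ne']
    exact hG.mono fun u hu => (hball2 w hw t ht u hu).1
  have hG' : ContinuousOn (deriv G) Hset := (hG.deriv isOpen_Hset).continuousOn
  have key := hasDerivAt_integral_of_dominated_loc_of_deriv_le (μ := volume.restrict (Set.Ioi 0))
    (F := fun (w : ℂ) (t : ℝ) => Complex.I * G (w + t * Complex.I))
    (F' := fun (w : ℂ) (t : ℝ) => Complex.I * deriv G (w + t * Complex.I))
    (bound := fun t => C * Real.exp (-ε * t) / ρ) (x₀ := z) (Metric.ball_mem_nhds z hρ)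
    (by
      filter_upwards [Metric.ball_mem_nhds z hρ] with w hw
      exact (((continuousOn_ray hG.continuousOn (hball w hw)).mono
        Set.Ioi_subset_Ici_self).aestronglyMeasurable measurableSet_Ioi).const_mul _)
    (hint.const_mul _)
    ((((continuousOn_ray hG' hz).mono
        Set.Ioi_subset_Ici_self).aestronglyMeasurable measurableSet_Ioi).const_mul _)
    (by
      filter_upwards [self_mem_ae_restrict measurableSet_Ioi] with t ht w hw
      rw [norm_mul, Complex.norm_I, one_mul]
      exact hderiv w hw t (le_of_lt ht))
    (((exp_neg_integrableOn_Ioi 0 hε).const_mul C).div_const ρ)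
    (by
      filter_upwards [self_mem_ae_restrict measurableSet_Ioi] with t ht w hw
      have h1 := (hG.differentiableAt (isOpen_Hset.mem_nhds
        (add_mul_I_mem (hball w hw) (le_of_lt ht)))).hasDerivAt
      exact (h1.comp_add_const w (t * Complex.I)).const_mul Complex.I)
  refine key.2.congr_deriv ?_
  have hF : ∀ t : ℝ, 0 ≤ t → HasDerivAt (fun t : ℝ => G (z + t * Complex.I))
      (Complex.I * deriv G (z + t * Complex.I)) t := by
    intro t ht
    have h1 := (hG.differentiableAt (isOpen_Hset.mem_nhds (add_mul_I_mem hz ht))).hasDerivAt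
    have h2 : HasDerivAt (fun t : ℂ => z + t * Complex.I) Complex.I (t : ℂ) := by
      simpa using ((hasDerivAt_id (t : ℂ)).mul_const Complex.I).const_add z
    rw [mul_comm]
    exact (h1.comp (t : ℂ) h2).comp_ofReal
  rw [integral_Ioi_of_hasDerivAt_of_tendsto (f := fun t : ℝ => G (z + t * Complex.I)) (m := 0)
    (hF 0 le_rfl).continuousAt.continuousWithinAt (fun t ht => hF t (le_of_lt ht)) key.1]
  · simp
  · refine squeeze_zero_norm' (a := fun t => C * Real.exp (-ε * t)) ?_ ?_
    · filter_upwards [eventually_ge_atTop 0] with t ht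
      exact h z (Metric.mem_ball_self hr) t ht
    · have : Tendsto (fun t : ℝ => Real.exp (-ε * t)) atTop (𝓝 0) := by
        refine Real.tendsto_exp_atBot.comp ?_
        exact tendsto_id.const_mul_atTop_of_neg (by linarith)
      simpa using this.const_mul C

/-! ### Functions with an exponentially approached limit at `i∞` -/

/-- `f` is holomorphic and tends to `c` at `i∞`, exponentially fast. -/
def GoodWith (f : ℍ → ℂ) (c : ℂ) : Prop :=
  DifferentiableOn ℂ (f ∘ ofComplex) Hset ∧
    ∃ ε > 0, ∀ δ > 0, ∃ C : ℝ, ∀ z : ℍ, δ ≤ z.im → ‖f z - c‖ ≤ C * Real.exp (-ε * z.im)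

lemma GoodWith.tendsto {f : ℍ → ℂ} {c : ℂ} (h : GoodWith f c) : Tendsto f atImInfty (𝓝 c) := by
  obtain ⟨-, ε, hε, h⟩ := h
  obtain ⟨C, hC⟩ := h 1 one_pos
  rw [tendsto_iff_norm_sub_tendsto_zero]
  have h1 : Tendsto (fun z : ℍ => C * Real.exp (-ε * z.im)) atImInfty (𝓝 0) := by
    have : Tendsto (fun t : ℝ => Real.exp (-ε * t)) atTop (𝓝 0) :=
      Real.tendsto_exp_atBot.comp (tendsto_id.const_mul_atTop_of_neg (by linarith))
    have h2 := (this.comp (tendsto_comap (f := UpperHalfPlane.im))).const_mul C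
    rw [mul_zero] at h2
    exact h2
  refine squeeze_zero' (Eventually.of_forall fun _ => norm_nonneg _) ?_ h1
  exact (atImInfty_mem _).2 ⟨1, hC⟩

lemma GoodWith.a0_eq {f : ℍ → ℂ} {c : ℂ} (h : GoodWith f c) : a0 f = c :=
  h.tendsto.limUnder_eq

lemma polynomial_growth (p : Polynomial ℂ) :
    ∃ K : ℝ, ∃ N : ℕ, 0 ≤ K ∧ ∀ w : ℂ, ‖p.eval w‖ ≤ K * (1 + ‖w‖) ^ N := by
  induction p using Polynomial.induction_on' with
  | add p q hp hq =>
    obtain ⟨K, N, hK, hp⟩ := hp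
    obtain ⟨L, M, hL, hq⟩ := hq
    refine ⟨K + L, max N M, by positivity, fun w => ?_⟩
    rw [Polynomial.eval_add, add_mul]
    have h1 : (1 : ℝ) ≤ 1 + ‖w‖ := by linarith [norm_nonneg w]
    refine (norm_add_le _ _).trans (add_le_add ((hp w).trans ?_) ((hq w).trans ?_))
    · gcongr
      · exact le_max_left _ _
    · gcongr
      · exact le_max_right _ _
  | monomial n a =>
    refine ⟨‖a‖, n, norm_nonneg _, fun w => ?_⟩
    rw [Polynomial.eval_monomial, norm_mul, norm_pow]
    gcongr
    linarith

/-- Half of the exponential rate is spent on absorbing the polynomial factor; the rate `ε / 2`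
remains. -/
lemma GoodWith.rayDecay {f : ℍ → ℂ} {c : ℂ} (h : GoodWith f c) (p : Polynomial ℂ) {z : ℂ}
    (hz : z ∈ Hset) : RayDecay (fun w => (f (ofComplex w) - c) * p.eval w) z := by
  obtain ⟨-, ε, hε, h⟩ := h
  have hz' : 0 < z.im := hz
  obtain ⟨C, hC⟩ := h (z.im / 2) (by positivity)
  obtain ⟨K, N, hK, hp⟩ := polynomial_growth p
  -- With this choice `N η ≤ ε / 2`, so the `N`-th power of the bound `M exp(η t)` costs at most
  -- `exp(ε t / 2)`. The `+ 1` keeps the denominator nonzero for `N = 0`.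
  set η : ℝ := ε / (2 * (N + 1)) with hη
  have hη0 : 0 < η := by positivity
  have hC0 : 0 ≤ C := by
    have := (norm_nonneg _).trans (hC ⟨z, hz⟩ (by change z.im / 2 ≤ z.im; linarith))
    exact nonneg_of_mul_nonneg_left this (Real.exp_pos _)
  set M : ℝ := 1 + ‖z‖ + z.im + 1 / η with hM
  refine ⟨C * K * M ^ N, ε / 2, z.im / 2, by positivity, by positivity, fun w hw t ht => ?_⟩
  rw [Metric.mem_ball, dist_eq_norm] at hw
  have hwim : z.im / 2 ≤ w.im := by
    have h2 := (abs_lt.mp ((Complex.abs_im_le_norm (w - z)).trans_lt hw)).1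
    rw [Complex.sub_im] at h2
    linarith
  have hw0 : w + t * Complex.I ∈ Hset := add_mul_I_mem (show 0 < w.im by linarith) ht
  have him : (w + t * Complex.I).im = w.im + t := by simp
  have h1 : ‖f (ofComplex (w + t * Complex.I)) - c‖ ≤ C * Real.exp (-ε * t) := by
    rw [ofComplex_apply_of_im_pos hw0]
    refine (hC _ ?_).trans ?_
    · change _ ≤ (w + t * Complex.I).im
      linarith
    · refine mul_le_mul_of_nonneg_left (Real.exp_le_exp.2 ?_) hC0
      change -ε * (w + t * Complex.I).im ≤ _
      rw [him]
      nlinarith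
  have h2 : ‖p.eval (w + t * Complex.I)‖ ≤ K * M ^ N * Real.exp (ε / 2 * t) := by
    have h3 : 1 + ‖w + t * Complex.I‖ ≤ M * Real.exp (η * t) := by
      have h4 : ‖w‖ ≤ ‖z‖ + z.im := by
        have := norm_le_norm_add_norm_sub' w z
        linarith
      have h5 : ‖w + t * Complex.I‖ ≤ ‖w‖ + t := by
        refine (norm_add_le _ _).trans ?_
        simp [abs_of_nonneg ht]
      have h6 : η * t ≤ Real.exp (η * t) := by
        linarith [Real.add_one_le_exp (η * t)]
      have h7 : 1 ≤ Real.exp (η * t) := Real.one_le_exp (by positivity)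
      have h8 : t ≤ 1 / η * Real.exp (η * t) := by
        calc t = 1 / η * (η * t) := by field_simp
          _ ≤ _ := by gcongr
      have h9 : 1 + ‖z‖ + z.im ≤ (1 + ‖z‖ + z.im) * Real.exp (η * t) :=
        le_mul_of_one_le_right (by positivity) h7
      rw [hM, add_mul _ (1 / η)]
      linarith
    refine (hp _).trans ?_
    rw [mul_assoc]
    refine mul_le_mul_of_nonneg_left ?_ hK
    refine (pow_le_pow_left₀ (by positivity) h3 N).trans ?_
    rw [mul_pow, ← Real.exp_nat_mul]
    refine mul_le_mul_of_nonneg_left (Real.exp_le_exp.2 ?_) (by positivity)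
    rw [← mul_assoc]
    refine mul_le_mul_of_nonneg_right ?_ ht
    rw [hη, mul_div_assoc', div_le_div_iff₀ (by positivity) (by positivity)]
    nlinarith
  rw [norm_mul]
  calc _ ≤ (C * Real.exp (-ε * t)) * (K * M ^ N * Real.exp (ε / 2 * t)) := by gcongr
    _ = C * K * M ^ N * (Real.exp (-ε * t) * Real.exp (ε / 2 * t)) := by ring
    _ = _ := by
      rw [← Real.exp_add]
      congr 2
      ring

lemma GoodWith.differentiableOn_mul {f : ℍ → ℂ} {c : ℂ} (h : GoodWith f c) (p : Polynomial ℂ) :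
    DifferentiableOn ℂ (fun w => (f (ofComplex w) - c) * p.eval w) Hset :=
  (h.1.sub_const c).mul p.differentiable.differentiableOn

lemma GoodWith.integrableOn_ray {f : ℍ → ℂ} {c : ℂ} (h : GoodWith f c) (p : Polynomial ℂ) {z : ℂ}
    (hz : z ∈ Hset) :
    IntegrableOn (fun t : ℝ => (f (ofComplex (z + t * Complex.I)) - c) *
      p.eval (z + t * Complex.I)) (Set.Ioi 0) :=
  (h.rayDecay p hz).integrableOn (h.differentiableOn_mul p).continuousOn hz

/-! ### Primitives -/

/-- The value of `F̌_n(z)` at `T`. -/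
def fchk (n : ℕ) (T : Fin 2 → ℂ) (z : ℂ) : ℂ :=
  ∑ k ∈ Finset.range (n + 1),
    (n.choose k : ℂ) / (k + 1) * z ^ (k + 1) * T 0 ^ k * T 1 ^ (n - k)

lemma eval_Fcheck (n : ℕ) (z : ℍ) (T : Fin 2 → ℂ) :
    MvPolynomial.eval T (Fcheck n z) = fchk n T z := by
  rw [Fcheck, eval_homog, fchk]
  refine Finset.sum_congr rfl fun k hk => ?_
  have hk' : k ≤ n := Nat.lt_succ_iff.mp (Finset.mem_range.mp hk)
  congr 3
  rw [Nat.cast_choose ℂ hk', Nat.factorial_succ]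
  push_cast
  have h1 : (k : ℂ) + 1 ≠ 0 := by exact_mod_cast Nat.succ_ne_zero k
  have h2 : ((k.factorial : ℕ) : ℂ) ≠ 0 := by exact_mod_cast k.factorial_ne_zero
  have h3 : (((n - k).factorial : ℕ) : ℂ) ≠ 0 := by exact_mod_cast (n - k).factorial_ne_zero
  field_simp

lemma hasDerivAt_fchk (n : ℕ) (T : Fin 2 → ℂ) (z : ℂ) :
    HasDerivAt (fchk n T) ((z * T 0 + T 1) ^ n) z := by
  have h : (z * T 0 + T 1) ^ n =
      ∑ k ∈ Finset.range (n + 1), (n.choose k : ℂ) / (k + 1) * (((k + 1 : ℕ) : ℂ) * z ^ k) *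
        T 0 ^ k * T 1 ^ (n - k) := by
    rw [add_pow]
    refine Finset.sum_congr rfl fun k _ => ?_
    have h1 : (k : ℂ) + 1 ≠ 0 := by exact_mod_cast Nat.succ_ne_zero k
    push_cast
    rw [mul_pow]
    field_simp
  rw [h]
  unfold fchk
  refine HasDerivAt.fun_sum fun k _ => ?_
  have h2 := hasDerivAt_pow (k + 1) z
  rw [Nat.add_sub_cancel] at h2
  exact ((h2.const_mul _).mul_const _).mul_const _

@[simp] lemma fchk_zero (n : ℕ) (T : Fin 2 → ℂ) : fchk n T 0 = 0 := by
  simp [fchk]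

/-- The polynomial `(z S₀ + S₁)^n` in `z`. -/
def linPow (n : ℕ) (T : Fin 2 → ℂ) : Polynomial ℂ :=
  (Polynomial.X * Polynomial.C (T 0) + Polynomial.C (T 1)) ^ n

lemma eval_linPow (n : ℕ) (T : Fin 2 → ℂ) (z : ℂ) :
    (linPow n T).eval z = (z * T 0 + T 1) ^ n := by
  simp only [linPow, Polynomial.eval_pow, Polynomial.eval_add, Polynomial.eval_mul,
    Polynomial.eval_X, Polynomial.eval_C]

/-- The regularized primitive of `f(z) (z T₀ + T₁)^n` at `i∞`. -/
def Eprim (n : ℕ) (f : ℍ → ℂ) (c : ℂ) (T : Fin 2 → ℂ) (z : ℂ) : ℂ :=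
  c * fchk n T z - ∫ t in Set.Ioi (0 : ℝ), Complex.I *
    ((f (ofComplex (z + t * Complex.I)) - c) * (linPow n T).eval (z + t * Complex.I))

lemma hasDerivAt_Eprim {f : ℍ → ℂ} {c : ℂ} (h : GoodWith f c) (n : ℕ) (T : Fin 2 → ℂ) {z : ℂ}
    (hz : z ∈ Hset) :
    HasDerivAt (Eprim n f c T) (f (ofComplex z) * (z * T 0 + T 1) ^ n) z := by
  have h1 := (hasDerivAt_fchk n T z).const_mul c
  have h2 := hasDerivAt_ray (h.differentiableOn_mul (linPow n T)) hz (h.rayDecay _ hz)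
  refine (h1.sub h2).congr_deriv ?_
  rw [eval_linPow]
  ring

/-! ### Evaluating the cochain -/

open MvPolynomial in
lemma coeff_homog {K : Type} [Field K] {n k : ℕ} (hk : k ≤ n) (c : ℕ → K) :
    (homog n c).coeff (expo k (n - k)) = c k := by
  have hX : ∀ (c : K) k l, C c * X 0 ^ k * X 1 ^ l = monomial (expo k l) c := by
    intro c k l
    rw [mul_assoc, X_pow_eq_monomial, X_pow_eq_monomial, monomial_mul, C_mul_monomial, expo]
    simp
  simp only [homog, hX, coeff_sum, coeff_monomial]
  rw [Finset.sum_eq_single k]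
  · simp
  · intro l _ hl
    refine if_neg fun h => hl ?_
    have := DFunLike.congr_fun h 0
    simpa [expo] using this
  · intro h
    simp at h
    omega

lemma act_F (n : ℕ) (γ : GL(2, ℚ)⁺) (z : ℍ) :
    act n γ (F n z) = homog n fun k => detFac ℂ n γ * (n.choose k *
      ((entry γ 0 0 : ℂ) * z + entry γ 0 1) ^ k *
        ((entry γ 1 0 : ℂ) * z + entry γ 1 1) ^ (n - k)) := by
  refine MvPolynomial.funext fun T => ?_
  rw [eval_act, eval_F, eval_homog]
  have : (z : ℂ) * rowMul T γ 0 + rowMul T γ 1 =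
      ((entry γ 0 0 : ℂ) * z + entry γ 0 1) * T 0 + ((entry γ 1 0 : ℂ) * z + entry γ 1 1) * T 1 := by
    simp [rowMul]
    ring
  rw [this, add_pow, Finset.mul_sum]
  refine Finset.sum_congr rfl fun k _ => ?_
  rw [mul_pow, mul_pow]
  ring

lemma act_one {K : Type} [Field K] [Algebra ℝ K] [CharZero K] (n : ℕ)
    (P : MvPolynomial (Fin 2) K) : act n 1 P = P := by
  refine MvPolynomial.funext fun T => ?_
  rw [eval_act, detFac_one, rowMul_one, one_mul]

/-- The coefficients of `γ · F_n(z)` as polynomials in `z`. -/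
def actCoeff (n : ℕ) (γ : GL(2, ℚ)⁺) (k : ℕ) : Polynomial ℂ :=
  Polynomial.C (detFac ℂ n γ) * (Polynomial.C (n.choose k : ℂ) *
    (Polynomial.C (entry γ 0 0 : ℂ) * Polynomial.X + Polynomial.C (entry γ 0 1 : ℂ)) ^ k *
    (Polynomial.C (entry γ 1 0 : ℂ) * Polynomial.X + Polynomial.C (entry γ 1 1 : ℂ)) ^ (n - k))

lemma coeff_act_F {n k : ℕ} (hk : k ≤ n) (γ : GL(2, ℚ)⁺) (z : ℍ) :
    (act n γ (F n z)).coeff (expo k (n - k)) = (actCoeff n γ k).eval (z : ℂ) := by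
  rw [act_F, coeff_homog hk, actCoeff]
  simp only [Polynomial.eval_mul, Polynomial.eval_pow, Polynomial.eval_add, Polynomial.eval_C,
    Polynomial.eval_X]

lemma eval_act_F (n : ℕ) (γ : GL(2, ℚ)⁺) (z : ℍ) (T : Fin 2 → ℂ) :
    MvPolynomial.eval T (act n γ (F n z)) =
      detFac ℂ n γ * (linPow n (rowMul T γ)).eval (z : ℂ) := by
  rw [eval_act, eval_F, eval_linPow]

lemma coe_ofComplex {w : ℂ} (hw : w ∈ Hset) : ((ofComplex w : ℍ) : ℂ) = w := by
  rw [ofComplex_apply_of_im_pos hw]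

open MvPolynomial in
-- The integrals are defined coefficient by coefficient; evaluation at `T` moves the finite sum
-- inside, each coefficient being integrable. Both ray integrals of `tauTilde` are covered, the
-- first one with `γ = 1`.
lemma eval_rayInt_act {f : ℍ → ℂ} {c : ℂ} (hf : GoodWith f c) (n : ℕ) (γ : GL(2, ℚ)⁺) (z : ℍ)
    (T : Fin 2 → ℂ) :
    eval T (rayInt n (fun z => C (tilde f z) * act n γ (F n z)) z) =
      detFac ℂ n γ * ∫ t in Set.Ioi (0 : ℝ), Complex.I * ((f (ofComplex ((z : ℂ) + t * Complex.I)) - c) *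
        (linPow n (rowMul T γ)).eval ((z : ℂ) + t * Complex.I)) := by
  have hz : (z : ℂ) ∈ Hset := z.2
  rw [rayInt, eval_homog, ← integral_const_mul]
  have h1 : ∀ k ∈ Finset.range (n + 1), (∫ t in Set.Ioi (0 : ℝ), Complex.I *
      coeff (expo k (n - k)) (C (tilde f (ofComplex ((z : ℂ) + t * Complex.I))) *
        act n γ (F n (ofComplex ((z : ℂ) + t * Complex.I))))) * T 0 ^ k * T 1 ^ (n - k) =
      ∫ t in Set.Ioi (0 : ℝ), (Complex.I * ((f (ofComplex ((z : ℂ) + t * Complex.I)) - c) *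
        (actCoeff n γ k).eval ((z : ℂ) + t * Complex.I))) * (T 0 ^ k * T 1 ^ (n - k)) := by
    intro k hk
    rw [integral_mul_const, mul_assoc]
    congr 1
    refine setIntegral_congr_fun measurableSet_Ioi fun t ht => ?_
    have hk' : k ≤ n := Nat.lt_succ_iff.mp (Finset.mem_range.mp hk)
    simp only [coeff_C_mul, coeff_act_F hk', tilde, hf.a0_eq,
      coe_ofComplex (add_mul_I_mem hz (le_of_lt ht))]
  rw [Finset.sum_congr rfl h1, ← integral_finsetSum]
  · refine setIntegral_congr_fun measurableSet_Ioi fun t ht => ?_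
    have h2 := eval_act_F n γ (ofComplex ((z : ℂ) + t * Complex.I)) T
    rw [eval_eq_sum (isHomogeneous_act (isHomogeneous_F n _) γ),
      coe_ofComplex (add_mul_I_mem hz (le_of_lt ht))] at h2
    rw [mul_left_comm (detFac ℂ n γ), mul_left_comm (detFac ℂ n γ), ← h2, Finset.mul_sum,
      Finset.mul_sum]
    refine Finset.sum_congr rfl fun k hk => ?_
    have hk' : k ≤ n := Nat.lt_succ_iff.mp (Finset.mem_range.mp hk)
    rw [coeff_act_F hk', coe_ofComplex (add_mul_I_mem hz (le_of_lt ht))]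
    ring
  · intro k _
    exact ((hf.integrableOn_ray (actCoeff n γ k) hz).const_mul _).mul_const _

lemma segment_mem {z w : ℂ} (hz : z ∈ Hset) (hw : w ∈ Hset) {t : ℝ} (ht : t ∈ Set.Icc (0 : ℝ) 1) :
    z + t * (w - z) ∈ Hset := by
  have h := (convex_halfSpace_im_gt 0).add_smul_sub_mem hz hw ht
  simpa using h

open MvPolynomial in
lemma eval_segInt {f : ℍ → ℂ} {c : ℂ} (hf : GoodWith f c) (n : ℕ) (z w : ℍ) (T : Fin 2 → ℂ) :
    eval T (segInt n (fun z => C (f z) * F n z) z w) = Eprim n f c T w - Eprim n f c T z := by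
  have hz : (z : ℂ) ∈ Hset := z.2
  have hw : (w : ℂ) ∈ Hset := w.2
  have hcont : ∀ p : Polynomial ℂ, ContinuousOn (fun t : ℝ => ((w : ℂ) - z) *
      (f (ofComplex ((z : ℂ) + t * ((w : ℂ) - z))) * p.eval ((z : ℂ) + t * ((w : ℂ) - z))))
      (Set.uIcc (0 : ℝ) 1) := by
    intro p
    rw [Set.uIcc_of_le zero_le_one]
    refine continuousOn_const.mul (ContinuousOn.mul ?_ ?_)
    · exact hf.1.continuousOn.comp (by fun_prop) fun t ht => segment_mem hz hw ht
    · exact (p.continuous.comp (by fun_prop)).continuousOn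
  rw [segInt, eval_homog]
  have h1 : ∀ k ∈ Finset.range (n + 1), (∫ t in (0 : ℝ)..1, ((w : ℂ) - z) *
      coeff (expo k (n - k)) (C (f (ofComplex ((z : ℂ) + t * ((w : ℂ) - z)))) *
        (F n (ofComplex ((z : ℂ) + t * ((w : ℂ) - z)))))) * T 0 ^ k * T 1 ^ (n - k) =
      ∫ t in (0 : ℝ)..1, (((w : ℂ) - z) * (f (ofComplex ((z : ℂ) + t * ((w : ℂ) - z))) *
        (actCoeff n 1 k).eval ((z : ℂ) + t * ((w : ℂ) - z)))) * (T 0 ^ k * T 1 ^ (n - k)) := by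
    intro k hk
    rw [intervalIntegral.integral_mul_const, mul_assoc]
    congr 1
    refine intervalIntegral.integral_congr fun t ht => ?_
    rw [Set.uIcc_of_le zero_le_one] at ht
    have hk' : k ≤ n := Nat.lt_succ_iff.mp (Finset.mem_range.mp hk)
    have h2 := coeff_act_F hk' 1 (ofComplex ((z : ℂ) + t * ((w : ℂ) - z)))
    rw [act_one, coe_ofComplex (segment_mem hz hw ht)] at h2
    simp only [coeff_C_mul, h2]
  rw [Finset.sum_congr rfl h1, ← intervalIntegral.integral_finsetSum]
  · have hderiv : ∀ t ∈ Set.uIcc (0 : ℝ) 1,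
        HasDerivAt (fun t : ℝ => Eprim n f c T ((z : ℂ) + t * ((w : ℂ) - z)))
          (((w : ℂ) - z) * (f (ofComplex ((z : ℂ) + t * ((w : ℂ) - z))) *
            (linPow n T).eval ((z : ℂ) + t * ((w : ℂ) - z)))) t := by
      intro t ht
      rw [Set.uIcc_of_le zero_le_one] at ht
      have h3 := hasDerivAt_Eprim hf n T (segment_mem hz hw ht)
      have h4 : HasDerivAt (fun t : ℂ => (z : ℂ) + t * ((w : ℂ) - z)) ((w : ℂ) - z) (t : ℂ) := by
        simpa using ((hasDerivAt_id (t : ℂ)).mul_const ((w : ℂ) - z)).const_add (z : ℂ)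
      rw [eval_linPow, mul_comm]
      exact (h3.comp (t : ℂ) h4).comp_ofReal
    have h5 := intervalIntegral.integral_eq_sub_of_hasDerivAt hderiv
      (hcont (linPow n T)).intervalIntegrable
    simp only [Complex.ofReal_one, one_mul, Complex.ofReal_zero, zero_mul, add_zero,
      add_sub_cancel] at h5
    rw [← h5]
    refine intervalIntegral.integral_congr fun t ht => ?_
    rw [Set.uIcc_of_le zero_le_one] at ht
    have h2 := eval_act_F n 1 (ofComplex ((z : ℂ) + t * ((w : ℂ) - z))) T
    rw [eval_eq_sum (isHomogeneous_act (isHomogeneous_F n _) 1), detFac_one, one_mul, rowMul_one,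
      coe_ofComplex (segment_mem hz hw ht)] at h2
    rw [← h2, Finset.mul_sum, Finset.mul_sum]
    refine Finset.sum_congr rfl fun k hk => ?_
    have hk' : k ≤ n := Nat.lt_succ_iff.mp (Finset.mem_range.mp hk)
    rw [coeff_act_F hk', coe_ofComplex (segment_mem hz hw ht)]
    ring
  · intro k _
    exact (hcont _).intervalIntegrable.mul_const _

/-- The segment integral is `E(γ z₀) - E(z₀)`. The term `a₀(g) F̌(z₀)` and the first ray integral
make up `E(z₀)` and cancel it; the two remaining terms form the primitive of `f | γ` at `T γ`. -/
lemma eval_Psi {m : ℕ} {f : ℍ → ℂ} {γ : GL(2, ℚ)⁺} {c c' : ℂ} (hf : GoodWith f c)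
    (hγ : GoodWith (slash m γ f) c') (z₀ : ℍ) (T : Fin 2 → ℂ) :
    MvPolynomial.eval T (Psi m z₀ f γ) = Eprim (m - 2) f c T (moeb γ z₀) -
      detFac ℂ (m - 2) γ * Eprim (m - 2) (slash m γ f) c' (rowMul T γ) z₀ := by
  have h1 := eval_rayInt_act hf (m - 2) 1 z₀ T
  have h2 := eval_rayInt_act hγ (m - 2) γ z₀ T
  simp only [act_one, detFac_one, rowMul_one, one_mul] at h1
  rw [Psi, tauTilde, if_pos ⟨by simp [U], by simp [U]⟩]
  simp only [U, slash_zero_one, mul_one, map_add, map_sub, map_mul, MvPolynomial.eval_C]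
  rw [eval_segInt hf, h1, h2, eval_act, eval_Fcheck, eval_Fcheck, hf.a0_eq, hγ.a0_eq]
  simp only [Eprim]
  ring

lemma isHomogeneous_Fcheck (n : ℕ) (z : ℍ) : (Fcheck n z).IsHomogeneous n :=
  isHomogeneous_homog _ _

open MvPolynomial in
lemma isHomogeneous_C_mul {K : Type} [Field K] {n : ℕ} {P : MvPolynomial (Fin 2) K}
    (hP : P.IsHomogeneous n) (a : K) : (C a * P).IsHomogeneous n := by
  have h := (isHomogeneous_C (Fin 2) a).mul hP
  rwa [zero_add] at h

lemma isHomogeneous_Psi (m : ℕ) (z₀ : ℍ) (f : ℍ → ℂ) (γ : GL(2, ℚ)⁺) :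
    (Psi m z₀ f γ).IsHomogeneous (m - 2) := by
  rw [Psi, tauTilde]
  split_ifs
  · exact ((((isHomogeneous_homog _ _).add (isHomogeneous_C_mul (isHomogeneous_Fcheck _ _) _)).sub
      (isHomogeneous_C_mul (isHomogeneous_act (isHomogeneous_Fcheck _ _) _) _)).sub
      (isHomogeneous_homog _ _)).add (isHomogeneous_homog _ _)
  · exact MvPolynomial.isHomogeneous_zero _ _ _

/-! ### Independence of the base point and the cocycle relation -/

lemma hasDerivAt_moeb (γ : GL(2, ℚ)⁺) (z : ℍ) :
    HasDerivAt (fun w : ℂ => ((entry γ 0 0 : ℂ) * w + entry γ 0 1) /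
        ((entry γ 1 0 : ℂ) * w + entry γ 1 1))
      ((realDet γ : ℂ) / denom (toReal γ) z ^ 2) z := by
  have h := denom_toReal_ne γ z
  have h1 : HasDerivAt (fun w : ℂ => (entry γ 0 0 : ℂ) * w + entry γ 0 1) (entry γ 0 0 : ℂ) z := by
    simpa using ((hasDerivAt_id (z : ℂ)).const_mul (entry γ 0 0 : ℂ)).add_const (entry γ 0 1 : ℂ)
  have h2 : HasDerivAt (fun w : ℂ => (entry γ 1 0 : ℂ) * w + entry γ 1 1) (entry γ 1 0 : ℂ) z := by
    simpa using ((hasDerivAt_id (z : ℂ)).const_mul (entry γ 1 0 : ℂ)).add_const (entry γ 1 1 : ℂ)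
  refine (h1.div h2 h).congr_deriv ?_
  rw [denom_toReal, realDet_eq]
  push_cast
  congr 1
  ring

/-- The normalizations of the action on `W_{m-2}` and of the weight `m` slash combine to the
exponent `1`, and `det γ` is the numerator of the derivative of `z ↦ γ z`. -/
lemma detFac_rpow {m : ℕ} (hm : 2 ≤ m) (γ : GL(2, ℚ)⁺) :
    detFac ℂ (m - 2) γ * ((realDet γ ^ (((m : ℤ) : ℝ) / 2) : ℝ) : ℂ) = (realDet γ : ℂ) := by
  rw [detFac, Complex.coe_algebraMap, ← Complex.ofReal_mul, ← Real.rpow_add (realDet_pos γ)]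
  have : -((m - 2 : ℕ) : ℝ) / 2 + ((m : ℤ) : ℝ) / 2 = 1 := by
    push_cast [Nat.cast_sub hm]
    ring
  rw [this, Real.rpow_one]

/-- Both primitives have the same derivative along `z`: the linear form contributes `(cz +
d)^{-(m-2)}` and the differential of `γ z` contributes `(cz + d)^{-2}`, together the automorphy
factor of weight `m`. The half plane is connected, so the difference is constant. -/
lemma Psi_formula_const {m : ℕ} (hm : 2 ≤ m) {f : ℍ → ℂ} {γ : GL(2, ℚ)⁺} {c c' : ℂ}
    (hf : GoodWith f c) (hγ : GoodWith (slash m γ f) c') (T : Fin 2 → ℂ) (z w : ℍ) :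
    Eprim (m - 2) f c T (moeb γ z) -
      detFac ℂ (m - 2) γ * Eprim (m - 2) (slash m γ f) c' (rowMul T γ) z =
    Eprim (m - 2) f c T (moeb γ w) -
      detFac ℂ (m - 2) γ * Eprim (m - 2) (slash m γ f) c' (rowMul T γ) w := by
  set Φ : ℂ → ℂ := fun u =>
    Eprim (m - 2) f c T (((entry γ 0 0 : ℂ) * u + entry γ 0 1) /
        ((entry γ 1 0 : ℂ) * u + entry γ 1 1)) -
      detFac ℂ (m - 2) γ * Eprim (m - 2) (slash m γ f) c' (rowMul T γ) u with hΦ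
  have hd : ∀ u ∈ Hset, HasDerivAt Φ 0 u := by
    intro u hu
    lift u to ℍ using hu
    have h1 := hasDerivAt_moeb γ u
    have h2 := hasDerivAt_Eprim hf (m - 2) T (moeb γ u).2
    have h3 := (hasDerivAt_Eprim hγ (m - 2) (rowMul T γ) u.2).const_mul (detFac ℂ (m - 2) γ)
    have h4 : HasDerivAt (Eprim (m - 2) f c T) (f (moeb γ u) * ((moeb γ u : ℂ) * T 0 + T 1) ^ (m - 2))
        (((entry γ 0 0 : ℂ) * u + entry γ 0 1) / ((entry γ 1 0 : ℂ) * u + entry γ 1 1)) := by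
      rw [← coe_moeb]
      convert h2 using 3
      exact (ofComplex_apply _).symm
    refine ((h4.comp (u : ℂ) h1).sub h3).congr_deriv ?_
    have hofc : ofComplex ((u : ℍ) : ℂ) = u := ofComplex_apply u
    have hdn := denom_ne_zero (toReal γ) u
    have hrow : (u : ℂ) * rowMul T γ 0 + rowMul T γ 1 =
        denom (toReal γ) u * ((moeb γ u : ℂ) * T 0 + T 1) := by
      have aux : ∀ p d a b : ℂ, d ≠ 0 → d * (p / d * a + b) = p * a + d * b := by
        intro p d a b hd
        field_simp
      rw [denom_toReal] at hdn
      rw [coe_moeb, denom_toReal, aux _ _ _ _ hdn]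
      simp [rowMul]
      ring
    rw [show ((u : ℍ).1 : ℂ) = (u : ℂ) from rfl, hofc, hrow, slash_apply, mul_pow]
    have e : denom (toReal γ) u ^ (-(m : ℤ)) * denom (toReal γ) u ^ (m - 2) =
        (denom (toReal γ) u ^ 2)⁻¹ := by
      rw [zpow_neg, zpow_natCast]
      conv_lhs => rw [← Nat.sub_add_cancel hm, pow_add]
      rw [Nat.add_sub_cancel]
      have h5 : denom (toReal γ) u ^ (m - 2) ≠ 0 := pow_ne_zero _ hdn
      field_simp
    calc _ = f (moeb γ u) * ((moeb γ u : ℂ) * T 0 + T 1) ^ (m - 2) *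
          ((realDet γ : ℂ) * (denom (toReal γ) u ^ 2)⁻¹ -
            (detFac ℂ (m - 2) γ * ((realDet γ ^ (((m : ℤ) : ℝ) / 2) : ℝ) : ℂ)) *
            (denom (toReal γ) u ^ (-(m : ℤ)) * denom (toReal γ) u ^ (m - 2))) := by
            rw [div_eq_mul_inv]; ring
      _ = 0 := by rw [e, detFac_rpow hm, sub_self, mul_zero]
  have h := isOpen_Hset.is_const_of_deriv_eq_zero isPreconnected_Hset
    (fun u hu => (hd u hu).differentiableAt.differentiableWithinAt) (fun u hu => (hd u hu).deriv)
    (show (z : ℂ) ∈ Hset from z.2) (show (w : ℂ) ∈ Hset from w.2)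
  simpa only [hΦ, ← coe_moeb] using h

/-- `f | γ` is holomorphic with an exponentially approached limit at `i∞`, for all `γ`. -/
def GoodAll (m : ℕ) (f : ℍ → ℂ) : Prop :=
  ∀ γ : GL(2, ℚ)⁺, ∃ c, GoodWith (slash m γ f) c

lemma GoodAll.slash {m : ℕ} {f : ℍ → ℂ} (h : GoodAll m f) (α : GL(2, ℚ)⁺) :
    GoodAll m (slash m α f) := by
  intro γ
  rw [← slash_mul_group]
  exact h _

lemma GoodAll.self {m : ℕ} {f : ℍ → ℂ} (h : GoodAll m f) : ∃ c, GoodWith f c := by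
  simpa using h 1

lemma Psi_indep {m : ℕ} (hm : 2 ≤ m) {f : ℍ → ℂ} (h : GoodAll m f) (z₀ z₁ : ℍ)
    (γ : GL(2, ℚ)⁺) : Psi m z₀ f γ = Psi m z₁ f γ := by
  obtain ⟨c, hc⟩ := h.self
  obtain ⟨c', hc'⟩ := h γ
  refine MvPolynomial.funext fun T => ?_
  rw [eval_Psi hc hc', eval_Psi hc hc', Psi_formula_const hm hc hc' T z₀ z₁]

/-- Once the base point of `Ψ(α)` is moved to `β z₀`, the primitive of `f | α` at `β z₀` occurs
twice with opposite signs. -/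
lemma Psi_cocycle {m : ℕ} (hm : 2 ≤ m) {f : ℍ → ℂ} (h : GoodAll m f) (z₀ : ℍ)
    (α β : GL(2, ℚ)⁺) : Psi m z₀ f (α * β) = Psi m z₀ f α + act (m - 2) α
      (Psi m z₀ (slash m α f) β) := by
  obtain ⟨c, hc⟩ := h.self
  obtain ⟨c', hc'⟩ := h α
  obtain ⟨c'', hc''⟩ := h (α * β)
  refine MvPolynomial.funext fun T => ?_
  rw [Psi_indep hm h z₀ (moeb β z₀) α, map_add, eval_act, eval_Psi hc hc', eval_Psi hc hc'',
    eval_Psi hc' (by rwa [← slash_mul_group]), moeb_mul, detFac_mul, rowMul_mul, slash_mul_group]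
  ring

lemma Psi_one {m : ℕ} {f : ℍ → ℂ} (h : GoodAll m f) (z₀ : ℍ) : Psi m z₀ f 1 = 0 := by
  obtain ⟨c, hc⟩ := h.self
  refine MvPolynomial.funext fun T => ?_
  rw [eval_Psi hc (by simpa using hc)]
  simp

/-! ### Upper triangular matrices -/

lemma borel_aux {β : GL(2, ℚ)⁺} (hβ : entry β 1 0 = 0) :
    (entry β 1 1 : ℝ) ≠ 0 ∧ (0 : ℝ) < entry β 0 0 / entry β 1 1 ∧
      realDet β = entry β 0 0 * entry β 1 1 := by
  have h := realDet_pos β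
  have h1 : realDet β = entry β 0 0 * entry β 1 1 := by
    rw [realDet_eq, hβ]
    simp
  rw [h1] at h
  have h2 : (entry β 1 1 : ℝ) ≠ 0 := right_ne_zero_of_mul h.ne'
  refine ⟨h2, ?_, h1⟩
  have : (entry β 0 0 : ℝ) / entry β 1 1 = (entry β 0 0 * entry β 1 1) / (entry β 1 1) ^ 2 := by
    field_simp
  rw [this]
  positivity

lemma coe_moeb_borel {β : GL(2, ℚ)⁺} (hβ : entry β 1 0 = 0) (z : ℍ) :
    (moeb β z : ℂ) = ((entry β 0 0 / entry β 1 1 : ℝ) : ℂ) * z +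
      ((entry β 0 1 / entry β 1 1 : ℝ) : ℂ) := by
  rw [coe_moeb, hβ]
  push_cast
  rw [zero_mul, zero_add]
  ring

/-- The automorphy factor `det(β)^{m/2} d^{-m}` of an upper triangular matrix. -/
def borelFac (m : ℕ) (β : GL(2, ℚ)⁺) : ℂ :=
  ((realDet β ^ (((m : ℤ) : ℝ) / 2) : ℝ) : ℂ) * (entry β 1 1 : ℂ) ^ (-(m : ℤ))

lemma slash_borel {m : ℕ} {β : GL(2, ℚ)⁺} (hβ : entry β 1 0 = 0) (f : ℍ → ℂ) (z : ℍ) :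
    slash m β f z = borelFac m β * f (moeb β z) := by
  rw [slash_apply, denom_toReal, hβ, borelFac]
  simp

lemma borel_mem {p : ℝ} (hp : 0 < p) (q : ℝ) {w : ℂ} (hw : w ∈ Hset) :
    (p : ℂ) * w + q ∈ Hset := by
  have : 0 < w.im := hw
  change 0 < ((p : ℂ) * w + q).im
  simp
  positivity

lemma ofComplex_borel {β : GL(2, ℚ)⁺} (hβ : entry β 1 0 = 0) {w : ℂ} (hw : w ∈ Hset) :
    moeb β (ofComplex w) = ofComplex (((entry β 0 0 / entry β 1 1 : ℝ) : ℂ) * w +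
      ((entry β 0 1 / entry β 1 1 : ℝ) : ℂ)) := by
  apply UpperHalfPlane.ext
  rw [coe_moeb_borel hβ, coe_ofComplex hw, coe_ofComplex (borel_mem (borel_aux hβ).2.1 _ hw)]

lemma GoodWith.slash_borel {m : ℕ} {f : ℍ → ℂ} {c : ℂ} (h : GoodWith f c) {β : GL(2, ℚ)⁺}
    (hβ : entry β 1 0 = 0) : GoodWith (slash m β f) (borelFac m β * c) := by
  obtain ⟨hd, hp, -⟩ := borel_aux hβ
  obtain ⟨hf, ε, hε, hdec⟩ := h
  set p : ℝ := entry β 0 0 / entry β 1 1 with hpdef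
  constructor
  · have h1 : DifferentiableOn ℂ (fun w => borelFac m β *
        (f ∘ ofComplex) ((p : ℂ) * w + ((entry β 0 1 / entry β 1 1 : ℝ) : ℂ))) Hset :=
      (hf.comp (by fun_prop) fun w hw => borel_mem hp _ hw).const_mul _
    refine h1.congr fun w hw => ?_
    simp only [Function.comp_apply, Transgress.slash_borel hβ, ofComplex_borel hβ hw, ← hpdef]
  · refine ⟨ε * p, by positivity, fun δ hδ => ?_⟩
    obtain ⟨C, hC⟩ := hdec (p * δ) (by positivity)
    refine ⟨‖borelFac m β‖ * C, fun z hz => ?_⟩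
    have him : (moeb β z).im = p * z.im := by
      rw [← coe_im, coe_moeb_borel hβ]
      simp [← hpdef]
    rw [Transgress.slash_borel hβ, ← mul_sub, norm_mul, mul_assoc]
    refine mul_le_mul_of_nonneg_left ((hC _ ?_).trans_eq ?_) (norm_nonneg _)
    · rw [him]
      gcongr
    · rw [him]
      congr 2
      ring

lemma borelFac_detFac {m : ℕ} (hm : 2 ≤ m) {β : GL(2, ℚ)⁺} (hβ : entry β 1 0 = 0) :
    detFac ℂ (m - 2) β * borelFac m β =
      (entry β 0 0 : ℂ) / entry β 1 1 * ((entry β 1 1 : ℂ) ^ (m - 2))⁻¹ := by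
  obtain ⟨hd, hp, hdet⟩ := borel_aux hβ
  have hd' : (entry β 1 1 : ℂ) ≠ 0 := by exact_mod_cast hd
  rw [borelFac, ← mul_assoc, detFac_rpow hm, hdet, zpow_neg, zpow_natCast]
  conv_lhs => rw [← Nat.sub_add_cancel hm, pow_add]
  push_cast
  field_simp

lemma rowMul_borel {β : GL(2, ℚ)⁺} (hβ : entry β 1 0 = 0) (T : Fin 2 → ℂ) (w : ℂ) :
    w * rowMul T β 0 + rowMul T β 1 = (entry β 1 1 : ℂ) *
      ((((entry β 0 0 / entry β 1 1 : ℝ) : ℂ) * w + ((entry β 0 1 / entry β 1 1 : ℝ) : ℂ)) * T 0 +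
        T 1) := by
  obtain ⟨hd, -, -⟩ := borel_aux hβ
  have hd' : (entry β 1 1 : ℂ) ≠ 0 := by exact_mod_cast hd
  simp [rowMul, hβ]
  field_simp
  ring

/-- The two terms on the left have equal derivatives in `z`, so their difference is its value at `z
= 0`, where the second one vanishes. -/
lemma fchk_borel {m : ℕ} (hm : 2 ≤ m) {β : GL(2, ℚ)⁺} (hβ : entry β 1 0 = 0) (T : Fin 2 → ℂ)
    (z : ℂ) :
    fchk (m - 2) T (((entry β 0 0 / entry β 1 1 : ℝ) : ℂ) * z +
        ((entry β 0 1 / entry β 1 1 : ℝ) : ℂ)) -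
      detFac ℂ (m - 2) β * borelFac m β * fchk (m - 2) (rowMul T β) z =
    fchk (m - 2) T ((entry β 0 1 / entry β 1 1 : ℝ) : ℂ) := by
  obtain ⟨hd, -, -⟩ := borel_aux hβ
  have hd' : (entry β 1 1 : ℂ) ≠ 0 := by exact_mod_cast hd
  have key : ∀ w : ℂ, HasDerivAt (fun z => fchk (m - 2) T
      (((entry β 0 0 / entry β 1 1 : ℝ) : ℂ) * z + ((entry β 0 1 / entry β 1 1 : ℝ) : ℂ)) -
      detFac ℂ (m - 2) β * borelFac m β * fchk (m - 2) (rowMul T β) z) 0 w := by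
    intro w
    have h1 : HasDerivAt (fun z : ℂ => ((entry β 0 0 / entry β 1 1 : ℝ) : ℂ) * z +
        ((entry β 0 1 / entry β 1 1 : ℝ) : ℂ)) ((entry β 0 0 / entry β 1 1 : ℝ) : ℂ) w := by
      simpa using ((hasDerivAt_id w).const_mul
        ((entry β 0 0 / entry β 1 1 : ℝ) : ℂ)).add_const ((entry β 0 1 / entry β 1 1 : ℝ) : ℂ)
    refine (((hasDerivAt_fchk (m - 2) T _).comp w h1).sub
      ((hasDerivAt_fchk (m - 2) (rowMul T β) w).const_mul _)).congr_deriv ?_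
    rw [rowMul_borel hβ, borelFac_detFac hm hβ, mul_pow, mul_assoc, inv_mul_cancel_left₀
      (pow_ne_zero _ hd')]
    push_cast
    ring
  have h := is_const_of_deriv_eq_zero (fun w => (key w).differentiableAt)
    (fun w => (key w).deriv) z 0
  simpa using h

/-- An upper triangular matrix maps vertical rays to vertical rays, so the substitution `t ↦ (a/d)
t` identifies the two ray integrals. Only the constant term survives, through `fchk_borel`. -/
lemma eval_Psi_borel {m : ℕ} (hm : 2 ≤ m) {f : ℍ → ℂ} {c : ℂ} (hf : GoodWith f c)
    {β : GL(2, ℚ)⁺} (hβ : entry β 1 0 = 0) (z₀ : ℍ) (T : Fin 2 → ℂ) :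
    MvPolynomial.eval T (Psi m z₀ f β) =
      c * fchk (m - 2) T ((entry β 0 1 / entry β 1 1 : ℝ) : ℂ) := by
  obtain ⟨hd, hp, -⟩ := borel_aux hβ
  have hd' : (entry β 1 1 : ℂ) ≠ 0 := by exact_mod_cast hd
  rw [eval_Psi hf (hf.slash_borel hβ), Eprim, Eprim, ← fchk_borel hm hβ T z₀, coe_moeb_borel hβ]
  set p : ℝ := entry β 0 0 / entry β 1 1 with hpdef
  set q : ℝ := entry β 0 1 / entry β 1 1 with hqdef
  have h1 := integral_comp_mul_left_Ioi (fun t : ℝ => Complex.I *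
    ((f (ofComplex (((p : ℂ) * z₀ + q) + t * Complex.I)) - c) *
      (linPow (m - 2) T).eval (((p : ℂ) * z₀ + q) + t * Complex.I))) 0 hp
  rw [mul_zero] at h1
  have h2 : (∫ t in Set.Ioi (0 : ℝ), Complex.I *
      ((f (ofComplex (((p : ℂ) * z₀ + q) + t * Complex.I)) - c) *
      (linPow (m - 2) T).eval (((p : ℂ) * z₀ + q) + t * Complex.I))) =
      detFac ℂ (m - 2) β * ∫ t in Set.Ioi (0 : ℝ), Complex.I *
      ((slash m β f (ofComplex ((z₀ : ℂ) + t * Complex.I)) - borelFac m β * c) *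
      (linPow (m - 2) (rowMul T β)).eval ((z₀ : ℂ) + t * Complex.I)) := by
    rw [eq_inv_smul_iff₀ hp.ne'] at h1
    rw [← h1, ← integral_const_mul, ← integral_smul]
    refine setIntegral_congr_fun measurableSet_Ioi fun t ht => ?_
    have hw : (z₀ : ℂ) + t * Complex.I ∈ Hset := add_mul_I_mem z₀.2 (le_of_lt ht)
    have e : (p : ℂ) * z₀ + q + ((p * t : ℝ) : ℂ) * Complex.I =
        (p : ℂ) * ((z₀ : ℂ) + t * Complex.I) + q := by
      push_cast
      ring
    have e2 : detFac ℂ (m - 2) β * borelFac m β * (entry β 1 1 : ℂ) ^ (m - 2) = p := by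
      rw [borelFac_detFac hm hβ, mul_assoc, inv_mul_cancel₀ (pow_ne_zero _ hd'), mul_one, hpdef]
      push_cast
      rfl
    simp only [e, slash_borel hβ, ofComplex_borel hβ hw, eval_linPow, rowMul_borel hβ, mul_pow,
      Complex.real_smul, ← hpdef, ← hqdef]
    rw [← e2]
    ring
  rw [h2]
  ring

/-! ### Linearity -/

lemma GoodWith.const_mul {f : ℍ → ℂ} {c : ℂ} (h : GoodWith f c) (a : ℂ) :
    GoodWith (fun z => a * f z) (a * c) := by
  obtain ⟨hf, ε, hε, hd⟩ := h
  refine ⟨hf.const_mul a, ε, hε, fun δ hδ => ?_⟩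
  obtain ⟨C, hC⟩ := hd δ hδ
  refine ⟨‖a‖ * C, fun z hz => ?_⟩
  rw [← mul_sub, norm_mul, mul_assoc]
  exact mul_le_mul_of_nonneg_left (hC z hz) (norm_nonneg _)

lemma GoodWith.add {f g : ℍ → ℂ} {c d : ℂ} (hf : GoodWith f c) (hg : GoodWith g d) :
    GoodWith (fun z => f z + g z) (c + d) := by
  obtain ⟨hf, ε, hε, hd⟩ := hf
  obtain ⟨hg, ε', hε', hd'⟩ := hg
  refine ⟨hf.add hg, min ε ε', lt_min hε hε', fun δ hδ => ?_⟩
  obtain ⟨C, hC⟩ := hd δ hδ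
  obtain ⟨C', hC'⟩ := hd' δ hδ
  refine ⟨|C| + |C'|, fun z hz => ?_⟩
  have him := z.im_pos
  rw [add_sub_add_comm, add_mul]
  refine (norm_add_le _ _).trans (add_le_add ((hC z hz).trans ?_) ((hC' z hz).trans ?_))
  · refine mul_le_mul (le_abs_self C) (Real.exp_le_exp.2 ?_) (Real.exp_pos _).le (abs_nonneg _)
    rw [neg_mul, neg_mul, neg_le_neg_iff]
    exact mul_le_mul_of_nonneg_right (min_le_left _ _) him.le
  · refine mul_le_mul (le_abs_self C') (Real.exp_le_exp.2 ?_) (Real.exp_pos _).le (abs_nonneg _)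
    rw [neg_mul, neg_mul, neg_le_neg_iff]
    exact mul_le_mul_of_nonneg_right (min_le_right _ _) him.le

lemma goodWith_const (a : ℂ) : GoodWith (fun _ => a) a := by
  refine ⟨differentiableOn_const a, 1, one_pos, fun δ _ => ⟨0, fun z _ => by simp⟩⟩

lemma Eprim_const_mul (n : ℕ) (f : ℍ → ℂ) (c a : ℂ) (T : Fin 2 → ℂ) (z : ℂ) :
    Eprim n (fun z => a * f z) (a * c) T z = a * Eprim n f c T z := by
  simp only [Eprim, mul_sub a, ← integral_const_mul]
  congr 1
  · ring
  · congr 1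
    funext t
    ring

lemma Eprim_add (n : ℕ) {f g : ℍ → ℂ} {c d : ℂ} (hf : GoodWith f c) (hg : GoodWith g d)
    (T : Fin 2 → ℂ) {z : ℂ} (hz : z ∈ Hset) :
    Eprim n (fun z => f z + g z) (c + d) T z = Eprim n f c T z + Eprim n g d T z := by
  simp only [Eprim]
  have h := integral_add ((hf.integrableOn_ray (linPow n T) hz).const_mul Complex.I)
    ((hg.integrableOn_ray (linPow n T) hz).const_mul Complex.I)
  rw [← add_sub_add_comm, ← add_mul, ← h]
  congr 2
  funext t
  ring

lemma slash_const_mul (w : ℤ) (γ : GL(2, ℚ)⁺) (a : ℂ) (f : ℍ → ℂ) :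
    slash w γ (fun z => a * f z) = fun z => a * slash w γ f z := by
  funext z
  simp only [slash_apply]
  ring

lemma slash_add (w : ℤ) (γ : GL(2, ℚ)⁺) (f g : ℍ → ℂ) :
    slash w γ (fun z => f z + g z) = fun z => slash w γ f z + slash w γ g z := by
  funext z
  simp only [slash_apply]
  ring

lemma GoodAll.const_mul {m : ℕ} {f : ℍ → ℂ} (h : GoodAll m f) (a : ℂ) :
    GoodAll m fun z => a * f z := by
  intro γ
  obtain ⟨c, hc⟩ := h γ
  rw [slash_const_mul]
  exact ⟨_, hc.const_mul a⟩

lemma GoodAll.add {m : ℕ} {f g : ℍ → ℂ} (hf : GoodAll m f) (hg : GoodAll m g) :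
    GoodAll m fun z => f z + g z := by
  intro γ
  obtain ⟨c, hc⟩ := hf γ
  obtain ⟨d, hd⟩ := hg γ
  rw [slash_add]
  exact ⟨_, hc.add hd⟩

lemma goodAll_zero (m : ℕ) : GoodAll m fun _ => 0 := by
  intro γ
  refine ⟨0, ?_⟩
  have : slash m γ (fun _ => 0) = fun _ => 0 := by
    funext z
    simp [slash_apply]
  rw [this]
  exact goodWith_const 0

lemma GoodAll.sum {m : ℕ} {ι : Type*} (s : Finset ι) {f : ι → ℍ → ℂ}
    (h : ∀ i ∈ s, GoodAll m (f i)) : GoodAll m fun z => ∑ i ∈ s, f i z := by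
  classical
  induction s using Finset.induction_on with
  | empty => simpa using goodAll_zero m
  | insert i s hi ih =>
    simp only [Finset.sum_insert hi]
    exact (h i (Finset.mem_insert_self _ _)).add
      (ih fun j hj => h j (Finset.mem_insert_of_mem hj))

lemma Psi_const_mul {m : ℕ} {f : ℍ → ℂ} (h : GoodAll m f) (a : ℂ) (z₀ : ℍ) (γ : GL(2, ℚ)⁺) :
    Psi m z₀ (fun z => a * f z) γ = MvPolynomial.C a * Psi m z₀ f γ := by
  obtain ⟨c, hc⟩ := h.self
  obtain ⟨c', hc'⟩ := h γ
  refine MvPolynomial.funext fun T => ?_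
  rw [map_mul, MvPolynomial.eval_C, eval_Psi hc hc', eval_Psi (hc.const_mul a) (c' := a * c')
    (by rw [slash_const_mul]; exact hc'.const_mul a), slash_const_mul, Eprim_const_mul,
    Eprim_const_mul]
  ring

lemma Psi_add {m : ℕ} {f g : ℍ → ℂ} (hf : GoodAll m f) (hg : GoodAll m g) (z₀ : ℍ)
    (γ : GL(2, ℚ)⁺) : Psi m z₀ (fun z => f z + g z) γ = Psi m z₀ f γ + Psi m z₀ g γ := by
  obtain ⟨c, hc⟩ := hf.self
  obtain ⟨c', hc'⟩ := hf γ
  obtain ⟨d, hd⟩ := hg.self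
  obtain ⟨d', hd'⟩ := hg γ
  refine MvPolynomial.funext fun T => ?_
  rw [map_add, eval_Psi hc hc', eval_Psi hd hd', eval_Psi (hc.add hd) (c' := c' + d')
    (by rw [slash_add]; exact hc'.add hd'), slash_add, Eprim_add _ hc hd _ (moeb γ z₀).2,
    Eprim_add _ hc' hd' _ z₀.2]
  ring

lemma Psi_sum {m : ℕ} {ι : Type*} (s : Finset ι) {f : ι → ℍ → ℂ} (h : ∀ i ∈ s, GoodAll m (f i))
    (z₀ : ℍ) (γ : GL(2, ℚ)⁺) :
    Psi m z₀ (fun z => ∑ i ∈ s, f i z) γ = ∑ i ∈ s, Psi m z₀ (f i) γ := by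
  classical
  induction s using Finset.induction_on with
  | empty =>
    have h0 := Psi_const_mul (goodAll_zero m) 0 z₀ γ
    simpa using h0
  | insert i s hi ih =>
    simp only [Finset.sum_insert hi]
    rw [Psi_add (h i (Finset.mem_insert_self _ _))
      (GoodAll.sum s fun j hj => h j (Finset.mem_insert_of_mem hj)),
      ih fun j hj => h j (Finset.mem_insert_of_mem hj)]

/-- A constant function all of whose slashes have a limit at the cusps vanishes. -/
lemma eq_zero_of_goodAll_const {m : ℕ} (hm : m ≠ 0) {κ : ℂ} (h : GoodAll m fun _ => κ) :
    κ = 0 := by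
  obtain ⟨c, hc⟩ := h (ofSL ModularGroup.S)
  obtain ⟨-, ε, hε, hd⟩ := id hc
  obtain ⟨C, hC⟩ := hd 1 one_pos
  -- The slash by `S` turns the constant into a function of size `|κ| y^{-m}` on the imaginary axis.
  -- It tends to `0`, but only polynomially, whereas goodness at the cusp demands exponential decay.
  have e : ∀ y : ℝ, ∀ hy : 0 < y, ‖slash m (ofSL ModularGroup.S) (fun _ => κ)
      ⟨y * Complex.I, by simpa using hy⟩‖ = ‖κ‖ * (y ^ m)⁻¹ := by
    intro y hy
    rw [slash_apply, denom_toReal, realDet_ofSL, entry_ofSL, entry_ofSL]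
    simp [ModularGroup.S, abs_of_pos hy]
    ring
  have hc0 : c = 0 := by
    have h1 := hc.tendsto
    have h2 : Tendsto (fun y : ℝ => (⟨(max y 1 : ℝ) * Complex.I, by simp⟩ : ℍ)) atTop
        atImInfty := by
      rw [atImInfty, tendsto_comap_iff]
      refine tendsto_atTop_mono (fun y => ?_) tendsto_id
      change y ≤ (((max y 1 : ℝ) : ℂ) * Complex.I).im
      simp
    have h3 := (h1.comp h2).norm
    have h4 : Tendsto (fun y : ℝ => ‖κ‖ * ((max y 1) ^ m)⁻¹) atTop (𝓝 (‖κ‖ * 0)) := by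
      refine Tendsto.const_mul _ (tendsto_inv_atTop_zero.comp ?_)
      exact (tendsto_pow_atTop hm).comp (tendsto_atTop_mono (fun y => le_max_left y 1) tendsto_id)
    have h5 := tendsto_nhds_unique h3 (h4.congr fun y => by
      simp only [Function.comp_apply]
      rw [e _ (by positivity)])
    simpa using h5
  subst hc0
  have h6 : ∀ y : ℝ, 1 ≤ y → ‖κ‖ ≤ C * (y ^ m * Real.exp (-ε * y)) := by
    intro y hy
    have hy0 : 0 < y := by linarith
    have h7 := hC ⟨y * Complex.I, by simpa using hy0⟩ (by change 1 ≤ (y * Complex.I).im; simpa)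
    rw [sub_zero, e y hy0] at h7
    have h8 : ‖κ‖ * (y ^ m)⁻¹ ≤ C * Real.exp (-ε * y) := by
      refine h7.trans_eq ?_
      congr 3
      change (y * Complex.I).im = y
      simp
    have h9 : 0 < y ^ m := by positivity
    calc ‖κ‖ = (‖κ‖ * (y ^ m)⁻¹) * y ^ m := by field_simp
      _ ≤ (C * Real.exp (-ε * y)) * y ^ m := by gcongr
      _ = _ := by ring
  have h10 : Tendsto (fun y : ℝ => C * (y ^ m * Real.exp (-ε * y))) atTop (𝓝 (C * 0)) := by
    refine Tendsto.const_mul _ ?_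
    have := (tendsto_rpow_mul_exp_neg_mul_atTop_nhds_zero m ε hε)
    simpa using this
  have h11 := ge_of_tendsto h10 ((eventually_ge_atTop 1).mono h6)
  simpa using h11

/-! ### Lattice sums with a character -/

/-- `exp(2πi t)`. -/
def e2 (t : ℂ) : ℂ := Complex.exp (2 * Real.pi * Complex.I * t)

lemma e2_add (s t : ℂ) : e2 (s + t) = e2 s * e2 t := by
  simp [e2, mul_add, Complex.exp_add]

@[simp] lemma e2_zero : e2 0 = 1 := by simp [e2]

lemma e2_int (n : ℤ) : e2 n = 1 := by
  rw [e2, mul_comm]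
  exact Complex.exp_int_mul_two_pi_mul_I n

lemma e2_nat_mul (n : ℕ) (t : ℂ) : e2 (n * t) = e2 t ^ n := by
  rw [e2, e2, ← Complex.exp_nat_mul]
  congr 1
  ring

lemma norm_e2 (t : ℂ) : ‖e2 t‖ = Real.exp (-(2 * Real.pi * t.im)) := by
  rw [e2, Complex.norm_exp]
  congr 1
  simp

lemma norm_e2_ratCast (t : ℚ) : ‖e2 t‖ = 1 := by
  rw [norm_e2]
  simp

lemma e2_ratCast_eq_one_iff (t : ℚ) : e2 t = 1 ↔ ∃ n : ℤ, t = n := by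
  rw [e2, Complex.exp_eq_one_iff]
  have h : (2 * Real.pi * Complex.I : ℂ) ≠ 0 := Complex.two_pi_I_ne_zero
  constructor
  · rintro ⟨n, hn⟩
    refine ⟨n, ?_⟩
    rw [mul_comm] at hn
    exact_mod_cast mul_right_cancel₀ h hn
  · rintro ⟨n, rfl⟩
    exact ⟨n, by push_cast; ring⟩

/-- The character `l ↦ exp(2πi (l₂ x₁ - l₁ x₂))` of `ℤ²`. -/
def latChi (x : ℚ × ℚ) (l : ℤ × ℤ) : ℂ := e2 ((l.2 * x.1 - l.1 * x.2 : ℚ) : ℂ)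

lemma latChi_add (x : ℚ × ℚ) (l k : ℤ × ℤ) : latChi x (l + k) = latChi x l * latChi x k := by
  rw [latChi, latChi, latChi, ← e2_add]
  congr 1
  simp only [Prod.fst_add, Prod.snd_add]
  push_cast
  ring

lemma norm_latChi (x : ℚ × ℚ) (l : ℤ × ℤ) : ‖latChi x l‖ = 1 := norm_e2_ratCast _

/-- The term `(l₁ z + l₂)^{-m} |l₁ z + l₂|^{-s}`, and `0` for `l = 0`. -/
def latT (m : ℕ) (z : ℍ) (s : ℝ) (l : ℤ × ℤ) : ℂ :=
  if l = 0 then 0 else ((l.1 : ℂ) * z + l.2) ^ (-(m : ℤ)) *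
    ((‖(l.1 : ℂ) * z + l.2‖ ^ (-s) : ℝ) : ℂ)

/-- The lattice sum `∑_{l ≠ 0} χ_x(l) (l₁ z + l₂)^{-m} |l₁ z + l₂|^{-s}`. -/
def latS (m : ℕ) (x : ℚ × ℚ) (z : ℍ) (s : ℝ) : ℂ := ∑' l : ℤ × ℤ, latChi x l * latT m z s l

/-- The iterated sum `∑_{l₁} ∑_{l₂} χ_x(l) (l₁ z + l₂)^{-m}`. -/
def latI (m : ℕ) (x : ℚ × ℚ) (z : ℍ) : ℂ :=
  ∑' l₁ : ℤ, ∑' l₂ : ℤ, latChi x (l₁, l₂) * latT m z 0 (l₁, l₂)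

/-- The sup norm on `ℤ²`. -/
def nrm (l : ℤ × ℤ) : ℝ := ‖(![l.1, l.2] : Fin 2 → ℤ)‖

lemma nrm_nonneg (l : ℤ × ℤ) : 0 ≤ nrm l := norm_nonneg _

lemma vec_ne_zero {l : ℤ × ℤ} (hl : l ≠ 0) : (![l.1, l.2] : Fin 2 → ℤ) ≠ 0 := by
  intro h
  apply hl
  have h0 := congrFun h 0
  have h1 := congrFun h 1
  simp at h0 h1
  exact Prod.ext h0 h1

lemma one_le_nrm {l : ℤ × ℤ} (hl : l ≠ 0) : 1 ≤ nrm l := by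
  rw [nrm, EisensteinSeries.norm_eq_max_natAbs]
  have : l.1 ≠ 0 ∨ l.2 ≠ 0 := by
    by_contra! h
    exact hl (Prod.ext h.1 h.2)
  have h2 : 1 ≤ max l.1.natAbs l.2.natAbs := by omega
  exact_mod_cast h2

lemma summable_nrm {k : ℝ} (hk : 2 < k) : Summable fun l : ℤ × ℤ => nrm l ^ (-k) := by
  have h := EisensteinSeries.summable_one_div_norm_rpow hk
  rw [← (finTwoArrowEquiv ℤ).symm.summable_iff] at h
  exact h

lemma r_mul_nrm_le (z : ℍ) {l : ℤ × ℤ} (hl : l ≠ 0) :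
    EisensteinSeries.r z * nrm l ≤ ‖(l.1 : ℂ) * z + l.2‖ := by
  simpa [nrm] using EisensteinSeries.r_mul_max_le z (vec_ne_zero hl)

lemma norm_latT_le (m : ℕ) (z : ℍ) {s : ℝ} (hs : 0 ≤ s) (l : ℤ × ℤ) :
    ‖latT m z s l‖ ≤ EisensteinSeries.r z ^ (-(m + s)) * nrm l ^ (-(m + s)) := by
  rw [latT]
  split_ifs with hl
  · rw [norm_zero]
    have := (EisensteinSeries.r_pos z).le
    have := nrm_nonneg l
    positivity
  · have h := EisensteinSeries.summand_bound z (k := m + s) (by positivity) ![l.1, l.2]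
    have hpos : 0 < ‖(l.1 : ℂ) * z + l.2‖ :=
      (mul_pos (EisensteinSeries.r_pos z) (zero_lt_one.trans_le (one_le_nrm hl))).trans_le
        (r_mul_nrm_le z hl)
    refine le_trans (le_of_eq ?_) h
    rw [norm_mul, norm_zpow, Complex.norm_real, Real.norm_of_nonneg (by positivity), neg_add,
      Real.rpow_add (by simpa using hpos), ← Real.rpow_intCast]
    simp

lemma summable_latT {m : ℕ} (z : ℍ) {s : ℝ} (hs : 0 ≤ s) (h : 2 < m + s) (x : ℚ × ℚ) :
    Summable fun l => latChi x l * latT m z s l := by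
  refine Summable.of_norm_bounded ((summable_nrm h).mul_left
    (EisensteinSeries.r z ^ (-(m + s)))) fun l => ?_
  rw [norm_mul, norm_latChi, one_mul]
  exact norm_latT_le m z hs l

lemma summable_latT_right {m : ℕ} (hm : 2 ≤ m) (z : ℍ) (x : ℚ × ℚ) (l₁ : ℤ) :
    Summable fun l₂ : ℤ => latChi x (l₁, l₂) * latT m z 0 (l₁, l₂) := by
  have h := (EisensteinSeries.linear_right_summable (z : ℂ) l₁ (k := m) (by exact_mod_cast hm)).norm
  refine Summable.of_norm_bounded h fun l₂ => ?_
  rw [norm_mul, norm_latChi, one_mul, latT]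
  split_ifs
  · simp
  · simp

/-! #### The action of `SL(2, ℤ)` -/

/-- `l ↦ l σ` as a permutation of `ℤ²`. -/
def latEquiv (σ : SL(2, ℤ)) : ℤ × ℤ ≃ ℤ × ℤ where
  toFun l := (l.1 * σ 0 0 + l.2 * σ 1 0, l.1 * σ 0 1 + l.2 * σ 1 1)
  invFun l := (l.1 * σ 1 1 - l.2 * σ 1 0, -l.1 * σ 0 1 + l.2 * σ 0 0)
  left_inv l := by
    have h := σ.det_coe
    rw [Matrix.det_fin_two] at h
    refine Prod.ext ?_ ?_
    · simp only
      linear_combination l.1 * h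
    · simp only
      linear_combination l.2 * h
  right_inv l := by
    have h := σ.det_coe
    rw [Matrix.det_fin_two] at h
    refine Prod.ext ?_ ?_
    · simp only
      linear_combination l.1 * h
    · simp only
      linear_combination l.2 * h

/-- `x ↦ x σ` on `ℚ²`. -/
def rowSL (x : ℚ × ℚ) (σ : SL(2, ℤ)) : ℚ × ℚ :=
  (σ 0 0 * x.1 + σ 1 0 * x.2, σ 0 1 * x.1 + σ 1 1 * x.2)

/-- The exponent `l₂ x₁ - l₁ x₂` is a determinant, hence invariant when `SL(2, ℤ)` acts on both
vectors. -/
lemma latChi_latEquiv (x : ℚ × ℚ) (σ : SL(2, ℤ)) (l : ℤ × ℤ) :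
    latChi (rowSL x σ) (latEquiv σ l) = latChi x l := by
  have h := σ.det_coe
  rw [Matrix.det_fin_two] at h
  have h' : (σ 0 0 : ℚ) * σ 1 1 - σ 0 1 * σ 1 0 = 1 := by exact_mod_cast h
  rw [latChi, latChi]
  congr 2
  simp only [latEquiv, rowSL, Equiv.coe_fn_mk]
  push_cast
  linear_combination (l.2 * x.1 - l.1 * x.2) * h'

lemma latT_moeb (m : ℕ) (σ : SL(2, ℤ)) (z : ℍ) (s : ℝ) (l : ℤ × ℤ) :
    latT m (moeb (ofSL σ) z) s l = denom (toReal (ofSL σ)) z ^ m *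
      ((‖denom (toReal (ofSL σ)) z‖ ^ s : ℝ) : ℂ) * latT m z s (latEquiv σ l) := by
  have hd := denom_ne_zero (toReal (ofSL σ)) z
  by_cases hl : l = 0
  · subst hl
    simp [latT, latEquiv]
  · have hl' : latEquiv σ l ≠ 0 := by
      intro h
      apply hl
      apply (latEquiv σ).injective
      rw [h]
      simp only [latEquiv, Equiv.coe_fn_mk, Prod.fst_zero, Prod.snd_zero, zero_mul, add_zero]
      rfl
    rw [latT, if_neg hl, latT, if_neg hl']
    have e : (l.1 : ℂ) * (moeb (ofSL σ) z) + l.2 =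
        (((latEquiv σ l).1 : ℂ) * z + (latEquiv σ l).2) / denom (toReal (ofSL σ)) z := by
      rw [coe_moeb, ← denom_toReal, eq_div_iff hd, add_mul, mul_assoc, div_mul_cancel₀ _ hd,
        denom_toReal]
      simp only [entry_ofSL, latEquiv, Equiv.coe_fn_mk]
      push_cast
      ring
    rw [e, norm_div, div_zpow, Real.div_rpow (norm_nonneg _) (norm_nonneg _), Real.rpow_neg
      (norm_nonneg (denom (toReal (ofSL σ)) z))]
    simp only [zpow_neg, zpow_natCast]
    have hn : ((‖denom (toReal (ofSL σ)) z‖ ^ s : ℝ) : ℂ) ≠ 0 := by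
      have : 0 < ‖denom (toReal (ofSL σ)) z‖ := norm_pos_iff.2 hd
      exact_mod_cast (Real.rpow_pos_of_pos this s).ne'
    push_cast
    rw [div_inv_eq_mul, div_inv_eq_mul]
    ring

lemma latS_moeb (m : ℕ) (x : ℚ × ℚ) (σ : SL(2, ℤ)) (z : ℍ) (s : ℝ) :
    latS m x (moeb (ofSL σ) z) s = denom (toReal (ofSL σ)) z ^ m *
      ((‖denom (toReal (ofSL σ)) z‖ ^ s : ℝ) : ℂ) * latS m (rowSL x σ) z s := by
  rw [latS, latS, ← (latEquiv σ).tsum_eq (fun l => latChi (rowSL x σ) l * latT m z s l),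
    ← tsum_mul_left]
  congr 1
  funext l
  rw [latT_moeb, latChi_latEquiv]
  ring

/-! #### The limit `s → 0` in weight `2` -/

/-- Differences of weight `2` terms gain one order of decay, uniformly for `s ∈ [0, 1]`. The
exponent `-3` is summable over the lattice, where `-2` is not. -/
lemma norm_sub_term_le {w w' : ℂ} {ρ s : ℝ} (hρ : 0 < ρ) (hρ1 : ρ ≤ 1) (hw : ρ ≤ ‖w‖)
    (hw' : ρ ≤ ‖w'‖) (hs : 0 ≤ s) (hs1 : s ≤ 1) :
    ‖w ^ (-((2 : ℕ) : ℤ)) * ((‖w‖ ^ (-s) : ℝ) : ℂ) -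
      w' ^ (-((2 : ℕ) : ℤ)) * ((‖w'‖ ^ (-s) : ℝ) : ℂ)‖ ≤
      3 * ‖w - w'‖ / ρ * (‖w‖ ^ (-3 : ℝ) + ‖w'‖ ^ (-3 : ℝ)) := by
  wlog h : ‖w‖ ≤ ‖w'‖ generalizing w w'
  · have := this hw' hw (le_of_not_ge h)
    rw [norm_sub_rev, norm_sub_rev w, add_comm (‖w‖ ^ (-3 : ℝ))]
    exact this
  set a := ‖w‖ with ha
  set b := ‖w'‖ with hb
  set D := ‖w - w'‖ with hD
  have ha0 : 0 < a := hρ.trans_le hw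
  have hb0 : 0 < b := hρ.trans_le hw'
  have hw0 : w ≠ 0 := norm_pos_iff.1 ha0
  have hw0' : w' ≠ 0 := norm_pos_iff.1 hb0
  have hbD : b - a ≤ D := by
    rw [hD, norm_sub_rev]
    exact norm_sub_norm_le _ _
  have hD0 : 0 ≤ D := norm_nonneg _
  have has : a ^ (-s) ≤ ρ⁻¹ := by
    calc a ^ (-s) ≤ ρ ^ (-s) := Real.rpow_le_rpow_of_nonpos hρ hw (by linarith)
      _ ≤ ρ ^ (-1 : ℝ) := Real.rpow_le_rpow_of_exponent_ge hρ hρ1 (by linarith)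
      _ = ρ⁻¹ := Real.rpow_neg_one ρ
  have has0 : 0 < a ^ (-s) := Real.rpow_pos_of_pos ha0 _
  -- The change of `w^{-2}` is separated from the change of the factor `|w|^{-s}`.
  have e : w ^ (-((2 : ℕ) : ℤ)) * ((a ^ (-s) : ℝ) : ℂ) -
      w' ^ (-((2 : ℕ) : ℤ)) * ((b ^ (-s) : ℝ) : ℂ) =
      (w ^ (-((2 : ℕ) : ℤ)) - w' ^ (-((2 : ℕ) : ℤ))) * ((a ^ (-s) : ℝ) : ℂ) +
      w' ^ (-((2 : ℕ) : ℤ)) * ((a ^ (-s) - b ^ (-s) : ℝ) : ℂ) := by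
    push_cast
    ring
  have h1 : ‖w ^ (-((2 : ℕ) : ℤ)) - w' ^ (-((2 : ℕ) : ℤ))‖ ≤ 2 * D * (a ^ 3)⁻¹ := by
    have e1 : w ^ (-((2 : ℕ) : ℤ)) - w' ^ (-((2 : ℕ) : ℤ)) =
        (w' - w) * (w' + w) * (w ^ 2)⁻¹ * (w' ^ 2)⁻¹ := by
      simp only [zpow_neg, zpow_natCast]
      field_simp
      ring
    rw [e1, norm_mul, norm_mul, norm_mul, norm_inv, norm_inv, norm_pow, norm_pow, norm_sub_rev,
      ← ha, ← hb, ← hD]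
    have h2 : ‖w' + w‖ ≤ 2 * b := by
      have := norm_add_le w' w
      linarith
    calc D * ‖w' + w‖ * (a ^ 2)⁻¹ * (b ^ 2)⁻¹ ≤ D * (2 * b) * (a ^ 2)⁻¹ * (b ^ 2)⁻¹ := by gcongr
      _ = 2 * D * (a ^ 2)⁻¹ * b⁻¹ := by field_simp
      _ ≤ 2 * D * (a ^ 2)⁻¹ * a⁻¹ := by gcongr
      _ = _ := by field_simp
  have h3 : |a ^ (-s) - b ^ (-s)| ≤ ρ⁻¹ * (D * b⁻¹) := by
    have h4 : (a / b) ^ (1 : ℝ) ≤ (a / b) ^ s :=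
      Real.rpow_le_rpow_of_exponent_ge (by positivity) ((div_le_one hb0).2 h) hs1
    have h5 : b ^ (-s) = a ^ (-s) * (a / b) ^ s := by
      rw [Real.div_rpow ha0.le hb0.le, Real.rpow_neg ha0.le, Real.rpow_neg hb0.le]
      have := (Real.rpow_pos_of_pos ha0 s).ne'
      field_simp
    have h6 : (a / b) ^ s ≤ 1 := Real.rpow_le_one (by positivity) ((div_le_one hb0).2 h) hs
    rw [h5, ← mul_one_sub, abs_mul, abs_of_pos has0, abs_of_nonneg (by linarith)]
    refine mul_le_mul has ?_ (by linarith) (by positivity)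
    rw [Real.rpow_one] at h4
    calc 1 - (a / b) ^ s ≤ 1 - a / b := by linarith
      _ = (b - a) * b⁻¹ := by field_simp
      _ ≤ D * b⁻¹ := by gcongr
  rw [e]
  have h7 : a ^ (-3 : ℝ) = (a ^ 3)⁻¹ := by
    rw [Real.rpow_neg ha0.le]
    norm_cast
  have h8 : 0 ≤ b ^ (-3 : ℝ) := Real.rpow_nonneg hb0.le _
  refine (norm_add_le _ _).trans ?_
  rw [norm_mul, norm_mul, Complex.norm_real, Complex.norm_real, Real.norm_eq_abs, Real.norm_eq_abs,
    abs_of_pos has0, norm_zpow, ← hb]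
  have h9 : b ^ (-((2 : ℕ) : ℤ)) * (ρ⁻¹ * (D * b⁻¹)) ≤ ρ⁻¹ * D * (a ^ 3)⁻¹ := by
    rw [zpow_neg, zpow_natCast]
    calc (b ^ 2)⁻¹ * (ρ⁻¹ * (D * b⁻¹)) = ρ⁻¹ * D * (b ^ 3)⁻¹ := by field_simp
      _ ≤ _ := by gcongr
  calc _ ≤ 2 * D * (a ^ 3)⁻¹ * ρ⁻¹ + b ^ (-((2 : ℕ) : ℤ)) * (ρ⁻¹ * (D * b⁻¹)) := by
        gcongr
    _ ≤ 2 * D * (a ^ 3)⁻¹ * ρ⁻¹ + ρ⁻¹ * D * (a ^ 3)⁻¹ := by gcongr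
    _ = 3 * D / ρ * a ^ (-3 : ℝ) := by rw [h7]; field_simp; ring
    _ ≤ _ := by
      gcongr
      linarith

lemma norm_latT_sub_le (z : ℍ) {v : ℤ × ℤ} (hv : nrm v = 1) : ∃ K : ℝ, 0 ≤ K ∧
    ∀ s : ℝ, 0 ≤ s → s ≤ 1 → ∀ l : ℤ × ℤ,
      ‖latT 2 z s l - latT 2 z s (l - v)‖ ≤ K * (nrm l ^ (-3 : ℝ) + nrm (l - v) ^ (-3 : ℝ)) := by
  set r := EisensteinSeries.r z with hr
  have hr0 : 0 < r := EisensteinSeries.r_pos z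
  set ρ := min r 1 with hρ
  have hρ0 : 0 < ρ := lt_min hr0 one_pos
  have hv0 : v ≠ 0 := by
    rintro rfl
    simp [nrm, EisensteinSeries.norm_eq_max_natAbs] at hv
  set D := ‖(v.1 : ℂ) * z + v.2‖ with hD
  have hnegv : nrm (-v) = 1 := by
    rw [← hv, nrm, nrm, ← norm_neg]
    congr 1
    ext i
    fin_cases i <;> simp
  have hlow : ∀ l : ℤ × ℤ, l ≠ 0 → ρ ≤ ‖(l.1 : ℂ) * z + l.2‖ := by
    intro l hl
    refine le_trans ?_ (r_mul_nrm_le z hl)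
    have := one_le_nrm hl
    calc ρ ≤ r := min_le_left _ _
      _ ≤ r * nrm l := le_mul_of_one_le_right hr0.le this
  have hsing : ∀ s : ℝ, 0 ≤ s → s ≤ 1 → ∀ l : ℤ × ℤ, nrm l = 1 → ‖latT 2 z s l‖ ≤ ρ⁻¹ ^ 3 := by
    intro s hs hs1 l hl
    have h := norm_latT_le 2 z hs l
    rw [hl, Real.one_rpow, mul_one] at h
    refine h.trans ?_
    calc r ^ (-(((2 : ℕ) : ℝ) + s)) ≤ ρ ^ (-(((2 : ℕ) : ℝ) + s)) :=
          Real.rpow_le_rpow_of_nonpos hρ0 (min_le_left _ _) (by push_cast; linarith)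
      _ ≤ ρ ^ (-3 : ℝ) :=
          Real.rpow_le_rpow_of_exponent_ge hρ0 (min_le_right _ _) (by push_cast; linarith)
      _ = ρ⁻¹ ^ 3 := by
        rw [Real.rpow_neg hρ0.le, inv_pow]
        norm_cast
  refine ⟨3 * D / ρ * r ^ (-3 : ℝ) + ρ⁻¹ ^ 3, by positivity, fun s hs hs1 l => ?_⟩
  have hn1 := Real.rpow_nonneg (nrm_nonneg l) (-3 : ℝ)
  have hn2 := Real.rpow_nonneg (nrm_nonneg (l - v)) (-3 : ℝ)
  have hc1 : 0 ≤ 3 * D / ρ * r ^ (-3 : ℝ) := by positivity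
  have hc2 : 0 ≤ ρ⁻¹ ^ 3 := by positivity
  -- Where one of the two terms is zero by convention there is no cancellation; the other one sits
  -- at a vector of norm `1` and is bounded outright.
  by_cases hl : l = 0
  · subst hl
    have h1 : nrm (0 - v) ^ (-3 : ℝ) = 1 := by rw [zero_sub, hnegv, Real.one_rpow]
    have h2 : latT 2 z s 0 = 0 := if_pos rfl
    rw [h1, h2, zero_sub (latT 2 z s _), norm_neg]
    have := hsing s hs hs1 (0 - v) (by rw [zero_sub, hnegv])
    nlinarith
  by_cases hlv : l - v = 0
  · have hlv' : l = v := sub_eq_zero.1 hlv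
    have h1 : nrm l ^ (-3 : ℝ) = 1 := by rw [hlv', hv, Real.one_rpow]
    have h2 : latT 2 z s (l - v) = 0 := if_pos hlv
    rw [h1, h2, sub_zero]
    have := hsing s hs hs1 l (by rw [hlv', hv])
    nlinarith
  rw [latT, latT, if_neg hl, if_neg hlv]
  have hdiff : ((l.1 : ℂ) * z + l.2) - (((l - v).1 : ℂ) * z + (l - v).2) = (v.1 : ℂ) * z + v.2 := by
    simp only [Prod.fst_sub, Prod.snd_sub]
    push_cast
    ring
  refine (norm_sub_term_le hρ0 (min_le_right _ _) (hlow l hl) (hlow _ hlv) hs hs1).trans ?_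
  rw [hdiff, ← hD]
  have hb : ∀ k : ℤ × ℤ, k ≠ 0 →
      ‖(k.1 : ℂ) * z + k.2‖ ^ (-3 : ℝ) ≤ r ^ (-3 : ℝ) * nrm k ^ (-3 : ℝ) := by
    intro k hk
    rw [← Real.mul_rpow hr0.le (nrm_nonneg k)]
    have := one_le_nrm hk
    exact Real.rpow_le_rpow_of_nonpos (by positivity) (r_mul_nrm_le z hk) (by norm_num)
  calc 3 * D / ρ * (‖(l.1 : ℂ) * z + l.2‖ ^ (-3 : ℝ) +
        ‖((l - v).1 : ℂ) * z + (l - v).2‖ ^ (-3 : ℝ))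
      ≤ 3 * D / ρ * (r ^ (-3 : ℝ) * nrm l ^ (-3 : ℝ) + r ^ (-3 : ℝ) * nrm (l - v) ^ (-3 : ℝ)) := by
        gcongr
        · exact hb l hl
        · exact hb _ hlv
    _ ≤ _ := by nlinarith

lemma tsum_latChi_shift (m : ℕ) (x : ℚ × ℚ) (z : ℍ) (s : ℝ) (v : ℤ × ℤ) :
    ∑' l : ℤ × ℤ, latChi x l * latT m z s (l - v) = latChi x v * latS m x z s := by
  rw [latS, ← tsum_mul_left, ← (Equiv.addRight v).tsum_eq]
  congr 1
  funext l
  simp only [Equiv.coe_addRight, add_sub_cancel_right, latChi_add]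
  ring

/-- Summation by parts. As `x ∉ ℤ²`, some unit vector `v` has `χ(v) ≠ 1`, and `(1 - χ(v))` times the
lattice sum is the sum of `χ(l) (T_s(l) - T_s(l - v))`. This converges absolutely with a majorant
independent of `s ∈ [0, 1]`, so dominated convergence applies. -/
lemma tendsto_latS {x : ℚ × ℚ} (hx : ¬ ∃ p q : ℤ, x.1 = p ∧ x.2 = q) (z : ℍ)
    (hsum : Summable fun l₁ : ℤ => ∑' l₂ : ℤ, latChi x (l₁, l₂) * latT 2 z 0 (l₁, l₂)) :
    Tendsto (latS 2 x z) (𝓝[>] 0) (𝓝 (latI 2 x z)) := by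
  obtain ⟨v, hv, hχ⟩ : ∃ v : ℤ × ℤ, nrm v = 1 ∧ latChi x v ≠ 1 := by
    by_cases h1 : ∃ p : ℤ, x.1 = p
    · refine ⟨(1, 0), by simp [nrm, EisensteinSeries.norm_eq_max_natAbs], fun h => ?_⟩
      rw [latChi, e2_ratCast_eq_one_iff] at h
      obtain ⟨n, hn⟩ := h
      obtain ⟨p, hp⟩ := h1
      exact hx ⟨p, -n, hp, by push_cast; simp at hn; linarith⟩
    · refine ⟨(0, 1), by simp [nrm, EisensteinSeries.norm_eq_max_natAbs], fun h => ?_⟩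
      rw [latChi, e2_ratCast_eq_one_iff] at h
      obtain ⟨n, hn⟩ := h
      exact h1 ⟨n, by simpa using hn⟩
  obtain ⟨K, hK, hbound⟩ := norm_latT_sub_le z hv
  have hbsum : Summable fun l : ℤ × ℤ => K * (nrm l ^ (-3 : ℝ) + nrm (l - v) ^ (-3 : ℝ)) := by
    have h := summable_nrm (k := 3) (by norm_num)
    exact (h.add ((Equiv.subRight v).summable_iff.2 h)).mul_left K
  have hlim := tendsto_tsum_of_dominated_convergence (𝓕 := 𝓝[>] (0 : ℝ))
    (f := fun s l => latChi x l * (latT 2 z s l - latT 2 z s (l - v)))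
    (g := fun l => latChi x l * (latT 2 z 0 l - latT 2 z 0 (l - v))) hbsum
    (by
      intro l
      have hc : ∀ l, Tendsto (fun s => latT 2 z s l) (𝓝[>] 0) (𝓝 (latT 2 z 0 l)) := by
        intro l
        by_cases hl : l = 0
        · simp only [latT, if_pos hl]
          exact tendsto_const_nhds
        · simp only [latT, if_neg hl]
          refine Tendsto.const_mul _ ?_
          have hpos : 0 < ‖(l.1 : ℂ) * z + l.2‖ :=
            (mul_pos (EisensteinSeries.r_pos z) (zero_lt_one.trans_le (one_le_nrm hl))).trans_le
              (r_mul_nrm_le z hl)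
          have h1 : Continuous fun s : ℝ => ((‖(l.1 : ℂ) * z + l.2‖ ^ (-s) : ℝ) : ℂ) :=
            Complex.continuous_ofReal.comp (by
              exact Continuous.rpow continuous_const continuous_neg fun s => Or.inl hpos.ne')
          exact (h1.tendsto 0).mono_left nhdsWithin_le_nhds
      exact ((hc l).sub (hc _)).const_mul _)
    (by
      filter_upwards [Ioo_mem_nhdsGT (zero_lt_one (α := ℝ))] with s hs l
      rw [norm_mul, norm_latChi, one_mul]
      exact hbound s hs.1.le hs.2.le l)
  have hχ' : 1 - latChi x v ≠ 0 := sub_ne_zero.2 (Ne.symm hχ)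
  have hs : ∀ s : ℝ, 0 < s → ∑' l, latChi x l * (latT 2 z s l - latT 2 z s (l - v)) =
      (1 - latChi x v) * latS 2 x z s := by
    intro s hs
    have h1 := summable_latT (m := 2) z hs.le (by push_cast; linarith) x
    have h2 : Summable fun l => latChi x l * latT 2 z s (l - v) := by
      have h3 := ((Equiv.subRight v).summable_iff.2 h1).mul_left (latChi x v)
      refine h3.congr fun l => ?_
      simp only [Function.comp_apply, Equiv.subRight_apply]
      rw [← mul_assoc, ← latChi_add, add_sub_cancel]
    simp only [mul_sub]
    rw [h1.tsum_sub h2, tsum_latChi_shift, ← latS]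
    ring
  -- At `s = 0` absolute summability is available only for the differences. They are therefore first
  -- written as an iterated sum, and the two parts are separated row by row and then over the rows,
  -- where `hsum` is used.
  have h0 : ∑' l, latChi x l * (latT 2 z 0 l - latT 2 z 0 (l - v)) =
      (1 - latChi x v) * latI 2 x z := by
    have h1 : Summable fun l => latChi x l * (latT 2 z 0 l - latT 2 z 0 (l - v)) := by
      refine Summable.of_norm_bounded hbsum fun l => ?_
      rw [norm_mul, norm_latChi, one_mul]
      exact hbound 0 le_rfl zero_le_one l
    rw [h1.tsum_prod]
    have h2 : ∀ l₁ : ℤ, ∑' l₂ : ℤ, latChi x (l₁, l₂) *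
        (latT 2 z 0 (l₁, l₂) - latT 2 z 0 ((l₁, l₂) - v)) =
        (∑' l₂ : ℤ, latChi x (l₁, l₂) * latT 2 z 0 (l₁, l₂)) -
        latChi x v * ∑' l₂ : ℤ, latChi x (l₁ - v.1, l₂) * latT 2 z 0 (l₁ - v.1, l₂) := by
      intro l₁
      have h3 := summable_latT_right le_rfl z x l₁
      have h4 := ((Equiv.subRight v.2).summable_iff.2
        (summable_latT_right le_rfl z x (l₁ - v.1))).mul_left (latChi x v)
      have h5 : ∀ l₂ : ℤ, latChi x v * ((fun l₂ : ℤ => latChi x (l₁ - v.1, l₂) *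
          latT 2 z 0 (l₁ - v.1, l₂)) ∘ Equiv.subRight v.2) l₂ =
          latChi x (l₁, l₂) * latT 2 z 0 ((l₁, l₂) - v) := by
        intro l₂
        simp only [Function.comp_apply, Equiv.subRight_apply]
        rw [← mul_assoc, ← latChi_add]
        congr 2
        exact Prod.ext (add_sub_cancel _ _) (add_sub_cancel _ _)
      have h6 := (Equiv.subRight v.2).tsum_eq (fun l₂ : ℤ => latChi x (l₁ - v.1, l₂) *
          latT 2 z 0 (l₁ - v.1, l₂))
      rw [← h6, ← tsum_mul_left]
      refine Eq.trans ?_ (h3.tsum_sub h4)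
      congr 1
      funext l₂
      have h10 := h5 l₂
      simp only [Function.comp_apply] at h10
      rw [h10, mul_sub]
    simp only [h2]
    have h7 := ((Equiv.subRight v.1).summable_iff.2 hsum).mul_left (latChi x v)
    have h8 := (Equiv.subRight v.1).tsum_eq (fun l₁ : ℤ =>
      ∑' l₂ : ℤ, latChi x (l₁, l₂) * latT 2 z 0 (l₁, l₂))
    have h9 := hsum.tsum_sub h7
    simp only [Function.comp_apply, Equiv.subRight_apply] at h8 h9
    rw [h9, tsum_mul_left, h8, ← latI]
    ring
  rw [h0] at hlim
  have h10 := hlim.const_mul (1 - latChi x v)⁻¹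
  rw [inv_mul_cancel_left₀ hχ'] at h10
  refine h10.congr' ?_
  filter_upwards [self_mem_nhdsWithin] with s hspos
  rw [hs s hspos, inv_mul_cancel_left₀ hχ']

/-! #### The Eisenstein series as a lattice sum -/

lemma latChi_add_mul {N : ℕ} {x : ℚ × ℚ} (hx : ∃ p q : ℤ, N * x.1 = p ∧ N * x.2 = q)
    (k l : ℤ × ℤ) : latChi x (k.1 * N + l.1, k.2 * N + l.2) = latChi x l := by
  obtain ⟨p, q, hp, hq⟩ := hx
  have h : (k.1 * N + l.1, k.2 * N + l.2) = ((k.1 * N, k.2 * N) : ℤ × ℤ) + l := rfl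
  have h1 : latChi x (k.1 * N, k.2 * N) = 1 := by
    rw [latChi, e2_ratCast_eq_one_iff]
    refine ⟨k.2 * p - k.1 * q, ?_⟩
    push_cast
    rw [← hp, ← hq]
    ring
  rw [h, latChi_add, h1, one_mul]

/-- Writing `k = l / N` with `l ≡ a mod N`, the sums over classes `a` and over `k` merge into one
sum over `l ∈ ℤ²`, the character being `N`-periodic because `N x` is integral. Scaling produces
`N^{m+s}`: the power `N^m` is removed by the normalization, while `N^s` tends to `1`. -/
lemma eisPhiS_eq {m N : ℕ} (hN : 0 < N) {x : ℚ × ℚ}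
    (hx : ∃ p q : ℤ, N * x.1 = p ∧ N * x.2 = q) (z : ℍ) {s : ℝ} (hs : 0 ≤ s) (h : 2 < m + s) :
    eisPhiS m N x z s = ((m - 1).factorial : ℂ) / (2 * Real.pi * Complex.I) ^ m *
      (((N : ℝ) ^ s : ℝ) : ℂ) * latS m x z s := by
  have : NeZero N := ⟨hN.ne'⟩
  have hN0 : (N : ℂ) ≠ 0 := by exact_mod_cast hN.ne'
  have hNr : (0 : ℝ) < N := by exact_mod_cast hN
  have hNq : (N : ℚ) ≠ 0 := by exact_mod_cast hN.ne'
  set E : (ℤ × Fin N) × (ℤ × Fin N) ≃ ℤ × ℤ :=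
    ((Int.divModEquiv N).prodCongr (Int.divModEquiv N)).symm with hE
  set E2 : (Fin N × Fin N) × (ℤ × ℤ) ≃ ℤ × ℤ :=
    ((Equiv.prodComm _ _).trans (Equiv.prodProdProdComm ℤ ℤ (Fin N) (Fin N))).trans E with hE2
  have hE2a : ∀ a n, E2 (a, n) = (n.1 * N + ((a.1 : ℕ) : ℤ), n.2 * N + ((a.2 : ℕ) : ℤ)) :=
    fun a n => rfl
  have hterm : ∀ (a : ℕ × ℕ) (n : ℤ × ℤ),
      (if (a.1 : ℚ) / N + n.1 = 0 ∧ (a.2 : ℚ) / N + n.2 = 0 then (0 : ℂ) else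
      ((((a.1 : ℚ) / N + n.1 : ℚ) : ℂ) * z + (((a.2 : ℚ) / N + n.2 : ℚ) : ℂ)) ^ (-(m : ℤ)) *
      ((‖(((a.1 : ℚ) / N + n.1 : ℚ) : ℂ) * z + (((a.2 : ℚ) / N + n.2 : ℚ) : ℂ)‖ ^ (-s) : ℝ) : ℂ)) =
      (N : ℂ) ^ m * (((N : ℝ) ^ s : ℝ) : ℂ) * latT m z s (n.1 * N + a.1, n.2 * N + a.2) := by
    intro a n
    have hz : ∀ (u : ℕ) (v : ℤ), (u : ℚ) / N + v = ((v * N + u : ℤ) : ℚ) / N := by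
      intro u v
      push_cast
      field_simp
      ring
    simp only [hz, latT]
    have hiff : ∀ u : ℤ, (u : ℚ) / N = 0 ↔ u = 0 := by
      intro u
      rw [div_eq_zero_iff, or_iff_left hNq, Int.cast_eq_zero]
    simp only [hiff]
    by_cases h0 : n.1 * (N : ℤ) + a.1 = 0 ∧ n.2 * (N : ℤ) + a.2 = 0
    · rw [if_pos h0, if_pos (Prod.ext h0.1 h0.2), mul_zero]
    · rw [if_neg h0, if_neg (fun h' => h0 ⟨congrArg Prod.fst h', congrArg Prod.snd h'⟩)]
      have e : (((((n.1 * N + a.1 : ℤ) : ℚ) / N : ℚ) : ℂ) * z +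
          ((((n.2 * N + a.2 : ℤ) : ℚ) / N : ℚ) : ℂ)) =
          (((n.1 * N + a.1 : ℤ) : ℂ) * z + ((n.2 * N + a.2 : ℤ) : ℂ)) / N := by
        push_cast
        field_simp
      rw [e, norm_div, div_zpow, Real.div_rpow (norm_nonneg _) (norm_nonneg _), Complex.norm_natCast,
        Real.rpow_neg hNr.le, zpow_neg (N : ℂ), zpow_natCast, Complex.ofReal_div, Complex.ofReal_inv,
        div_inv_eq_mul, div_inv_eq_mul]
      ring
  have hchi : ∀ (a : Fin N × Fin N) (n : ℤ × ℤ),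
      chi x ((a.1 : ℕ), (a.2 : ℕ)) = latChi x (E2 (a, n)) := by
    intro a n
    rw [hE2a, latChi_add_mul hx n (((a.1 : ℕ) : ℤ), ((a.2 : ℕ) : ℤ))]
    simp [chi, latChi, e2]
  have hS : latS m x z s = ∑ a : Fin N × Fin N, chi x ((a.1 : ℕ), (a.2 : ℕ)) *
      ∑' n : ℤ × ℤ, latT m z s (n.1 * N + ((a.1 : ℕ) : ℤ), n.2 * N + ((a.2 : ℕ) : ℤ)) := by
    have h1 := summable_latT z hs h x
    rw [latS, ← E2.tsum_eq]
    refine (E2.summable_iff.2 h1).tsum_prod.trans ?_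
    rw [tsum_fintype]
    refine Finset.sum_congr rfl fun a _ => ?_
    rw [← tsum_mul_left]
    congr 1
    funext n
    rw [hchi a n, ← hE2a]
    rfl
  rw [eisPhiS, Finset.sum_product, Finset.sum_range]
  simp only [Finset.sum_range]
  rw [hS, ← Fintype.sum_prod_type']
  simp only [eisG]
  rw [Finset.mul_sum, Finset.mul_sum]
  refine Finset.sum_congr rfl fun a _ => ?_
  have h2 := hterm ((a.1 : ℕ), (a.2 : ℕ))
  simp only at h2
  simp only [h2, tsum_mul_left, mul_pow]
  have hNm : (N : ℂ) ^ m ≠ 0 := pow_ne_zero _ hN0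
  have hpi : (2 * Real.pi * Complex.I : ℂ) ≠ 0 := Complex.two_pi_I_ne_zero
  rw [← mul_pow, ← mul_pow, mul_pow, div_mul_eq_div_div]
  field_simp

/-! ### The twisted Lipschitz formula -/

lemma sum_e2_div {D : ℕ} (hD : 0 < D) (n : ℤ) :
    ∑ r ∈ Finset.range D, e2 (r * ((n : ℂ) / D)) = if (D : ℤ) ∣ n then (D : ℂ) else 0 := by
  have hD' : (D : ℂ) ≠ 0 := by exact_mod_cast hD.ne'
  simp only [e2_nat_mul]
  split_ifs with h
  · obtain ⟨k, rfl⟩ := h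
    have : e2 (((D * k : ℤ) : ℂ) / D) = 1 := by
      push_cast
      rw [mul_div_cancel_left₀ _ hD', e2_int]
    rw [this]
    simp
  · have h1 : e2 ((n : ℂ) / D) ≠ 1 := by
      intro h1
      have h2 : ((n : ℂ) / D) = (((n : ℚ) / D : ℚ) : ℂ) := by push_cast; rfl
      rw [h2, e2_ratCast_eq_one_iff] at h1
      obtain ⟨k, hk⟩ := h1
      have hDq : (D : ℚ) ≠ 0 := by exact_mod_cast hD.ne'
      rw [div_eq_iff hDq] at hk
      exact h ⟨k, by rw [mul_comm]; exact_mod_cast hk⟩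
    have h2 := geom_sum_mul (e2 ((n : ℂ) / D)) D
    rw [← e2_nat_mul, mul_div_cancel₀ _ hD', e2_int, sub_self] at h2
    exact (mul_eq_zero.1 h2).resolve_right (sub_ne_zero.2 h1)

/-- The constant of the Lipschitz formula. -/
def lipC (m : ℕ) : ℂ := (-2 * Real.pi * Complex.I) ^ m / (m - 1).factorial

lemma tsum_inv_pow {m : ℕ} (hm : 2 ≤ m) {w : ℂ} (hw : 0 < w.im) :
    ∑' k : ℤ, (w + k) ^ (-(m : ℤ)) = lipC m * ∑' n : ℕ, (n : ℂ) ^ (m - 1) * e2 (n * w) := by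
  have h := EisensteinSeries.qExpansion_identity (k := m - 1) (by omega) ⟨w, hw⟩
  rw [Nat.sub_add_cancel (by omega)] at h
  simp only [one_div] at h
  simp only [zpow_neg, zpow_natCast, lipC, e2_nat_mul]
  exact h

lemma summable_pow_mul_e2 (k : ℕ) {w : ℂ} (hw : 0 < w.im) :
    Summable fun n : ℕ => (n : ℂ) ^ k * e2 (n * w) := by
  have h := summable_pow_mul_cexp k 1 ⟨w, hw⟩
  refine h.congr fun n => ?_
  rw [e2_nat_mul]
  simp [e2]

/-- Write `x = p / D` and split `l` by its residue `r mod D`. The untwisted formula applies to `(w +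
r) / D`, and the sum over `r` of roots of unity selects the `n` with `n ≡ p mod D`, that is `n / D =
j + x`. -/
lemma tsum_lipschitz {m : ℕ} (hm : 2 ≤ m) (x : ℚ) {w : ℂ} (hw : 0 < w.im) :
    ∑' l : ℤ, e2 (-(l * x)) * (w + l) ^ (-(m : ℤ)) =
      lipC m * ∑' j : ℤ, if 0 < (j + x : ℚ) then
        ((j + x : ℚ) : ℂ) ^ (m - 1) * e2 (((j + x : ℚ) : ℂ) * w) else 0 := by
  set D := x.den with hDdef
  have hD : 0 < D := x.den_pos
  have : NeZero D := ⟨hD.ne'⟩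
  have hDc : (D : ℂ) ≠ 0 := by exact_mod_cast hD.ne'
  have hDq : (D : ℚ) ≠ 0 := by exact_mod_cast hD.ne'
  have hDr : (0 : ℝ) < D := by exact_mod_cast hD
  have hDz : (D : ℤ) ≠ 0 := by exact_mod_cast hD.ne'
  have hx : (x : ℂ) = (x.num : ℂ) / D := by
    rw [hDdef]
    exact_mod_cast (Rat.num_div_den x).symm
  have hwr : ∀ r : ℕ, 0 < ((w + r) / D).im := by
    intro r
    rw [Complex.div_natCast_im]
    simp
    positivity
  -- split by residue classes
  have hterm : ∀ (r : Fin D) (k : ℤ),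
      e2 (-(((k * D + (r : ℕ) : ℤ) : ℂ) * x)) * (w + ((k * D + (r : ℕ) : ℤ) : ℂ)) ^ (-(m : ℤ)) =
      e2 (-((r : ℕ) * x)) * ((D : ℂ) ^ m)⁻¹ * ((w + (r : ℕ)) / D + k) ^ (-(m : ℤ)) := by
    intro r k
    have h1 : e2 (-(((k * D + (r : ℕ) : ℤ) : ℂ) * x)) = e2 (-((r : ℕ) * x)) := by
      have : -(((k * D + (r : ℕ) : ℤ) : ℂ) * x) = ((-(k * x.num) : ℤ) : ℂ) + -((r : ℕ) * x) := by
        push_cast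
        rw [add_mul, mul_assoc, hx, mul_div_cancel₀ _ hDc]
        ring
      rw [this, e2_add, e2_int, one_mul]
    have h2 : (w + ((k * D + (r : ℕ) : ℤ) : ℂ)) = D * ((w + (r : ℕ)) / D + k) := by
      push_cast
      field_simp
      ring
    rw [h1, h2, mul_zpow, zpow_neg (D : ℂ), zpow_natCast]
    ring
  have hsum : Summable fun l : ℤ => e2 (-(l * x)) * (w + l) ^ (-(m : ℤ)) := by
    have h := (EisensteinSeries.linear_right_summable w 1 (k := m) (by exact_mod_cast hm)).norm
    refine Summable.of_norm_bounded h fun l => ?_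
    have : (-(l * x) : ℂ) = ((-(l * x) : ℚ) : ℂ) := by push_cast; ring
    rw [norm_mul, this, norm_e2_ratCast]
    simp
  set E : Fin D × ℤ ≃ ℤ := (Equiv.prodComm _ _).trans (Int.divModEquiv D).symm with hE
  have hEa : ∀ r k, E (r, k) = k * D + ((r : ℕ) : ℤ) := fun r k => rfl
  rw [← E.tsum_eq]
  refine ((E.summable_iff.2 hsum).tsum_prod).trans ?_
  rw [tsum_fintype]
  have hinner : ∀ r : Fin D, ∑' k : ℤ, ((fun l : ℤ => e2 (-(l * x)) * (w + l) ^ (-(m : ℤ))) ∘ E)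
      (r, k) = ∑' n : ℕ, lipC m * ((D : ℂ) ^ m)⁻¹ * ((n : ℂ) ^ (m - 1) * e2 (n * (w / D)) *
        e2 ((r : ℕ) * (((n - x.num : ℤ) : ℂ) / D))) := by
    intro r
    simp only [Function.comp_apply, hEa, hterm]
    rw [tsum_mul_left, tsum_inv_pow hm (hwr r), ← tsum_mul_left, ← tsum_mul_left]
    refine tsum_congr fun n => ?_
    have h1 : e2 (n * ((w + (r : ℕ)) / D)) * e2 (-((r : ℕ) * x)) =
        e2 (n * (w / D)) * e2 ((r : ℕ) * (((n - x.num : ℤ) : ℂ) / D)) := by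
      rw [← e2_add, ← e2_add, hx]
      congr 1
      push_cast
      ring
    linear_combination (lipC m * ((D : ℂ) ^ m)⁻¹ * (n : ℂ) ^ (m - 1)) * h1
  rw [Finset.sum_congr rfl fun r _ => hinner r, ← Summable.tsum_finsetSum]
  · have h1 : ∀ n : ℕ, ∑ r : Fin D, lipC m * ((D : ℂ) ^ m)⁻¹ * ((n : ℂ) ^ (m - 1) *
        e2 (n * (w / D)) * e2 ((r : ℕ) * (((n - x.num : ℤ) : ℂ) / D))) =
        lipC m * (if 0 < (n : ℤ) ∧ (D : ℤ) ∣ (n : ℤ) - x.num then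
          (((n : ℤ) : ℂ) / D) ^ (m - 1) * e2 (((n : ℤ) : ℂ) / D * w) else 0) := by
      intro n
      rw [← Finset.mul_sum, ← Finset.mul_sum,
        ← Finset.sum_range fun r : ℕ => e2 (r * (((n - x.num : ℤ) : ℂ) / D)), sum_e2_div hD]
      -- The term `n = 0` drops out because `m ≥ 2` gives `0^(m-1) = 0`.
      rcases Nat.eq_zero_or_pos n with hn | hn
      · subst hn
        have : m - 1 ≠ 0 := by omega
        simp [this]
      · have hn' : (0 : ℤ) < n := by exact_mod_cast hn
        by_cases hd : (D : ℤ) ∣ (n : ℤ) - x.num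
        · rw [if_pos hd, if_pos ⟨hn', hd⟩]
          have hmm : (D : ℂ) ^ m = D ^ (m - 1) * D := by
            rw [← pow_succ, Nat.sub_add_cancel (by omega)]
          have he : (n : ℂ) * (w / D) = ((n : ℤ) : ℂ) / D * w := by push_cast; ring
          rw [he, hmm, div_pow]
          push_cast
          field_simp
        · rw [if_neg hd, if_neg (fun h => hd h.2)]
          simp
    rw [tsum_congr h1, tsum_mul_left]
    congr 1
    have h2 := (Nat.cast_injective (R := ℤ)).tsum_eq (f := fun n : ℤ =>
      if 0 < n ∧ (D : ℤ) ∣ n - x.num then ((n : ℂ) / D) ^ (m - 1) * e2 ((n : ℂ) / D * w) else 0)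
      (by
        intro n hn
        have : 0 < n ∧ (D : ℤ) ∣ n - x.num := by
          by_contra h
          exact hn (if_neg h)
        exact ⟨n.toNat, Int.toNat_of_nonneg this.1.le⟩)
    have hinj : Function.Injective fun j : ℤ => j * D + x.num := by
      intro a b hab
      simpa [hD.ne'] using hab
    have h3 := hinj.tsum_eq (f := fun n : ℤ =>
      if 0 < n ∧ (D : ℤ) ∣ n - x.num then ((n : ℂ) / D) ^ (m - 1) * e2 ((n : ℂ) / D * w) else 0)
      (by
        intro n hn
        have : 0 < n ∧ (D : ℤ) ∣ n - x.num := by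
          by_contra h
          exact hn (if_neg h)
        obtain ⟨k, hk⟩ := this.2
        exact ⟨k, by simp only; linarith⟩)
    refine h2.trans (h3.symm.trans (tsum_congr fun j => ?_))
    have hjx : (j + x : ℚ) = ((j * D + x.num : ℤ) : ℚ) / D := by
      push_cast
      rw [add_div, mul_div_cancel_right₀ _ hDq, Rat.num_div_den]
    have hpos : (0 < j * D + x.num ∧ (D : ℤ) ∣ j * D + x.num - x.num) ↔ 0 < (j + x : ℚ) := by
      rw [hjx]
      have hDq' : (0 : ℚ) < D := by exact_mod_cast hD
      rw [div_pos_iff_of_pos_right hDq', Int.cast_pos]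
      simp
    simp only [hpos]
    rw [hjx]
    push_cast
    rfl
  · intro r _
    refine Summable.mul_left _ ?_
    have h1 : 0 < (w / D).im := by simpa using hwr 0
    refine Summable.of_norm_bounded (summable_pow_mul_e2 (m - 1) h1).norm fun n => ?_
    have : (((r : ℕ) : ℂ) * (((n - x.num : ℤ) : ℂ) / D)) =
        ((((r : ℕ) : ℚ) * (((n - x.num : ℤ) : ℚ) / D) : ℚ) : ℂ) := by push_cast; ring
    rw [norm_mul, this, norm_e2_ratCast, mul_one]

/-! ### Fourier expansions -/

/-- The frequencies `ε (j + x₁)`. -/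
def gu (ε : ℤ) (x : ℚ × ℚ) (j : ℤ) : ℚ := ε * (j + x.1)

/-- The terms `u^{m-1} exp(2πi (l + 1) (ε x₂ + u z))` with `u = ε (j + x₁) > 0`. -/
def gT (m : ℕ) (ε : ℤ) (x : ℚ × ℚ) (z : ℂ) (p : ℕ × ℤ) : ℂ :=
  if 0 < gu ε x p.2 then
    (gu ε x p.2 : ℂ) ^ (m - 1) * e2 ((p.1 + 1) * (ε * x.2 + gu ε x p.2 * z)) else 0

/-- The sum of the terms `gT`. -/
def gS (m : ℕ) (ε : ℤ) (x : ℚ × ℚ) (z : ℂ) : ℂ := ∑' p, gT m ε x z p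

/-- The Fourier expansion of the Eisenstein series `φ^{(m)}_x`. -/
def fourierPhi (m : ℕ) (x : ℚ × ℚ) (z : ℍ) : ℂ :=
  -((bern m x.1 : ℂ) / m) + (gS m 1 x z + (-1) ^ m * gS m (-1) x z)

/-- A summable majorant of the terms `gT`. -/
def gM (m : ℕ) (x : ℚ × ℚ) (c : ℝ) (p : ℕ × ℤ) : ℝ :=
  (if 0 < |((p.2 + x.1 : ℚ) : ℝ)| then
    |((p.2 + x.1 : ℚ) : ℝ)| ^ (m - 1) * Real.exp (-(c * |((p.2 + x.1 : ℚ) : ℝ)|)) else 0) *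
    Real.exp (-(c * ((p.1 + 1 : ℝ) / x.1.den)))

lemma pow_mul_exp_neg_le (k : ℕ) {c t : ℝ} (hc : 0 < c) (ht : 0 < t) :
    t ^ k * Real.exp (-(c * t)) ≤ (k + 2).factorial / c ^ (k + 2) * (1 / t ^ 2) := by
  have h := Real.pow_div_factorial_le_exp (c * t) (by positivity) (k + 2)
  rw [div_le_iff₀ (by positivity)] at h
  rw [Real.exp_neg, div_mul_div_comm, mul_one, le_div_iff₀ (by positivity),
    ← div_eq_mul_inv, div_mul_eq_mul_div, div_le_iff₀ (Real.exp_pos _)]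
  calc t ^ k * (c ^ (k + 2) * t ^ 2) = (c * t) ^ (k + 2) := by ring
    _ ≤ _ := by linarith

lemma summable_gM (m : ℕ) (x : ℚ × ℚ) {c : ℝ} (hc : 0 < c) : Summable (gM m x c) := by
  have hD : (0 : ℝ) < x.1.den := by exact_mod_cast x.1.den_pos
  have h1 : Summable fun j : ℤ => if 0 < |((j + x.1 : ℚ) : ℝ)| then
      |((j + x.1 : ℚ) : ℝ)| ^ (m - 1) * Real.exp (-(c * |((j + x.1 : ℚ) : ℝ)|)) else 0 := by
    have h := (Real.summable_one_div_int_add_rpow (x.1 : ℝ) 2).2 one_lt_two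
    refine Summable.of_nonneg_of_le (fun j => ?_) (fun j => ?_)
      (h.mul_left ((m - 1 + 2).factorial / c ^ (m - 1 + 2)))
    · split_ifs <;> positivity
    · split_ifs with hj
      · have := pow_mul_exp_neg_le (m - 1) hc hj
        push_cast at this ⊢
        rw [Real.rpow_two]
        exact this
      · positivity
  have h2 : Summable fun l : ℕ => Real.exp (-(c * ((l + 1 : ℝ) / x.1.den))) := by
    have hneg : -(c / x.1.den) < 0 := by
      have : 0 < c / x.1.den := by positivity
      linarith
    have h := (Real.summable_exp_nat_mul_iff.2 hneg)
    have h' := (summable_nat_add_iff 1).2 h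
    refine h'.congr fun l => ?_
    congr 1
    push_cast
    ring
  have h3 := Summable.mul_of_nonneg h2 h1 (fun l => (Real.exp_pos _).le)
    (fun j => by simp only; split_ifs <;> positivity)
  refine h3.congr fun p => ?_
  rw [gM, mul_comm]

/-- Frequencies are multiples of `1 / den(x₁)`. This gap above zero is what produces exponential
decay at `i∞`. -/
lemma gu_lower {ε : ℤ} (x : ℚ × ℚ) (j : ℤ) (hu : 0 < gu ε x j) :
    1 / (x.1.den : ℝ) ≤ (gu ε x j : ℝ) := by
  have hD : (0 : ℚ) < x.1.den := by exact_mod_cast x.1.den_pos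
  have e : gu ε x j * x.1.den = ((ε * (j * x.1.den + x.1.num) : ℤ) : ℚ) := by
    rw [gu]
    push_cast
    rw [mul_assoc, add_mul, Rat.mul_den_eq_num]
  have h1 : 0 < gu ε x j * x.1.den := mul_pos hu hD
  rw [e, Int.cast_pos] at h1
  have h2 : (1 : ℚ) ≤ gu ε x j * x.1.den := by
    rw [e]
    exact_mod_cast h1
  have h3 : 1 / (x.1.den : ℚ) ≤ gu ε x j := (div_le_iff₀ hD).2 h2
  have h4 : ((1 / (x.1.den : ℚ) : ℚ) : ℝ) ≤ (gu ε x j : ℝ) := by exact_mod_cast h3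
  push_cast at h4
  exact h4

lemma abs_gu {ε : ℤ} (hε : ε = 1 ∨ ε = -1) (x : ℚ × ℚ) (j : ℤ) (hu : 0 < gu ε x j) :
    |((j + x.1 : ℚ) : ℝ)| = (gu ε x j : ℝ) := by
  have hu' : (0 : ℝ) < (gu ε x j : ℝ) := by exact_mod_cast hu
  rcases hε with rfl | rfl
  · have : ((j + x.1 : ℚ) : ℝ) = (gu 1 x j : ℝ) := by simp [gu]
    rw [this, abs_of_pos hu']
  · have : ((j + x.1 : ℚ) : ℝ) = -(gu (-1) x j : ℝ) := by simp [gu]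
    rw [this, abs_neg, abs_of_pos hu']

lemma norm_gT {m : ℕ} {ε : ℤ} (x : ℚ × ℚ) (z : ℂ) (p : ℕ × ℤ)
    (hu : 0 < gu ε x p.2) : ‖gT m ε x z p‖ = (gu ε x p.2 : ℝ) ^ (m - 1) *
      Real.exp (-(2 * Real.pi * ((p.1 + 1) * (gu ε x p.2 * z.im)))) := by
  have hu' : (0 : ℝ) < (gu ε x p.2 : ℝ) := by exact_mod_cast hu
  rw [gT, if_pos hu, norm_mul, norm_pow, norm_e2]
  have h2 : ((p.1 + 1) * (ε * x.2 + gu ε x p.2 * z) : ℂ).im = (p.1 + 1) * (gu ε x p.2 * z.im) := by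
    simp
  rw [h2]
  congr 2
  rw [← Complex.ofReal_ratCast, Complex.norm_real, Real.norm_of_nonneg hu'.le]

/-- With `L = l + 1` and `d = 1 / den(x₁) ≤ u`, the exponent `2π L u y` is cut in halves. One half
is at least `π d y` and gives the decay at `i∞`; the other is at least `π (δ/2) (u + L d)` and makes
the sum over `(l, j)` converge. -/
lemma norm_gT_le {m : ℕ} {ε : ℤ} (hε : ε = 1 ∨ ε = -1) (x : ℚ × ℚ) {δ : ℝ} (hδ : 0 < δ) {z : ℂ}
    (hz : δ ≤ z.im) (p : ℕ × ℤ) :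
    ‖gT m ε x z p‖ ≤ Real.exp (-(Real.pi / x.1.den) * z.im) * gM m x (Real.pi * (δ / 2)) p := by
  by_cases hu : 0 < gu ε x p.2
  · have hu' : (0 : ℝ) < (gu ε x p.2 : ℝ) := by exact_mod_cast hu
    have hlow := gu_lower x p.2 hu
    have hD : (0 : ℝ) < x.1.den := by exact_mod_cast x.1.den_pos
    rw [norm_gT x z p hu, gM, abs_gu hε x p.2 hu, if_pos hu', mul_assoc (_ ^ (m - 1)),
      ← Real.exp_add, mul_left_comm (Real.exp _), ← Real.exp_add]
    gcongr
    set u : ℝ := (gu ε x p.2 : ℝ)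
    set d : ℝ := 1 / (x.1.den : ℝ) with hd
    have hd0 : 0 < d := by positivity
    set L : ℝ := (p.1 : ℝ) + 1 with hL
    have hL1 : 1 ≤ L := by simp [hL]
    have e : -(Real.pi / x.1.den) * z.im + (-(Real.pi * (δ / 2) * u) +
        -(Real.pi * (δ / 2) * (L / x.1.den))) =
        -(Real.pi * (d * z.im + (δ / 2) * (u + L * d))) := by
      rw [hd]
      ring
    rw [e]
    have h1 : d * z.im ≤ L * u * z.im := by
      have : d ≤ L * u := by nlinarith
      nlinarith
    have h2 : (δ / 2) * (u + L * d) ≤ L * u * z.im := by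
      have h3 : u + L * d ≤ 2 * (L * u) := by nlinarith
      have h4 : L * u * δ ≤ L * u * z.im := by
        have : 0 < L * u := by positivity
        nlinarith
      nlinarith
    have hpi := Real.pi_pos
    nlinarith
  · rw [gT, if_neg hu, norm_zero]
    refine mul_nonneg (Real.exp_pos _).le (mul_nonneg ?_ (Real.exp_pos _).le)
    split_ifs <;> positivity

lemma summable_gT (m : ℕ) {ε : ℤ} (hε : ε = 1 ∨ ε = -1) (x : ℚ × ℚ) {z : ℂ} (hz : 0 < z.im) :
    Summable (gT m ε x z) :=
  Summable.of_norm_bounded ((summable_gM m x (c := Real.pi * (z.im / 2))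
    (by have := Real.pi_pos; positivity)).mul_left _) fun p => norm_gT_le hε x hz le_rfl p

lemma norm_gS_le (m : ℕ) {ε : ℤ} (hε : ε = 1 ∨ ε = -1) (x : ℚ × ℚ) {δ : ℝ} (hδ : 0 < δ) :
    ∃ K : ℝ, ∀ z : ℂ, δ ≤ z.im →
      ‖gS m ε x z‖ ≤ K * Real.exp (-(Real.pi / x.1.den) * z.im) := by
  refine ⟨∑' p, gM m x (Real.pi * (δ / 2)) p, fun z hz => ?_⟩
  rw [mul_comm, ← tsum_mul_left]
  exact tsum_of_norm_bounded ((summable_gM m x (by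
    have := Real.pi_pos; positivity)).mul_left _).hasSum fun p => norm_gT_le hε x hδ hz p

lemma differentiableOn_gS (m : ℕ) {ε : ℤ} (hε : ε = 1 ∨ ε = -1) (x : ℚ × ℚ) :
    DifferentiableOn ℂ (gS m ε x) Hset := by
  intro z hz
  have hz' : 0 < z.im := hz
  have hopen : IsOpen {w : ℂ | z.im / 2 < w.im} := isOpen_lt continuous_const Complex.continuous_im
  have h := Complex.differentiableOn_tsum_of_summable_norm (F := fun p w => gT m ε x w p)
    (U := {w : ℂ | z.im / 2 < w.im}) (summable_gM m x (c := Real.pi * (z.im / 2 / 2))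
    (by have := Real.pi_pos; positivity))
    (by
      intro p
      simp only [gT]
      split_ifs
      · unfold e2
        fun_prop
      · exact differentiableOn_const 0) hopen
    (by
      intro p w hw
      have hw' : z.im / 2 < w.im := hw
      refine (norm_gT_le hε x (δ := z.im / 2) (by positivity) hw'.le p).trans ?_
      refine mul_le_of_le_one_left ?_ ?_
      · refine mul_nonneg ?_ (Real.exp_pos _).le
        split_ifs <;> positivity
      · rw [Real.exp_le_one_iff]
        have : 0 ≤ Real.pi / x.1.den * w.im :=
          mul_nonneg (by have := Real.pi_pos; positivity) (by linarith)
        linarith)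
  have hmem : z ∈ {w : ℂ | z.im / 2 < w.im} := by
    change z.im / 2 < z.im
    linarith
  exact (h.differentiableAt (hopen.mem_nhds hmem)).differentiableWithinAt

lemma goodWith_gS (m : ℕ) {ε : ℤ} (hε : ε = 1 ∨ ε = -1) (x : ℚ × ℚ) :
    GoodWith (fun z => gS m ε x z) 0 := by
  refine ⟨(differentiableOn_gS m hε x).congr fun z hz => ?_, Real.pi / x.1.den, ?_, fun δ hδ => ?_⟩
  · simp [coe_ofComplex hz]
  · have := x.1.den_pos
    have := Real.pi_pos
    positivity
  · obtain ⟨K, hK⟩ := norm_gS_le m hε x hδ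
    exact ⟨K, fun z hz => by simpa using hK z hz⟩

lemma goodWith_fourierPhi (m : ℕ) (x : ℚ × ℚ) :
    GoodWith (fourierPhi m x) (-((bern m x.1 : ℂ) / m)) := by
  have h := (goodWith_const (-((bern m x.1 : ℂ) / m))).add
    ((goodWith_gS m (.inl rfl) x).add ((goodWith_gS m (.inr rfl) x).const_mul ((-1) ^ m)))
  simp only [mul_zero, add_zero] at h
  exact h

/-! #### The iterated lattice sum -/

/-- The normalizing constant of the Eisenstein series. -/
def eisC (m : ℕ) : ℂ := ((m - 1).factorial : ℂ) / (2 * Real.pi * Complex.I) ^ m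

lemma eisC_mul_lipC (m : ℕ) : eisC m * lipC m = (-1) ^ m := by
  have h : (2 * Real.pi * Complex.I : ℂ) ≠ 0 := Complex.two_pi_I_ne_zero
  have h2 : ((m - 1).factorial : ℂ) ≠ 0 := by exact_mod_cast (Nat.factorial_pos _).ne'
  have e : (-2 * Real.pi * Complex.I : ℂ) = -1 * (2 * Real.pi * Complex.I) := by ring
  have h3 := pow_ne_zero m h
  rw [eisC, lipC, e]
  generalize (2 * Real.pi * Complex.I : ℂ) = c at *
  rw [mul_pow]
  field_simp

/-- The inner sums `∑_{l₂} χ_x(l) (l₁ z + l₂)^{-m}`. -/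
def latInner (m : ℕ) (x : ℚ × ℚ) (z : ℍ) (l₁ : ℤ) : ℂ :=
  ∑' l₂ : ℤ, latChi x (l₁, l₂) * latT m z 0 (l₁, l₂)

/-- This is the Lipschitz formula with twist `-x₁`; the frequencies `j - x₁` become `-(j + x₁)`
after `j ↦ -j`, which is the case `ε = -1`. -/
lemma latInner_pos {m : ℕ} (hm : 2 ≤ m) (x : ℚ × ℚ) (z : ℍ) (l : ℕ) :
    eisC m * latInner m x z (l + 1) = (-1) ^ m * ∑' j : ℤ, gT m (-1) x z (l, j) := by
  have hw : 0 < (((l + 1 : ℕ) : ℂ) * z).im := by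
    have : 0 < (z : ℂ).im := z.im_pos
    rw [← Complex.ofReal_natCast, Complex.im_ofReal_mul]
    positivity
  have h := tsum_lipschitz hm (-x.1) hw
  have h1 : latInner m x z (l + 1) = e2 ((-((l + 1) * x.2) : ℚ) : ℂ) *
      ∑' l₂ : ℤ, e2 (-(l₂ * ((-x.1 : ℚ) : ℂ))) * (((l + 1 : ℕ) : ℂ) * z + l₂) ^ (-(m : ℤ)) := by
    rw [latInner, ← tsum_mul_left]
    refine tsum_congr fun l₂ => ?_
    have hne : ¬ (((l + 1 : ℤ), l₂) : ℤ × ℤ) = 0 := by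
      intro h
      have := congrArg Prod.fst h
      simp at this
      omega
    rw [latT, if_neg hne, ← mul_assoc (e2 _), ← e2_add, latChi]
    simp only [neg_zero, Real.rpow_zero, Complex.ofReal_one, mul_one]
    push_cast
    congr 2
    ring
  rw [h1, h, mul_left_comm (e2 _), ← mul_assoc (eisC m), eisC_mul_lipC, ← tsum_mul_left,
    ← (Equiv.neg ℤ).tsum_eq]
  congr 1
  refine tsum_congr fun j => ?_
  have hg : (((Equiv.neg ℤ) j : ℤ) + -x.1 : ℚ) = gu (-1) x j := by
    simp [gu]
    ring
  rw [gT, hg]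
  simp only
  split_ifs with hu
  · rw [mul_left_comm, ← e2_add]
    congr 2
    push_cast
    ring
  · rw [mul_zero]

/-- Changing the sign of `l` gives a factor `(-1)^m`, which cancels the one in `eisC_mul_lipC`;
hence no sign remains here, unlike in `latInner_pos`. -/
lemma latInner_neg {m : ℕ} (hm : 2 ≤ m) (x : ℚ × ℚ) (z : ℍ) (l : ℕ) :
    eisC m * latInner m x z (-(l + 1)) = ∑' j : ℤ, gT m 1 x z (l, j) := by
  have hw : 0 < (((l + 1 : ℕ) : ℂ) * z).im := by
    have : 0 < (z : ℂ).im := z.im_pos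
    rw [← Complex.ofReal_natCast, Complex.im_ofReal_mul]
    positivity
  have h := tsum_lipschitz hm x.1 hw
  have h1 : latInner m x z (-(l + 1)) = (-1) ^ m * (e2 (((l + 1) * x.2 : ℚ) : ℂ) *
      ∑' l₂ : ℤ, e2 (-(l₂ * (x.1 : ℂ))) * (((l + 1 : ℕ) : ℂ) * z + l₂) ^ (-(m : ℤ))) := by
    rw [latInner, ← tsum_mul_left, ← tsum_mul_left, ← (Equiv.neg ℤ).tsum_eq]
    refine tsum_congr fun l₂ => ?_
    have hne : ¬ ((-(l + 1 : ℤ), Equiv.neg ℤ l₂) : ℤ × ℤ) = 0 := by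
      intro h
      have := congrArg Prod.fst h
      simp at this
      omega
    rw [latT, if_neg hne, ← mul_assoc (e2 _), ← e2_add, latChi]
    simp only [neg_zero, Real.rpow_zero, Complex.ofReal_one, mul_one, Equiv.neg_apply]
    push_cast
    have e : (-((l : ℂ) + 1) * z + -l₂) = (-1) * (((l : ℂ) + 1) * z + l₂) := by ring
    have e1 : ((-1 : ℂ)) ^ (-(m : ℤ)) = (-1) ^ m := by
      rw [zpow_neg, zpow_natCast, ← inv_pow]
      norm_num
    rw [e, mul_zpow, e1, ← mul_assoc, mul_comm (e2 _) ((-1) ^ m), mul_assoc]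
    congr 3
    ring
  rw [h1, h, mul_left_comm (e2 _), mul_left_comm (eisC m), ← mul_assoc (eisC m), eisC_mul_lipC,
    ← mul_assoc, ← mul_pow, neg_one_mul, neg_neg, one_pow, one_mul, ← tsum_mul_left]
  refine tsum_congr fun j => ?_
  have hg : (j + x.1 : ℚ) = gu 1 x j := by
    simp [gu]
  rw [gT, hg]
  simp only
  split_ifs with hu
  · rw [mul_left_comm, ← e2_add]
    congr 2
    push_cast
    ring
  · rw [mul_zero]

/-- The row `l₁ = 0` is the Fourier series of the periodic Bernoulli function in `x₁`. -/
lemma latInner_zero {m : ℕ} (hm : 2 ≤ m) (x : ℚ × ℚ) (z : ℍ) :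
    eisC m * latInner m x z 0 = -((bern m x.1 : ℂ) / m) := by
  have hsum := (summable_latT_right hm z x 0).hasSum
  rw [← latInner] at hsum
  have h1 := hsum.nat_add_neg
  have h00 : latT m z 0 (0, 0) = 0 := if_pos rfl
  rw [h00, mul_zero, add_zero] at h1
  have hfr : ((Int.fract x.1 : ℚ) : ℝ) ∈ Set.Icc (0 : ℝ) 1 :=
    ⟨by exact_mod_cast Int.fract_nonneg x.1, by exact_mod_cast (Int.fract_lt_one x.1).le⟩
  have h2 := hasSum_one_div_nat_pow_mul_fourier hm hfr
  have h3 : latInner m x z 0 = -(2 * Real.pi * Complex.I) ^ m / m.factorial *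
      bernoulliFun m ((Int.fract x.1 : ℚ) : ℝ) := by
    refine h1.unique (h2.congr_fun ?_)
    intro n
    have he : ∀ k : ℤ, (fourier k) (((Int.fract x.1 : ℚ) : ℝ) : UnitAddCircle) =
        latChi x (0, k) := by
      intro k
      rw [fourier_coe_apply, latChi]
      have : ((((0, k) : ℤ × ℤ).2 * x.1 - ((0, k) : ℤ × ℤ).1 * x.2 : ℚ) : ℂ) =
          ((k * ⌊x.1⌋ : ℤ) : ℂ) + (k * ((Int.fract x.1 : ℚ) : ℂ)) := by
        simp only [Int.fract]
        push_cast
        ring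
      rw [this, e2_add, e2_int, one_mul, e2]
      congr 1
      rw [Complex.ofReal_ratCast]
      push_cast
      ring
    rw [he, he]
    by_cases hn : n = 0
    · subst hn
      have hm0 : m ≠ 0 := by omega
      simp [h00, hm0]
    · have hne : ∀ k : ℤ, k ≠ 0 → ¬ ((0, k) : ℤ × ℤ) = 0 := by
        intro k hk h
        exact hk (congrArg Prod.snd h)
      have hn' : (n : ℤ) ≠ 0 := by exact_mod_cast hn
      rw [latT, latT, if_neg (hne _ hn'), if_neg (hne _ (neg_ne_zero.2 hn'))]
      simp only [neg_zero, Real.rpow_zero, Complex.ofReal_one, mul_one]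
      push_cast
      have e1 : ((-1 : ℂ)) ^ (-(m : ℤ)) = (-1) ^ m := by
        rw [zpow_neg, zpow_natCast, ← inv_pow]
        norm_num
      rw [zero_mul, zero_add, zero_add, ← neg_one_mul (n : ℂ), mul_zpow, e1, zpow_neg, zpow_natCast,
        one_div]
      ring
  have hb : bernoulliFun m ((Int.fract x.1 : ℚ) : ℝ) = ((bern m x.1 : ℚ) : ℝ) := by
    rw [bern, if_neg (by omega), bernoulliFun, Polynomial.eval_map]
    exact Polynomial.eval₂_at_apply (algebraMap ℚ ℝ) (Int.fract x.1)
  rw [h3, hb, eisC]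
  have h : (2 * Real.pi * Complex.I : ℂ) ≠ 0 := Complex.two_pi_I_ne_zero
  have hf : (m.factorial : ℂ) = m * (m - 1).factorial := by
    rw [← Nat.mul_factorial_pred (by omega : m ≠ 0)]
    push_cast
    rfl
  have h4 : ((m - 1).factorial : ℂ) ≠ 0 := by exact_mod_cast (Nat.factorial_pos _).ne'
  have h5 : (m : ℂ) ≠ 0 := by exact_mod_cast (by omega : m ≠ 0)
  rw [hf]
  push_cast
  field_simp

lemma eisC_ne (m : ℕ) : eisC m ≠ 0 := by
  have h : (2 * Real.pi * Complex.I : ℂ) ≠ 0 := Complex.two_pi_I_ne_zero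
  have h4 : ((m - 1).factorial : ℂ) ≠ 0 := by exact_mod_cast (Nat.factorial_pos _).ne'
  exact div_ne_zero h4 (pow_ne_zero _ h)

lemma hasSum_latInner {m : ℕ} (hm : 2 ≤ m) (x : ℚ × ℚ) (z : ℍ) :
    HasSum (fun l₁ => eisC m * latInner m x z l₁) (fourierPhi m x z) := by
  have hz : 0 < (z : ℂ).im := z.im_pos
  have hp := (summable_gT m (.inl rfl) x hz (ε := 1)).hasSum
  have hn := (summable_gT m (.inr rfl) x hz (ε := -1)).hasSum
  have hp' := hp.prod_fiberwise fun l => (hp.summable.prod_factor l).hasSum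
  have hn' := (hn.prod_fiberwise fun l => (hn.summable.prod_factor l).hasSum).mul_left ((-1) ^ m)
  simp only [← latInner_neg hm] at hp'
  simp only [← latInner_pos hm] at hn'
  have hn2 : HasSum (fun n : ℕ => eisC m * latInner m x z n)
      (-((bern m x.1 : ℂ) / m) + (-1) ^ m * gS m (-1) x z) := by
    rw [← hasSum_nat_add_iff' 1]
    simp only [Finset.sum_range_one, Nat.cast_zero, latInner_zero hm, add_sub_cancel_left]
    push_cast
    exact hn'
  have h := hn2.of_nat_of_neg_add_one (f := fun l₁ : ℤ => eisC m * latInner m x z l₁)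
    (by simpa using hp')
  convert h using 1
  rw [fourierPhi, gS, gS]
  ring

/-! ### Transformation behaviour of the Eisenstein series -/

/-- In weight `2` the parameter has to be nonzero modulo `ℤ²`. -/
def Adm (m : ℕ) (x : ℚ × ℚ) : Prop := m = 2 → ¬ ∃ p q : ℤ, x.1 = p ∧ x.2 = q

lemma summable_latInner {m : ℕ} (hm : 2 ≤ m) (x : ℚ × ℚ) (z : ℍ) :
    Summable (latInner m x z) :=
  (summable_mul_left_iff (eisC_ne m)).1 (hasSum_latInner hm x z).summable

lemma eisC_mul_latI {m : ℕ} (hm : 2 ≤ m) (x : ℚ × ℚ) (z : ℍ) :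
    eisC m * latI m x z = fourierPhi m x z := by
  rw [← (hasSum_latInner hm x z).tsum_eq, tsum_mul_left]
  rfl

/-- The filter treats both cases at once: a one-sided limit in weight `2`, plain evaluation at `s =
0` in higher weight. -/
lemma tendsto_eisC_mul_latS {m : ℕ} (hm : 2 ≤ m) {x : ℚ × ℚ} (hx : Adm m x) (z : ℍ) :
    Tendsto (fun s => eisC m * latS m x z s) (if m = 2 then 𝓝[>] 0 else pure 0)
      (𝓝 (fourierPhi m x z)) := by
  rw [← eisC_mul_latI hm]
  refine Tendsto.const_mul _ ?_
  split_ifs with h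
  · subst h
    exact tendsto_latS (hx rfl) z (summable_latInner hm x z)
  · have h1 := (summable_latT (m := m) z le_rfl (by
      have : (3 : ℝ) ≤ m := by exact_mod_cast (by omega : 3 ≤ m)
      linarith) x).tsum_prod
    have h2 : latS m x z 0 = latI m x z := h1
    rw [← h2]
    exact tendsto_pure_nhds _ _

lemma eisPhi_eq {m N : ℕ} (hm : 2 ≤ m) (hN : 0 < N) {x : ℚ × ℚ}
    (hx : ∃ p q : ℤ, N * x.1 = p ∧ N * x.2 = q) (hx0 : Adm m x) :
    eisPhi m N x = fourierPhi m x := by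
  funext z
  have hlim := tendsto_eisC_mul_latS hm hx0 z
  have hNr : (0 : ℝ) < N := by exact_mod_cast hN
  rw [eisPhi]
  split_ifs at hlim ⊢ with h
  · refine Tendsto.limUnder_eq ?_
    have h1 : Tendsto (fun s : ℝ => (((N : ℝ) ^ s : ℝ) : ℂ)) (𝓝[>] 0) (𝓝 1) := by
      have hc : Continuous fun s : ℝ => (((N : ℝ) ^ s : ℝ) : ℂ) :=
        Complex.continuous_ofReal.comp (Real.continuous_const_rpow hNr.ne')
      have := (hc.tendsto 0).mono_left (nhdsWithin_le_nhds (s := Set.Ioi 0))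
      simpa using this
    have h2 := h1.mul hlim
    rw [one_mul] at h2
    refine h2.congr' ?_
    filter_upwards [self_mem_nhdsWithin] with s hs
    have hs' : 0 < s := hs
    rw [eisPhiS_eq hN hx z hs'.le (by rw [h]; push_cast; linarith), eisC]
    ring
  · have h1 : 2 < (m : ℝ) + 0 := by
      have : (3 : ℝ) ≤ m := by exact_mod_cast (by omega : 3 ≤ m)
      linarith
    rw [eisPhiS_eq hN hx z le_rfl h1, Real.rpow_zero, Complex.ofReal_one, mul_one]
    exact tendsto_nhds_unique (tendsto_pure_nhds (fun s => eisC m * latS m x z s) (0 : ℝ)) hlim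

lemma rowSL_mul (x : ℚ × ℚ) (σ τ : SL(2, ℤ)) : rowSL x (σ * τ) = rowSL (rowSL x σ) τ := by
  refine Prod.ext ?_ ?_ <;>
  · simp only [rowSL, Matrix.SpecialLinearGroup.coe_mul, Matrix.mul_apply, Fin.sum_univ_two]
    push_cast
    ring

lemma rowSL_one (x : ℚ × ℚ) : rowSL x 1 = x := by
  refine Prod.ext ?_ ?_ <;> simp [rowSL]

lemma Adm.rowSL {m : ℕ} {x : ℚ × ℚ} (hx : Adm m x) (σ : SL(2, ℤ)) : Adm m (rowSL x σ) := by
  intro hm ⟨p, q, hp, hq⟩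
  refine hx hm ⟨σ⁻¹ 0 0 * p + σ⁻¹ 1 0 * q, σ⁻¹ 0 1 * p + σ⁻¹ 1 1 * q, ?_⟩
  have h : Transgress.rowSL (Transgress.rowSL x σ) σ⁻¹ = x := by
    rw [← rowSL_mul, mul_inv_cancel, rowSL_one]
  conv_lhs => rw [← h]
  conv_rhs => rw [← h]
  rw [Transgress.rowSL, hp, hq]
  push_cast
  exact ⟨rfl, rfl⟩

/-- The transformation law of the lattice sum holds for every `s`, and its non-holomorphic factor
`|cz + d|^s` tends to `1`. -/
lemma slash_fourierPhi {m : ℕ} (hm : 2 ≤ m) {x : ℚ × ℚ} (hx : Adm m x) (σ : SL(2, ℤ)) :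
    slash m (ofSL σ) (fourierPhi m x) = fourierPhi m (rowSL x σ) := by
  funext z
  have hd := denom_ne_zero (toReal (ofSL σ)) z
  have h1 := tendsto_eisC_mul_latS hm hx (moeb (ofSL σ) z)
  have h2 := tendsto_eisC_mul_latS hm (hx.rowSL σ) z
  set l : Filter ℝ := if m = 2 then 𝓝[>] 0 else pure 0 with hl
  have hl0 : l ≤ 𝓝 0 := by
    rw [hl]
    split_ifs
    · exact nhdsWithin_le_nhds
    · exact pure_le_nhds 0
  have : l.NeBot := by
    rw [hl]
    split_ifs <;> infer_instance
  have h3 : Tendsto (fun s : ℝ => denom (toReal (ofSL σ)) z ^ m *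
      ((‖denom (toReal (ofSL σ)) z‖ ^ s : ℝ) : ℂ)) l (𝓝 (denom (toReal (ofSL σ)) z ^ m * 1)) := by
    refine Tendsto.const_mul _ ?_
    have hc : Continuous fun s : ℝ => ((‖denom (toReal (ofSL σ)) z‖ ^ s : ℝ) : ℂ) :=
      Complex.continuous_ofReal.comp (Real.continuous_const_rpow (norm_ne_zero_iff.2 hd))
    have := (hc.tendsto 0).mono_left hl0
    simpa using this
  have h4 := h3.mul h2
  have h5 : fourierPhi m x (moeb (ofSL σ) z) =
      denom (toReal (ofSL σ)) z ^ m * 1 * fourierPhi m (rowSL x σ) z := by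
    refine tendsto_nhds_unique h1 (h4.congr fun s => ?_)
    rw [latS_moeb]
    ring
  rw [slash_apply, h5, realDet_ofSL]
  simp only [Real.one_rpow, Complex.ofReal_one, one_mul, mul_one, zpow_neg, zpow_natCast]
  rw [inv_mul_cancel_left₀ (pow_ne_zero _ hd)]

lemma gS_add_int (m : ℕ) (ε : ℤ) (x : ℚ × ℚ) (p q : ℤ) :
    gS m ε (x.1 + p, x.2 + q) = gS m ε x := by
  funext z
  rw [gS, gS, ← ((Equiv.refl ℕ).prodCongr (Equiv.addRight p)).tsum_eq (gT m ε x z)]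
  refine tsum_congr fun k => ?_
  have he : ((Equiv.refl ℕ).prodCongr (Equiv.addRight p)) k = (k.1, k.2 + p) := rfl
  have h : gu ε (x.1 + p, x.2 + q) k.2 = gu ε x (k.2 + p) := by
    simp only [gu]
    push_cast
    ring
  rw [he]
  simp only [gT, h]
  split_ifs
  · have : ((k.1 + 1 : ℂ) * (ε * ((x.2 + q : ℚ) : ℂ) + gu ε x (k.2 + p) * z)) =
        (((k.1 + 1) * ε * q : ℤ) : ℂ) + (k.1 + 1) * (ε * x.2 + gu ε x (k.2 + p) * z) := by
      push_cast
      ring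
    rw [this, e2_add, e2_int, one_mul]
  · rfl

lemma bern_add_int (j : ℕ) (y : ℚ) (n : ℤ) : bern j (y + n) = bern j y := by
  rw [bern, bern, Int.fract_add_intCast]

lemma fourierPhi_add_int (m : ℕ) (x : ℚ × ℚ) (p q : ℤ) :
    fourierPhi m (x.1 + p, x.2 + q) = fourierPhi m x := by
  funext z
  simp only [fourierPhi, gS_add_int, bern_add_int]

/-! #### Regularity at all cusps -/

/-- The first column of `γ` is proportional to a primitive integral vector, which is completed to a
matrix in `SL(2, ℤ)`. -/
lemma exists_SL_borel (γ : GL(2, ℚ)⁺) : ∃ (σ : SL(2, ℤ)) (β : GL(2, ℚ)⁺),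
    entry β 1 0 = 0 ∧ γ = ofSL σ * β := by
  by_cases hc : entry γ 1 0 = 0
  · refine ⟨1, γ, hc, ?_⟩
    have : ofSL 1 = 1 := by
      have h := ofSL_mul 1 1
      rw [one_mul] at h
      exact (mul_eq_left.1 h.symm)
    rw [this, one_mul]
  · set t : ℚ := entry γ 0 0 / entry γ 1 0 with ht
    have hcop : IsCoprime t.num (t.den : ℤ) := Rat.isCoprime_num_den t
    obtain ⟨u, v, huv⟩ := hcop
    let σ : SL(2, ℤ) := ⟨!![t.num, -v; t.den, u], by rw [Matrix.det_fin_two_of]; linarith⟩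
    refine ⟨σ, ofSL σ⁻¹ * γ, ?_, ?_⟩
    · rw [entry_mul, entry_ofSL, entry_ofSL]
      have h10 : σ⁻¹ 1 0 = -(t.den : ℤ) := by
        rw [Matrix.SpecialLinearGroup.SL2_inv_expl]
        simp [σ]
      have h11 : σ⁻¹ 1 1 = t.num := by
        rw [Matrix.SpecialLinearGroup.SL2_inv_expl]
        simp [σ]
      rw [h10, h11]
      have h3 : entry γ 0 0 = t * entry γ 1 0 := by rw [ht, div_mul_cancel₀ _ hc]
      have h4 := Rat.mul_den_eq_num t
      rw [h3, ← h4]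
      push_cast
      ring
    · rw [← mul_assoc, ← ofSL_mul, mul_inv_cancel]
      have : ofSL 1 = 1 := by
        have h := ofSL_mul 1 1
        rw [one_mul] at h
        exact (mul_eq_left.1 h.symm)
      rw [this, one_mul]

lemma goodAll_fourierPhi {m : ℕ} (hm : 2 ≤ m) {x : ℚ × ℚ} (hx : Adm m x) :
    GoodAll m (fourierPhi m x) := by
  intro γ
  obtain ⟨σ, β, hβ, rfl⟩ := exists_SL_borel γ
  rw [slash_mul_group, slash_fourierPhi hm hx]
  exact ⟨_, (goodWith_fourierPhi m _).slash_borel hβ⟩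

/-! #### Distribution relations -/

/-- The translates `((x₁ + r)/c, x₂ + a (x₁ + r)/c)`. -/
def distPt (x : ℚ × ℚ) (a : ℤ) (c r : ℕ) : ℚ × ℚ := ((x.1 + r) / c, x.2 + a * ((x.1 + r) / c))

lemma Adm.distPt {m : ℕ} {x : ℚ × ℚ} (hx : Adm m x) (a : ℤ) {c : ℕ} (hc : 0 < c) (r : ℕ) :
    Adm m (distPt x a c r) := by
  intro hm ⟨p, q, hp, hq⟩
  have hc' : (c : ℚ) ≠ 0 := by exact_mod_cast hc.ne'
  simp only [Transgress.distPt] at hp hq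
  rw [hp] at hq
  rw [div_eq_iff hc'] at hp
  refine hx hm ⟨p * c - r, q - a * p, ?_, ?_⟩
  · push_cast
    linarith
  · push_cast
    linarith

/-- Division with remainder `j = j' c + r` gives `j + x₁ = c (j' + (x₁ + r)/c)`, and the phases then
agree up to an integer. -/
lemma gS_dist (m : ℕ) {ε : ℤ} (hε : ε = 1 ∨ ε = -1) (x : ℚ × ℚ) (a : ℤ) {c : ℕ}
    (hc : 0 < c) {z : ℂ} (hz : 0 < z.im) :
    gS m ε x ((z + a) / c) = (c : ℂ) ^ (m - 1) *
      ∑ r ∈ Finset.range c, gS m ε (distPt x a c r) z := by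
  have : NeZero c := ⟨hc.ne'⟩
  have hc' : (c : ℂ) ≠ 0 := by exact_mod_cast hc.ne'
  have hcq : (c : ℚ) ≠ 0 := by exact_mod_cast hc.ne'
  have hcpos : (0 : ℚ) < c := by exact_mod_cast hc
  have hcr : (0 : ℝ) < c := by exact_mod_cast hc
  have hw : 0 < ((z + a) / c).im := by
    rw [Complex.div_natCast_im]
    simp
    positivity
  set E : Fin c × (ℕ × ℤ) ≃ ℕ × ℤ :=
    ((Equiv.prodAssoc _ _ _).symm.trans ((Equiv.prodComm _ _).prodCongr (Equiv.refl ℤ))).trans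
      ((Equiv.prodAssoc _ _ _).trans ((Equiv.refl ℕ).prodCongr
        ((Equiv.prodComm _ _).trans (Int.divModEquiv c).symm))) with hE
  have hEa : ∀ r p, E (r, p) = (p.1, p.2 * c + ((r : ℕ) : ℤ)) := fun r p => rfl
  have hterm : ∀ r p, gT m ε x ((z + a) / c) (E (r, p)) =
      (c : ℂ) ^ (m - 1) * gT m ε (distPt x a c r) z p := by
    intro r p
    have hg : gu ε x (p.2 * c + ((r : ℕ) : ℤ)) = c * gu ε (distPt x a c r) p.2 := by
      simp only [gu, distPt]
      push_cast
      field_simp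
      ring
    rw [hEa]
    simp only [gT, hg, mul_pos_iff_of_pos_left hcpos]
    split_ifs
    · push_cast
      rw [mul_pow, mul_assoc]
      congr 2
      have : ((p.1 + 1 : ℂ) * (ε * x.2 + c * gu ε (distPt x a c r) p.2 * ((z + a) / c))) =
          (((p.1 + 1) * ε * p.2 * a : ℤ) : ℂ) + (p.1 + 1) * (ε * ((distPt x a c r).2 : ℚ) +
            gu ε (distPt x a c r) p.2 * z) := by
        simp only [gu, distPt]
        push_cast
        field_simp
        ring
      rw [this, e2_add, e2_int, one_mul]
    · rw [mul_zero]
  rw [gS, ← E.tsum_eq]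
  refine ((E.summable_iff.2 (summable_gT m hε x hw)).tsum_prod).trans ?_
  rw [tsum_fintype, Finset.mul_sum, Finset.sum_range]
  refine Finset.sum_congr rfl fun r _ => ?_
  rw [gS, ← tsum_mul_left]
  exact tsum_congr fun p => hterm r p

/-- The matrix `(p, q; 0, r)`. -/
def upper (p q r : ℚ) (h : 0 < p * r) : GL(2, ℚ)⁺ :=
  ⟨Matrix.GeneralLinearGroup.mkOfDetNeZero !![p, q; 0, r] (by
    rw [Matrix.det_fin_two_of]; linarith), by
    rw [Matrix.mem_glpos]
    simp [Matrix.GeneralLinearGroup.mkOfDetNeZero, h]⟩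

lemma entry_upper (p q r : ℚ) (h : 0 < p * r) : entry (upper p q r h) 0 0 = p ∧
    entry (upper p q r h) 0 1 = q ∧ entry (upper p q r h) 1 0 = 0 ∧ entry (upper p q r h) 1 1 = r :=
  ⟨rfl, rfl, rfl, rfl⟩

/-- By `gS_dist` the nonconstant Fourier terms agree, so the two sides differ by a constant `κ`.
This constant is a combination of good functions, hence zero; no identity between Bernoulli
polynomials has to be checked. -/
lemma slash_upper_fourierPhi {m : ℕ} (hm : 2 ≤ m) {x : ℚ × ℚ} (hx : Adm m x) (a : ℤ) {c : ℕ}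
    (hc : 0 < c) (h : 0 < (1 : ℚ) * c) :
    slash m (upper 1 a c h) (fourierPhi m x) = fun z =>
      borelFac m (upper 1 a c h) * (c : ℂ) ^ (m - 1) *
        ∑ r ∈ Finset.range c, fourierPhi m (distPt x a c r) z := by
  set β := upper 1 a c h with hβdef
  obtain ⟨h00, h01, h10, h11⟩ := entry_upper 1 a c h
  rw [← hβdef] at h00 h01 h10 h11
  set K := borelFac m β * (c : ℂ) ^ (m - 1) with hK
  set κ : ℂ := borelFac m β * (-((bern m x.1 : ℂ) / m)) -
    K * ∑ r ∈ Finset.range c, (-((bern m (distPt x a c r).1 : ℂ) / m)) with hκ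
  have key : ∀ z, slash m β (fourierPhi m x) z =
      K * ∑ r ∈ Finset.range c, fourierPhi m (distPt x a c r) z + κ := by
    intro z
    have hz : (moeb β z : ℂ) = ((z : ℂ) + a) / c := by
      rw [coe_moeb, h00, h01, h10, h11]
      simp
    rw [slash_borel h10, fourierPhi, hz, gS_dist m (.inl rfl) x a hc z.im_pos,
      gS_dist m (.inr rfl) x a hc z.im_pos, hκ]
    simp only [fourierPhi, Finset.sum_add_distrib, ← Finset.mul_sum]
    rw [hK]
    ring
  have hconst : GoodAll m fun _ => κ := by
    have h1 : GoodAll m (slash m β (fourierPhi m x)) := (goodAll_fourierPhi hm hx).slash β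
    have h2 := (GoodAll.sum (Finset.range c) fun r _ =>
      goodAll_fourierPhi hm (hx.distPt a hc r)).const_mul (-K)
    have h3 := h1.add h2
    have e : (fun z => slash m β (fourierPhi m x) z + -K * ∑ r ∈ Finset.range c,
        fourierPhi m (distPt x a c r) z) = fun _ => κ := by
      funext z
      rw [key]
      ring
    rwa [e] at h3
  have h0 := eq_zero_of_goodAll_const (by omega) hconst
  funext z
  rw [key, h0, add_zero]

/-! #### Complex conjugation -/

lemma conj_e2 (t : ℂ) : (starRingEnd ℂ) (e2 t) = e2 (-(starRingEnd ℂ) t) := by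
  rw [e2, e2, ← Complex.exp_conj]
  congr 1
  simp [Complex.conj_ofNat]

/-- On the imaginary axis `exp(2πi u z)` is real, so conjugation only reverses the phase in `x₂`. -/
lemma conj_gT (m : ℕ) (ε : ℤ) (x : ℚ × ℚ) (y : ℝ) (p : ℕ × ℤ) :
    (starRingEnd ℂ) (gT m ε x (y * Complex.I) p) = gT m ε (x.1, -x.2) (y * Complex.I) p := by
  have h : gu ε (x.1, -x.2) p.2 = gu ε x p.2 := rfl
  simp only [gT, h]
  split_ifs
  · rw [map_mul, map_pow, conj_e2]
    congr 2
    · exact map_ratCast _ _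
    · simp
      ring
  · exact map_zero _

lemma conj_gS (m : ℕ) (ε : ℤ) (x : ℚ × ℚ) (y : ℝ) :
    (starRingEnd ℂ) (gS m ε x (y * Complex.I)) = gS m ε (x.1, -x.2) (y * Complex.I) := by
  rw [gS, gS, Complex.conj_tsum]
  exact tsum_congr fun p => conj_gT m ε x y p

/-! ### Special values of the periodic and Hurwitz zeta functions -/

open HurwitzZeta

lemma one_sub_mem_slitPlane {ζ : ℂ} (hn : ‖ζ‖ ≤ 1) (h : ζ ≠ 1) : 1 - ζ ∈ Complex.slitPlane := by
  left
  rw [Complex.sub_re, Complex.one_re]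
  have h1 : ζ.re ≤ 1 := (Complex.re_le_norm ζ).trans hn
  rcases h1.lt_or_eq with h1 | h1
  · linarith
  · exfalso
    apply h
    have h2 := Complex.normSq_apply ζ
    have h3 : Complex.normSq ζ ≤ 1 := by
      rw [Complex.normSq_eq_norm_sq]
      nlinarith [norm_nonneg ζ]
    rw [h1] at h2
    have h4 : ζ.im = 0 := by nlinarith [mul_self_nonneg ζ.im]
    exact Complex.ext h1 h4

lemma mul_exp_neg_ne_one {ζ : ℂ} (hn : ‖ζ‖ = 1) (h : ζ ≠ 1) {t : ℝ} (ht : 0 ≤ t) :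
    ‖ζ * (Real.exp (-t) : ℂ)‖ ≤ 1 ∧ ζ * (Real.exp (-t) : ℂ) ≠ 1 := by
  have e : ‖ζ * (Real.exp (-t) : ℂ)‖ = Real.exp (-t) := by
    rw [norm_mul, hn, one_mul, Complex.norm_real, Real.norm_of_nonneg (Real.exp_pos _).le]
  refine ⟨by rw [e, Real.exp_le_one_iff]; linarith, fun h1 => ?_⟩
  rw [h1, norm_one] at e
  rw [← e, Complex.ofReal_one, mul_one] at h1
  exact h h1

/-- The Dirichlet series does not converge absolutely at `s = 1`. For `Re s > 1` the product `Γ(s)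
expZeta(a, s)` is the Mellin transform of `F(t) = ζ e^{-t} / (1 - ζ e^{-t})`, and both sides are
continuous at `s = 1`. There the transform is `∫ F`, and `F` is the derivative of `log(1 - ζ
e^{-t})`. -/
lemma expZeta_one {a : ℝ} (ha : e2 a ≠ 1) (ha' : (a : UnitAddCircle) ≠ 0) :
    expZeta a 1 = -Complex.log (1 - e2 a) := by
  set ζ := e2 a with hζ
  have hn : ‖ζ‖ = 1 := by
    rw [hζ, norm_e2]
    simp
  set F : ℝ → ℂ := fun t => (Real.exp (-t) : ℂ) * (ζ / (1 - ζ * (Real.exp (-t) : ℂ))) with hF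
  have hne : ∀ t : ℝ, 0 ≤ t → 1 - ζ * (Real.exp (-t) : ℂ) ≠ 0 := fun t ht =>
    sub_ne_zero.2 (mul_exp_neg_ne_one hn ha ht).2.symm
  have hcont : ContinuousOn F (Set.Ici 0) := by
    rw [hF]
    refine ContinuousOn.mul (by fun_prop) (ContinuousOn.div (by fun_prop) (by fun_prop) ?_)
    exact fun t ht => hne t ht
  have hloc : LocallyIntegrableOn F (Set.Ioi 0) :=
    (hcont.mono Set.Ioi_subset_Ici_self).locallyIntegrableOn measurableSet_Ioi
  have htop0 : Tendsto (fun t : ℝ => (Real.exp (-t) : ℂ)) atTop (𝓝 0) := by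
    have := Real.tendsto_exp_neg_atTop_nhds_zero
    exact_mod_cast (Complex.continuous_ofReal.tendsto 0).comp this
  have htop1 : Tendsto (fun t : ℝ => 1 - ζ * (Real.exp (-t) : ℂ)) atTop (𝓝 1) := by
    simpa using (htop0.const_mul ζ).const_sub 1
  have hO1 : F =O[atTop] fun t => Real.exp (-1 * t) := by
    have h1 : Tendsto (fun t : ℝ => ζ / (1 - ζ * (Real.exp (-t) : ℂ))) atTop (𝓝 (ζ / 1)) :=
      tendsto_const_nhds.div htop1 one_ne_zero
    have h2 : (fun t : ℝ => (Real.exp (-t) : ℂ)) =O[atTop] fun t => Real.exp (-1 * t) := by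
      refine Asymptotics.IsBigO.of_bound 1 (Eventually.of_forall fun t => ?_)
      rw [Complex.norm_real, neg_one_mul, one_mul]
    have h3 := h2.mul (h1.isBigO_one ℝ)
    simp only [mul_one] at h3
    exact h3
  have hO0 : F =O[𝓝[>] 0] fun t => t ^ (-(0 : ℝ)) := by
    simp only [neg_zero, Real.rpow_zero]
    have h1 := (hcont 0 Set.self_mem_Ici).mono Set.Ioi_subset_Ici_self
    exact h1.isBigO_one ℝ
  have hmel : ∀ s : ℂ, 1 < s.re → Complex.Gamma s * expZeta a s = mellin F s := by
    intro s hs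
    have h1 := (hasSum_expZeta_of_one_lt_re a hs).mul_left (Complex.Gamma s)
    have hs0 : s ≠ 0 := by
      rintro rfl
      simp at hs
      linarith
    rw [← hasSum_nat_add_iff' 1] at h1
    simp only [Finset.sum_range_one, Nat.cast_zero, Complex.zero_cpow hs0, div_zero, mul_zero,
      sub_zero] at h1
    have h2 := hasSum_mellin (a := fun n : ℕ => ζ ^ (n + 1)) (p := fun n : ℕ => (n : ℝ) + 1)
      (F := F) (s := s) (fun n => Or.inr (by positivity)) (by linarith)
      (by
        intro t ht
        have ht' : 0 < t := ht
        have h3 : ‖ζ * (Real.exp (-t) : ℂ)‖ < 1 := by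
          rw [norm_mul, hn, one_mul, Complex.norm_real, Real.norm_of_nonneg (Real.exp_pos _).le,
            Real.exp_lt_one_iff]
          linarith
        have h4 := (hasSum_geometric_of_norm_lt_one h3).mul_left (ζ * (Real.exp (-t) : ℂ))
        have e : ζ * (Real.exp (-t) : ℂ) * (1 - ζ * (Real.exp (-t) : ℂ))⁻¹ = F t := by
          simp only [hF]
          ring
        rw [e] at h4
        refine h4.congr_fun fun n => ?_
        rw [← pow_succ', mul_pow, ← Complex.ofReal_pow, ← Real.exp_nat_mul]
        congr 3
        push_cast
        ring)
      (by
        simp only [norm_pow, hn, one_pow]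
        have h3 := (summable_nat_add_iff 1).2 (Real.summable_one_div_nat_rpow.2 hs)
        simpa using h3)
    refine h1.unique (h2.congr_fun fun n => ?_)
    rw [mul_div_assoc, hζ, ← e2_nat_mul, e2]
    congr 2
    · congr 1
      push_cast
      ring
    · push_cast
      rfl
  have hlim : Tendsto (fun s : ℝ => (s : ℂ)) (𝓝[>] 1) (𝓝 1) := by
    have := (Complex.continuous_ofReal.tendsto 1).mono_left (nhdsWithin_le_nhds (s := Set.Ioi 1))
    simpa using this
  have hd1 := mellin_differentiableAt_of_isBigO_rpow_exp (s := 1) one_pos hloc hO1 hO0 (by simp)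
  have hd2 := (differentiableAt_expZeta (a : UnitAddCircle) 1 (.inr ha')).continuousAt
  have hG : ContinuousAt Complex.Gamma 1 :=
    (Complex.differentiableAt_Gamma 1 fun n h => by
      have := congrArg Complex.re h
      simp at this
      have h0 : (0 : ℝ) ≤ n := n.cast_nonneg
      linarith).continuousAt
  have h1 : Complex.Gamma 1 * expZeta a 1 = mellin F 1 := by
    refine tendsto_nhds_unique ((hG.mul hd2).tendsto.comp hlim)
      ((hd1.continuousAt.tendsto.comp hlim).congr' ?_)
    filter_upwards [self_mem_nhdsWithin] with s hs
    exact (hmel s (by simpa using hs)).symm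
  rw [Complex.Gamma_one, one_mul] at h1
  have hint : IntegrableOn F (Set.Ioi 0) := by
    have := mellinConvergent_of_isBigO_rpow_exp (s := 1) one_pos hloc hO1 hO0 (by simp)
    refine this.congr_fun (fun t _ => by simp) measurableSet_Ioi
  rw [h1, mellin]
  simp only [sub_self, Complex.cpow_zero, one_smul]
  have hder : ∀ t : ℝ, 0 ≤ t →
      HasDerivAt (fun t : ℝ => Complex.log (1 - ζ * (Real.exp (-t) : ℂ))) (F t) t := by
    intro t ht
    have h2 : HasDerivAt (fun t : ℝ => 1 - ζ * (Real.exp (-t) : ℂ))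
        (-(ζ * (((Real.exp (-t) * -1 : ℝ)) : ℂ))) t :=
      (((hasDerivAt_neg t).exp.ofReal_comp).const_mul ζ).const_sub 1
    obtain ⟨h3, h4⟩ := mul_exp_neg_ne_one hn ha ht
    have h5 := h2.clog_real (one_sub_mem_slitPlane h3 h4)
    refine h5.congr_deriv ?_
    simp only [hF]
    push_cast
    ring
  rw [integral_Ioi_of_hasDerivAt_of_tendsto (m := 0) (hder 0 le_rfl).continuousAt.continuousWithinAt
    (fun t ht => hder t (le_of_lt ht)) hint]
  · simp
  · have h2 : ContinuousAt Complex.log 1 := continuousAt_clog Complex.one_mem_slitPlane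
    have h3 := h2.tendsto.comp htop1
    rwa [Complex.log_one] at h3

lemma e2_ofReal_eq_one_iff (t : ℝ) : e2 t = 1 ↔ ∃ n : ℤ, t = n := by
  rw [e2, Complex.exp_eq_one_iff]
  have h : (2 * Real.pi * Complex.I : ℂ) ≠ 0 := Complex.two_pi_I_ne_zero
  constructor
  · rintro ⟨n, hn⟩
    refine ⟨n, ?_⟩
    rw [mul_comm] at hn
    exact_mod_cast mul_right_cancel₀ h hn
  · rintro ⟨n, rfl⟩
    exact ⟨n, by push_cast; ring⟩

lemma unitAddCircle_coe_ne_zero {a : ℝ} (h0 : 0 < a) (h1 : a < 1) : (a : UnitAddCircle) ≠ 0 := by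
  rw [Ne, AddCircle.coe_eq_zero_iff]
  rintro ⟨n, hn⟩
  simp at hn
  rw [← hn] at h0 h1
  have h2 : (0 : ℤ) < n := by exact_mod_cast h0
  have h3 : n < (1 : ℤ) := by exact_mod_cast h1
  omega

/-- Since `1 - e(a) = 2 sin(πa) e^{i(πa - π/2)}`, the imaginary part of its logarithm is `πa - π/2`.
This is the case of `B₁`. -/
lemma sinZeta_one {a : ℝ} (h0 : 0 < a) (h1 : a < 1) :
    sinZeta a 1 = (Real.pi * (1 / 2 - a) : ℝ) := by
  have hne : ∀ n : ℤ, a ≠ n := by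
    rintro n rfl
    have h2 : (0 : ℤ) < n := by exact_mod_cast h0
    have h3 : n < (1 : ℤ) := by exact_mod_cast h1
    omega
  have ha : e2 a ≠ 1 := fun h => by
    obtain ⟨n, hn⟩ := (e2_ofReal_eq_one_iff a).1 h
    exact hne n hn
  have hc : e2 ((-a : ℝ) : ℂ) = (starRingEnd ℂ) (e2 a) := by
    rw [conj_e2, Complex.conj_ofReal, Complex.ofReal_neg]
  have ha2 : e2 ((-a : ℝ) : ℂ) ≠ 1 := by
    rw [hc]
    intro h
    apply ha
    have := congrArg (starRingEnd ℂ) h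
    simpa using this
  have ha' := unitAddCircle_coe_ne_zero h0 h1
  have hneg : ((-a : ℝ) : UnitAddCircle) = -(a : UnitAddCircle) := rfl
  have e1 := expZeta_one ha ha'
  have e3 := expZeta_one ha2 (by rw [hneg]; exact neg_ne_zero.2 ha')
  have hs : 0 < Real.sin (Real.pi * a) :=
    Real.sin_pos_of_pos_of_lt_pi (by have := Real.pi_pos; positivity)
      (by have := Real.pi_pos; nlinarith)
  have hval : 1 - e2 a = ((2 * Real.sin (Real.pi * a) : ℝ) : ℂ) *
      (Complex.cos ((Real.pi * a - Real.pi / 2 : ℝ) : ℂ) +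
        Complex.sin ((Real.pi * a - Real.pi / 2 : ℝ) : ℂ) * Complex.I) := by
    have e4 : (2 * Real.pi * Complex.I * a : ℂ) = ((2 * (Real.pi * a) : ℝ) : ℂ) * Complex.I := by
      push_cast
      ring
    rw [e2, e4, Complex.exp_mul_I, ← Complex.ofReal_cos, ← Complex.ofReal_sin,
      ← Complex.ofReal_cos, ← Complex.ofReal_sin, Real.cos_sub_pi_div_two, Real.sin_sub_pi_div_two,
      Real.cos_two_mul, Real.sin_two_mul, Real.cos_sq']
    push_cast
    ring
  have harg : (1 - e2 a).arg = Real.pi * a - Real.pi / 2 := by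
    rw [hval]
    refine Complex.arg_mul_cos_add_sin_mul_I (by positivity) ⟨?_, ?_⟩ <;>
      have := Real.pi_pos <;> nlinarith
  have hlog : Complex.log (1 - e2 ((-a : ℝ) : ℂ)) =
      (starRingEnd ℂ) (Complex.log (1 - e2 a)) := by
    rw [hc, ← Complex.log_conj]
    · simp
    · rw [harg]
      have := Real.pi_pos
      nlinarith
  rw [sinZeta_eq, ← hneg, e1, e3, hlog]
  have h5 := Complex.sub_conj (Complex.log (1 - e2 a))
  have e6 : -Complex.log (1 - e2 a) - -(starRingEnd ℂ) (Complex.log (1 - e2 a)) =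
      -((2 * (Complex.log (1 - e2 a)).im : ℝ) * Complex.I) := by
    rw [← h5]
    ring
  rw [e6, Complex.log_im, harg]
  have hI := Complex.I_ne_zero
  push_cast
  field_simp
  ring

lemma hurwitzZetaOdd_zero_right {a : ℝ} (h0 : 0 < a) (h1 : a < 1) :
    hurwitzZetaOdd a 0 = (1 / 2 - a : ℝ) := by
  have h := hurwitzZetaOdd_one_sub (a : UnitAddCircle) (s := 1) (fun n hn => by
    have := congrArg Complex.re hn
    simp at this
    have h0 : (0 : ℝ) ≤ n := n.cast_nonneg
    linarith)
  rw [sub_self, sinZeta_one h0 h1, mul_one, Complex.sin_pi_div_two, Complex.Gamma_one,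
    Complex.cpow_neg_one] at h
  have hpi : (Real.pi : ℂ) ≠ 0 := by exact_mod_cast Real.pi_ne_zero
  rw [h]
  push_cast
  field_simp

/-! ### Combinations of zeta functions of definite parity and their Bernoulli values. -/

open HurwitzZeta

/-- A rational number as an element of `ℝ/ℤ`. -/
def circ (x : ℚ) : UnitAddCircle := ((x : ℝ) : UnitAddCircle)

lemma circ_neg (x : ℚ) : circ (-x) = -circ x := by
  rw [circ, Rat.cast_neg]
  rfl

lemma circ_fract (x : ℚ) : circ x = (((Int.fract x : ℚ) : ℝ) : UnitAddCircle) := by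
  rw [circ, ← sub_eq_zero, ← AddCircle.coe_sub, AddCircle.coe_eq_zero_iff]
  refine ⟨⌊x⌋, ?_⟩
  rw [← Rat.cast_sub, Int.self_sub_fract]
  simp

/-- `∑ e(l x) l^{-s} + (-1)^q ∑ e(-l x) l^{-s}`. -/
def expC (q : ℕ) (x : ℚ) (s : ℂ) : ℂ := expZeta (circ x) s + (-1) ^ q * expZeta (circ (-x)) s

/-- `ζ(s, x) + (-1)^p ζ(s, -x)`. -/
def hurC (p : ℕ) (x : ℚ) (s : ℂ) : ℂ :=
  hurwitzZeta (circ x) s + (-1) ^ p * hurwitzZeta (circ (-x)) s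

lemma expC_even {q : ℕ} (hq : Even q) (x : ℚ) (s : ℂ) : expC q x s = 2 * cosZeta (circ x) s := by
  rw [expC, hq.neg_one_pow, circ_neg, expZeta, expZeta, cosZeta_neg, sinZeta_neg]
  ring

lemma expC_odd {q : ℕ} (hq : Odd q) (x : ℚ) (s : ℂ) :
    expC q x s = 2 * Complex.I * sinZeta (circ x) s := by
  rw [expC, hq.neg_one_pow, circ_neg, expZeta, expZeta, cosZeta_neg, sinZeta_neg]
  ring

lemma hurC_even {p : ℕ} (hp : Even p) (x : ℚ) (s : ℂ) :
    hurC p x s = 2 * hurwitzZetaEven (circ x) s := by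
  rw [hurC, hp.neg_one_pow, circ_neg, hurwitzZeta, hurwitzZeta, hurwitzZetaEven_neg,
    hurwitzZetaOdd_neg]
  ring

lemma hurC_odd {p : ℕ} (hp : Odd p) (x : ℚ) (s : ℂ) :
    hurC p x s = 2 * hurwitzZetaOdd (circ x) s := by
  rw [hurC, hp.neg_one_pow, circ_neg, hurwitzZeta, hurwitzZeta, hurwitzZetaEven_neg,
    hurwitzZetaOdd_neg]
  ring

/-- For odd `q` the combination is a sine zeta function, which is entire; for even `q` it may have a
pole at `s = 1`. The distinction matters because `q = 1` is one of the points of evaluation. -/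
lemma differentiableAt_expC {q : ℕ} (x : ℚ) {s : ℂ} (h : s ≠ 1 ∨ Odd q) :
    DifferentiableAt ℂ (expC q x) s := by
  rcases Nat.even_or_odd q with hq | hq
  · have e : expC q x = fun s => 2 * cosZeta (circ x) s := funext fun s => expC_even hq x s
    rw [e]
    refine (differentiableAt_cosZeta _ (.inl ?_)).const_mul _
    exact h.resolve_right (Nat.not_odd_iff_even.2 hq)
  · have e : expC q x = fun s => 2 * Complex.I * sinZeta (circ x) s :=
      funext fun s => expC_odd hq x s
    rw [e]
    exact (differentiableAt_sinZeta _ s).const_mul _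

lemma differentiableAt_hurC (p : ℕ) (x : ℚ) {s : ℂ} (h : s ≠ 1) :
    DifferentiableAt ℂ (hurC p x) s :=
  (differentiableAt_hurwitzZeta _ h).add ((differentiableAt_hurwitzZeta _ h).const_mul _)

lemma fract_mem_Icc (x : ℚ) : ((Int.fract x : ℚ) : ℝ) ∈ Set.Icc (0 : ℝ) 1 :=
  ⟨by exact_mod_cast Int.fract_nonneg x, by exact_mod_cast (Int.fract_lt_one x).le⟩

lemma eval_bernoulli_fract (n : ℕ) (x : ℚ) :
    ((Polynomial.bernoulli n).map (algebraMap ℚ ℂ)).eval (((Int.fract x : ℚ) : ℝ) : ℂ) =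
      (((Polynomial.bernoulli n).eval (Int.fract x) : ℚ) : ℂ) := by
  rw [Complex.ofReal_ratCast, Polynomial.eval_map]
  exact Polynomial.eval₂_at_apply (algebraMap ℚ ℂ) (Int.fract x)

lemma bern_of_ne_one {j : ℕ} (hj : j ≠ 1) (x : ℚ) :
    bern j x = (Polynomial.bernoulli j).eval (Int.fract x) := by
  rw [bern, if_neg fun h => hj h.1]

lemma bern_one_of_fract_ne {x : ℚ} (hx : Int.fract x ≠ 0) : bern 1 x = Int.fract x - 1 / 2 := by
  rw [bern, if_neg fun h => hx h.2, Polynomial.bernoulli_one]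
  simp

lemma bern_one_of_fract_eq {x : ℚ} (hx : Int.fract x = 0) : bern 1 x = 0 := by
  rw [bern, if_pos ⟨rfl, hx⟩]

lemma sinZeta_circ_zero (s : ℂ) : sinZeta 0 s = 0 := by
  have h := sinZeta_neg 0 s
  rw [neg_zero] at h
  exact self_eq_neg.1 h

lemma hurwitzZetaOdd_circ_zero (s : ℂ) : hurwitzZetaOdd 0 s = 0 := by
  have h := hurwitzZetaOdd_neg 0 s
  rw [neg_zero] at h
  exact self_eq_neg.1 h

lemma expC_value {q : ℕ} (hq : q ≠ 0) (x : ℚ) :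
    expC q x q = -((2 * Real.pi * Complex.I) ^ q / q.factorial * bern q x) := by
  rcases Nat.even_or_odd' q with ⟨k, rfl | rfl⟩
  · have hk : k ≠ 0 := by rintro rfl; simp at hq
    rw [expC_even (even_two_mul k), circ_fract]
    have h := cosZeta_two_mul_nat hk (fract_mem_Icc x)
    rw [eval_bernoulli_fract, ← bern_of_ne_one (by omega)] at h
    generalize Int.fract x = f at *
    push_cast
    rw [h, mul_pow _ Complex.I, pow_mul Complex.I, Complex.I_sq]
    ring
  · rw [expC_odd (odd_two_mul_add_one k), circ_fract]
    by_cases hk : k = 0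
    · subst hk
      simp only [mul_zero, zero_add, Nat.cast_one]
      -- At integers the sine zeta function vanishes identically, in agreement with the convention
      -- `𝐁₁ = 0` there.
      by_cases hx : Int.fract x = 0
      · rw [bern_one_of_fract_eq hx, hx]
        simp [sinZeta_circ_zero]
      · have h0 : 0 < Int.fract x := lt_of_le_of_ne (Int.fract_nonneg x) (Ne.symm hx)
        rw [sinZeta_one (by exact_mod_cast h0) (by exact_mod_cast Int.fract_lt_one x),
          bern_one_of_fract_ne hx]
        generalize Int.fract x = f at *
        push_cast
        simp
        ring
    · have h := sinZeta_two_mul_nat_add_one hk (fract_mem_Icc x)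
      rw [eval_bernoulli_fract, ← bern_of_ne_one (by omega)] at h
      generalize Int.fract x = f at *
      push_cast
      rw [h, mul_pow _ Complex.I, pow_succ Complex.I, pow_mul Complex.I, Complex.I_sq]
      ring

lemma hurC_value {p : ℕ} (hp : p ≠ 0) (x : ℚ) :
    hurC p x (1 - p) = -(2 * bern p x / p) := by
  rcases Nat.even_or_odd' p with ⟨k, rfl | rfl⟩
  · have hk : k ≠ 0 := by rintro rfl; simp at hp
    rw [hurC_even (even_two_mul k), circ_fract]
    have h := hurwitzZetaEven_one_sub_two_mul_nat hk (fract_mem_Icc x)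
    rw [eval_bernoulli_fract, ← bern_of_ne_one (by omega)] at h
    generalize Int.fract x = f at *
    push_cast
    rw [h]
    ring
  · rw [hurC_odd (odd_two_mul_add_one k), circ_fract]
    by_cases hk : k = 0
    · subst hk
      simp only [mul_zero, zero_add, Nat.cast_one, sub_self]
      by_cases hx : Int.fract x = 0
      · rw [bern_one_of_fract_eq hx, hx]
        simp [hurwitzZetaOdd_circ_zero]
      · have h0 : 0 < Int.fract x := lt_of_le_of_ne (Int.fract_nonneg x) (Ne.symm hx)
        rw [hurwitzZetaOdd_zero_right (by exact_mod_cast h0)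
          (by exact_mod_cast Int.fract_lt_one x), bern_one_of_fract_ne hx]
        generalize Int.fract x = f at *
        push_cast
        ring
    · have h := hurwitzZetaOdd_neg_two_mul_nat hk (fract_mem_Icc x)
      rw [eval_bernoulli_fract, ← bern_of_ne_one (by omega)] at h
      have e : (1 - ((2 * k + 1 : ℕ) : ℂ)) = -(2 * k) := by
        push_cast
        ring
      rw [e, h]
      push_cast
      ring

/-! ### The value at `S` as a special value of a completed `L`-function -/

/-- The element `S` of `GL⁺(2, ℚ)`. -/
def matS : GL(2, ℚ)⁺ := ofSL ModularGroup.S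

lemma entry_matS : entry matS 0 0 = 0 ∧ entry matS 0 1 = -1 ∧ entry matS 1 0 = 1 ∧
    entry matS 1 1 = 0 := by
  simp only [matS]
  rw [entry_ofSL, entry_ofSL, entry_ofSL, entry_ofSL]
  simp [ModularGroup.S]

lemma realDet_matS : realDet matS = 1 := realDet_ofSL _

lemma moeb_matS_I : moeb matS I = I := by
  apply UpperHalfPlane.ext
  obtain ⟨h00, h01, h10, h11⟩ := entry_matS
  rw [coe_moeb, h00, h01, h10, h11]
  simp

/-- The restriction of `f` to the imaginary axis. -/
def axis (f : ℍ → ℂ) (y : ℝ) : ℂ := f (ofComplex (y * Complex.I))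

lemma mul_I_mem {y : ℝ} (hy : 0 < y) : (y : ℂ) * Complex.I ∈ Hset := by
  change 0 < ((y : ℂ) * Complex.I).im
  simpa using hy

/-- On the imaginary axis `S` is `y ↦ 1/y`, so the slash relation is a functional equation of weight
`m` with constant `i^m`. -/
lemma axis_one_div (m : ℕ) (f : ℍ → ℂ) {y : ℝ} (hy : 0 < y) :
    axis f (1 / y) = Complex.I ^ m * (y : ℂ) ^ m * axis (slash m matS f) y := by
  obtain ⟨h00, h01, h10, h11⟩ := entry_matS
  have hyc : (y : ℂ) ≠ 0 := by exact_mod_cast hy.ne'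
  have hI := Complex.I_ne_zero
  have hm : moeb matS (ofComplex (y * Complex.I)) = ofComplex (((1 / y : ℝ) : ℂ) * Complex.I) := by
    apply UpperHalfPlane.ext
    rw [coe_moeb, coe_ofComplex (mul_I_mem hy), coe_ofComplex (mul_I_mem (by positivity)), h00, h01,
      h10, h11]
    push_cast
    field_simp
    linear_combination -(y : ℂ) * Complex.I_sq
  rw [axis, axis, slash_apply, hm, realDet_matS, denom_toReal, coe_ofComplex (mul_I_mem hy), h10,
    h11]
  simp only [Real.one_rpow, Complex.ofReal_one, Rat.cast_one, one_mul, Rat.cast_zero, add_zero,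
    zpow_neg, zpow_natCast]
  rw [mul_pow]
  field_simp

lemma GoodWith.continuousOn_axis {f : ℍ → ℂ} {c : ℂ} (h : GoodWith f c) :
    ContinuousOn (axis f) (Set.Ioi 0) :=
  h.1.continuousOn.comp (f := fun y : ℝ => (y : ℂ) * Complex.I) (by fun_prop)
    fun _ hy => mul_I_mem hy

lemma GoodWith.axis_isBigO {f : ℍ → ℂ} {c : ℂ} (h : GoodWith f c) (r : ℝ) :
    (fun y => axis f y - c) =O[atTop] fun y => y ^ r := by
  obtain ⟨-, ε, hε, hd⟩ := h
  obtain ⟨C, hC⟩ := hd 1 one_pos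
  have h1 : (fun y => axis f y - c) =O[atTop] fun y => Real.exp (-ε * y) := by
    refine Asymptotics.IsBigO.of_bound C ?_
    filter_upwards [eventually_ge_atTop 1] with y hy
    have hz := coe_ofComplex (mul_I_mem (zero_lt_one.trans_le hy))
    have him : (ofComplex (y * Complex.I)).im = y := by
      rw [← coe_im, hz]
      simp
    have := hC (ofComplex (y * Complex.I)) (by rw [him]; exact hy)
    rw [him] at this
    rwa [Real.norm_of_nonneg (Real.exp_pos _).le]
  exact h1.trans (isLittleO_exp_neg_mul_rpow_atTop hε r).isBigO

/-- The pair of functions on the imaginary axis attached to `f` and `f | S`. -/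
def fePair {m : ℕ} (hm : 0 < m) {f : ℍ → ℂ} {c c' : ℂ} (hf : GoodWith f c)
    (hg : GoodWith (slash m matS f) c') : WeakFEPair ℂ where
  f := axis f
  g := axis (slash m matS f)
  k := m
  ε := Complex.I ^ m
  f₀ := c
  g₀ := c'
  hf_int := hf.continuousOn_axis.locallyIntegrableOn measurableSet_Ioi
  hg_int := hg.continuousOn_axis.locallyIntegrableOn measurableSet_Ioi
  hk := by exact_mod_cast hm
  hε := pow_ne_zero _ Complex.I_ne_zero
  h_feq := fun y hy => by
    rw [axis_one_div m f hy, Real.rpow_natCast, Complex.ofReal_pow, smul_eq_mul]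
  hf_top := hf.axis_isBigO
  hg_top := hg.axis_isBigO

/-- `∫_1^∞ (f(iy) - c) y^k dy`. -/
def axisInt (f : ℍ → ℂ) (c : ℂ) (k : ℕ) : ℂ :=
  ∫ y in Set.Ioi (1 : ℝ), (axis f y - c) * (y : ℂ) ^ k

lemma shift_Ioi (h : ℝ → ℂ) : ∫ t in Set.Ioi (0 : ℝ), h (1 + t) = ∫ y in Set.Ioi (1 : ℝ), h y := by
  have := (measurePreserving_add_left volume (1 : ℝ)).setIntegral_preimage_emb
    (measurableEmbedding_addLeft 1) h (Set.Ioi 1)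
  rw [← this]
  simp

lemma shift_integrableOn (h : ℝ → ℂ) :
    IntegrableOn (fun t => h (1 + t)) (Set.Ioi 0) ↔ IntegrableOn h (Set.Ioi 1) := by
  have := (measurePreserving_add_left volume (1 : ℝ)).integrableOn_comp_preimage
    (measurableEmbedding_addLeft 1) (f := h) (s := Set.Ioi 1)
  rw [← this]
  simp [Function.comp_def]

lemma one_add_mul_I (t : ℝ) : (I : ℂ) + t * Complex.I = ((1 + t : ℝ) : ℂ) * Complex.I := by
  rw [coe_I]
  push_cast
  ring

lemma GoodWith.integrableOn_axis {f : ℍ → ℂ} {c : ℂ} (h : GoodWith f c) (k : ℕ) :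
    IntegrableOn (fun y : ℝ => (axis f y - c) * (y : ℂ) ^ k) (Set.Ioi 1) := by
  rw [← shift_integrableOn]
  have h1 : IntegrableOn (fun t : ℝ => (f (ofComplex ((I : ℂ) + t * Complex.I)) - c) *
      (Polynomial.X ^ k : Polynomial ℂ).eval ((I : ℂ) + t * Complex.I) * (Complex.I ^ k)⁻¹)
      (Set.Ioi 0) :=
    (h.integrableOn_ray (Polynomial.X ^ k) I.im_pos).mul_const _
  refine h1.congr_fun (fun t _ => ?_) measurableSet_Ioi
  simp only [Polynomial.eval_pow, Polynomial.eval_X]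
  rw [one_add_mul_I, mul_pow, ← mul_assoc, mul_assoc, mul_inv_cancel₀
    (pow_ne_zero _ Complex.I_ne_zero), mul_one]
  rfl

/-- `S` fixes `i`. With this base point the ray is the part `y > 1` of the imaginary axis, and the
linear form is expanded by the binomial theorem. -/
lemma Eprim_I {f : ℍ → ℂ} {c : ℂ} (h : GoodWith f c) (n : ℕ) (T : Fin 2 → ℂ) :
    Eprim n f c T I = ∑ k ∈ Finset.range (n + 1), (n.choose k : ℂ) * T 0 ^ k * T 1 ^ (n - k) *
      (Complex.I ^ (k + 1) * (c / (k + 1) - axisInt f c k)) := by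
  set J : ℝ → ℂ := fun y => ∑ k ∈ Finset.range (n + 1), ((n.choose k : ℂ) * T 0 ^ k *
    T 1 ^ (n - k) * Complex.I ^ (k + 1)) * ((axis f y - c) * (y : ℂ) ^ k) with hJ
  have h1 : ∀ t : ℝ, Complex.I * ((f (ofComplex ((I : ℂ) + t * Complex.I)) - c) *
      (linPow n T).eval ((I : ℂ) + t * Complex.I)) =
      J (1 + t) := by
    intro t
    rw [hJ, one_add_mul_I, eval_linPow, add_pow, Finset.mul_sum, Finset.mul_sum]
    refine Finset.sum_congr rfl fun k _ => ?_
    rw [axis, mul_pow, mul_pow]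
    ring
  rw [Eprim, integral_congr_ae (Eventually.of_forall h1), shift_Ioi, hJ, integral_finsetSum _ fun k _ => (h.integrableOn_axis k).const_mul _, fchk,
    Finset.mul_sum, ← Finset.sum_sub_distrib]
  refine Finset.sum_congr rfl fun k _ => ?_
  rw [integral_const_mul, axisInt, coe_I]
  ring

lemma mellin_indicator (h : ℝ → ℂ) (s : ℂ) :
    mellin ((Set.Ioi 1).indicator h) s = ∫ y in Set.Ioi (1 : ℝ), (y : ℂ) ^ (s - 1) * h y := by
  rw [mellin]
  have : ∀ y : ℝ, (y : ℂ) ^ (s - 1) • (Set.Ioi (1 : ℝ)).indicator h y =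
      (Set.Ioi (1 : ℝ)).indicator (fun y : ℝ => (y : ℂ) ^ (s - 1) * h y) y := by
    intro y
    by_cases hy : y ∈ Set.Ioi (1 : ℝ)
    · simp [Set.indicator_of_mem hy]
    · simp [Set.indicator_of_notMem hy]
  simp only [this]
  rw [setIntegral_indicator measurableSet_Ioi]
  congr 2
  ext y
  simp only [Set.mem_inter_iff, Set.mem_Ioi]
  exact ⟨fun h => h.2, fun h => ⟨zero_lt_one.trans h, h⟩⟩

lemma mellin_indicator_nat (f : ℍ → ℂ) (c : ℂ) (k : ℕ) {s : ℂ} (hs : s = k + 1) :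
    mellin ((Set.Ioi 1).indicator fun y => axis f y - c) s = axisInt f c k := by
  rw [mellin_indicator, axisInt, hs]
  refine setIntegral_congr_fun measurableSet_Ioi fun y _ => ?_
  rw [add_sub_cancel_right, Complex.cpow_natCast, mul_comm]

/-- The Mellin integral is split at `y = 1`, and the part over `(0, 1)` is folded onto `(1, ∞)` by
`y ↦ 1/y` and the functional equation, which exchanges the exponents `k` and `l = m - 2 - k`. The
last two terms are the polar parts of `Λ`. -/
lemma fePair_Λ {m : ℕ} (hm : 0 < m) {f : ℍ → ℂ} {c c' : ℂ} (hf : GoodWith f c)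
    (hg : GoodWith (slash m matS f) c') {k l : ℕ} (hkl : k + l + 2 = m) :
    (fePair hm hf hg).Λ (k + 1) = axisInt f c k + Complex.I ^ m * axisInt (slash m matS f) c' l -
      c / (k + 1) - Complex.I ^ m * (c' / (l + 1)) := by
  set P := fePair hm hf hg with hP
  have hε : P.ε = Complex.I ^ m := rfl
  have hmc : ((P.k : ℝ) : ℂ) = k + l + 2 := by
    change (((m : ℕ) : ℝ) : ℂ) = _
    rw [← hkl]
    push_cast
    rfl
  set A : ℝ → ℂ := (Set.Ioi 1).indicator fun y => axis f y - c with hA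
  set A' : ℝ → ℂ := (Set.Ioi 1).indicator fun y => axis (slash m matS f) y - c' with hA'
  set B : ℝ → ℂ := (Set.Ioo 0 1).indicator fun y => P.f y - (P.ε * ((y ^ (-P.k) : ℝ) : ℂ)) • P.g₀
    with hB
  have hmod : P.f_modif = A + B := rfl
  have hfull : MellinConvergent P.f_modif (k + 1) :=
    (P.isStrongFEPair_toStrongFEPair.hasMellin (k + 1)).1
  have hAc : MellinConvergent A (k + 1) := by
    rw [MellinConvergent]
    have h1 : (fun t : ℝ => (t : ℂ) ^ ((k : ℂ) + 1 - 1) • A t) =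
        (Set.Ioi 1).indicator fun y : ℝ => (axis f y - c) * (y : ℂ) ^ k := by
      funext t
      by_cases ht : t ∈ Set.Ioi (1 : ℝ)
      · rw [hA, Set.indicator_of_mem ht, Set.indicator_of_mem ht, add_sub_cancel_right,
          Complex.cpow_natCast, smul_eq_mul, mul_comm]
      · rw [hA, Set.indicator_of_notMem ht, Set.indicator_of_notMem ht, smul_zero]
    rw [h1]
    exact ((integrable_indicator_iff measurableSet_Ioi).2 (hf.integrableOn_axis k)).integrableOn
  have hBc : MellinConvergent B (k + 1) := by
    have : B = P.f_modif - A := by rw [hmod]; simp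
    rw [this]
    exact (hasMellin_sub hfull hAc).1
  have h0 : P.Λ₀ (k + 1) = mellin A (k + 1) + mellin B (k + 1) := by
    rw [WeakFEPair.Λ₀, hmod]
    exact (hasMellin_add hAc hBc).2
  have hBA : mellin B (k + 1) = Complex.I ^ m * mellin A' (l + 1) := by
    have h1 : mellin B (k + 1) = mellin (fun t : ℝ => Complex.I ^ m •
        ((t : ℂ) ^ (-((P.k : ℝ) : ℂ)) • (A' t⁻¹))) (k + 1) := by
      refine setIntegral_congr_fun measurableSet_Ioi fun t ht => ?_
      have ht' : (0 : ℝ) < t := ht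
      simp only
      congr 1
      by_cases h1 : t < 1
      · have h2 : t⁻¹ ∈ Set.Ioi (1 : ℝ) := (one_lt_inv₀ ht').2 h1
        rw [hB, hA', Set.indicator_of_mem (Set.mem_Ioo.2 ⟨ht', h1⟩), Set.indicator_of_mem h2]
        have h3 := axis_one_div m f (inv_pos.2 ht')
        rw [one_div, inv_inv] at h3
        have h4 : ((t ^ (-P.k) : ℝ) : ℂ) = ((t⁻¹ : ℝ) : ℂ) ^ m := by
          change ((t ^ (-((m : ℕ) : ℝ)) : ℝ) : ℂ) = _
          rw [Real.rpow_neg ht'.le, Real.rpow_natCast]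
          push_cast
          rw [inv_pow]
        have h5 : (t : ℂ) ^ (-((P.k : ℝ) : ℂ)) = ((t ^ (-P.k) : ℝ) : ℂ) := by
          rw [Complex.ofReal_cpow ht'.le]
          push_cast
          rfl
        rw [h5, h4]
        change axis f t - (Complex.I ^ m * _) • c' = _
        rw [h3]
        simp only [smul_eq_mul]
        ring
      · have h2 : t⁻¹ ∉ Set.Ioi (1 : ℝ) := fun h => h1 ((one_lt_inv₀ ht').1 h)
        rw [hB, hA', Set.indicator_of_notMem (fun h => h1 h.2), Set.indicator_of_notMem h2, smul_zero,
          smul_zero]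
    rw [h1, mellin_const_smul, mellin_cpow_smul, mellin_comp_inv, smul_eq_mul]
    congr 2
    rw [hmc]
    ring
  have hmk : (P.k : ℂ) - (k + 1) = l + 1 := by
    rw [hmc]
    ring
  have hA1 : mellin A (k + 1) = axisInt f c k := mellin_indicator_nat f c k rfl
  have hA2 : mellin A' (l + 1) = axisInt (slash m matS f) c' l :=
    mellin_indicator_nat (slash m matS f) c' l rfl
  rw [WeakFEPair.Λ, h0, hBA, hmk, hA1, hA2]
  change _ - (1 / ((k : ℂ) + 1)) • c - (Complex.I ^ m / ((l : ℂ) + 1)) • c' = _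
  simp only [smul_eq_mul]
  ring

/-- Reversing the sum for the primitive of `f | S` pairs `k` with `l = m - 2 - k`, which is the
shape of `fePair_Λ`. -/
lemma eval_Psi_matS {m : ℕ} (hm : 2 ≤ m) {f : ℍ → ℂ} {c c' : ℂ} (hf : GoodWith f c)
    (hg : GoodWith (slash m matS f) c') (T : Fin 2 → ℂ) :
    MvPolynomial.eval T (Psi m I f matS) = ∑ k ∈ Finset.range (m - 1),
      ((m - 2).choose k : ℂ) * T 0 ^ k * T 1 ^ (m - 2 - k) *
        (-(Complex.I ^ (k + 1) * (fePair (by omega) hf hg).Λ (k + 1))) := by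
  obtain ⟨h00, h01, h10, h11⟩ := entry_matS
  have hdet : detFac ℂ (m - 2) matS = 1 := by
    simp [detFac, realDet_matS]
  have hn : m - 2 + 1 = m - 1 := by omega
  rw [eval_Psi hf hg, moeb_matS_I, hdet, one_mul, Eprim_I hf, Eprim_I hg, hn,
    ← Finset.sum_range_reflect (fun k => ((m - 2).choose k : ℂ) * rowMul T matS 0 ^ k *
      rowMul T matS 1 ^ (m - 2 - k) * _), ← Finset.sum_sub_distrib]
  refine Finset.sum_congr rfl fun k hk => ?_
  have hk' : k ≤ m - 2 := by
    have := Finset.mem_range.1 hk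
    omega
  obtain ⟨l, hl⟩ := Nat.exists_eq_add_of_le hk'
  have hkl : k + l + 2 = m := by omega
  have e1 : m - 1 - 1 - k = l := by omega
  have e2' : m - 2 - l = k := by omega
  have e3 : m - 2 - k = l := by omega
  have e4 : ((m - 2).choose l : ℂ) = (m - 2).choose k := by
    rw [hl]
    congr 1
    rw [Nat.choose_symm_add]
  have r0 : rowMul T matS 0 = T 1 := by simp [rowMul, h00, h10]
  have r1 : rowMul T matS 1 = -T 0 := by simp [rowMul, h01, h11]
  -- The sign `(-1)^k` matches the factor `(-T 0)^k` of the linear form translated by `S`.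
  have hI : Complex.I ^ (k + 1) * Complex.I ^ m = -((-1) ^ k * Complex.I ^ (l + 1)) := by
    have : Complex.I ^ (k + 1) * Complex.I ^ m = (Complex.I ^ 2) ^ (k + 1) * Complex.I ^ (l + 1) := by
      rw [← pow_mul, ← pow_add, ← pow_add]
      congr 1
      omega
    rw [this, Complex.I_sq]
    ring
  rw [e1, e2', e3, e4, r0, r1, fePair_Λ (by omega) hf hg hkl, neg_pow]
  generalize axisInt f c k = A
  generalize axisInt (slash m matS f) c' l = B
  linear_combination ((m - 2).choose k : ℂ) * T 0 ^ k * T 1 ^ l * (B - c' / (l + 1)) * hI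

open HurwitzZeta

/-! ### Dirichlet series -/

lemma hasSum_hurwitz {ε : ℤ} (hε : ε = 1 ∨ ε = -1) (x : ℚ × ℚ) {w : ℂ} (hw : 1 < w.re) :
    HasSum (fun j : ℤ => if 0 < gu ε x j then 1 / (gu ε x j : ℂ) ^ w else 0)
      (hurwitzZeta (circ (ε * x.1)) w) := by
  have hw0 : w ≠ 0 := by
    rintro rfl
    simp at hw
    linarith
  set a : ℚ := Int.fract (ε * x.1) with ha
  have ha0 : 0 ≤ a := Int.fract_nonneg _
  have ha1 : a < 1 := Int.fract_lt_one _
  have h1 := hasSum_hurwitzZeta_of_one_lt_re (fract_mem_Icc (ε * x.1)) hw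
  rw [← circ_fract, ← ha] at h1
  have h2 : HasSum (fun n : ℤ => if 0 < (n + a : ℚ) then 1 / ((n + a : ℚ) : ℂ) ^ w else 0)
      (hurwitzZeta (circ (ε * x.1)) w) := by
    rw [← (Nat.cast_injective (R := ℤ)).hasSum_iff]
    · refine h1.congr_fun fun n => ?_
      simp only [Function.comp_apply]
      split_ifs with hn
      · push_cast
        rfl
      -- The omitted term `n = a = 0` is `1 / 0^w`, which is `0` by the convention for division.
      · have hna : (n : ℚ) + a = 0 := le_antisymm (by push_cast at hn; linarith) (by positivity)
        have : ((n : ℂ) + ((a : ℝ) : ℂ)) = (((n : ℚ) + a : ℚ) : ℂ) := by push_cast; rfl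
        rw [this, hna, Rat.cast_zero, Complex.zero_cpow hw0, div_zero]
    · intro n hn
      refine if_neg fun h => hn ⟨n.toNat, ?_⟩
      have hn' : (-1 : ℚ) < n := by linarith
      have : -1 < n := by exact_mod_cast hn'
      exact Int.toNat_of_nonneg (by omega)
  set E : ℤ ≃ ℤ := (if ε = 1 then Equiv.refl ℤ else Equiv.neg ℤ).trans
    (Equiv.addRight ⌊ε * x.1⌋) with hE
  have hEj : ∀ j, ((E j : ℤ) : ℚ) + a = gu ε x j := by
    intro j
    have h3 : E j = ε * j + ⌊ε * x.1⌋ := by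
      rcases hε with rfl | rfl
      · simp [hE]
      · simp [hE]
    rw [h3, ha, gu]
    push_cast
    rw [add_assoc, Int.floor_add_fract]
    ring
  rw [← E.hasSum_iff] at h2
  refine h2.congr_fun fun j => ?_
  simp only [Function.comp_apply, hEj]

lemma hasSum_expZeta_rat (ε : ℤ) (x : ℚ × ℚ) {s : ℂ} (hs : 1 < s.re) :
    HasSum (fun l : ℕ => e2 ((l + 1) * (ε * x.2)) / ((l : ℂ) + 1) ^ s)
      (expZeta (circ (ε * x.2)) s) := by
  have hs0 : s ≠ 0 := by
    rintro rfl
    simp at hs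
    linarith
  have h1 := hasSum_expZeta_of_one_lt_re ((ε * x.2 : ℚ) : ℝ) hs
  rw [← hasSum_nat_add_iff' 1] at h1
  simp only [Finset.sum_range_one, Nat.cast_zero, Complex.zero_cpow hs0, div_zero, sub_zero] at h1
  refine h1.congr_fun fun n => ?_
  rw [e2]
  push_cast
  congr 2
  ring

/-- The coefficients of the Dirichlet series of `gS`. -/
def dirA (m : ℕ) (ε : ℤ) (x : ℚ × ℚ) (p : ℕ × ℤ) : ℂ :=
  if 0 < gu ε x p.2 then (gu ε x p.2 : ℂ) ^ (m - 1) * e2 ((p.1 + 1) * (ε * x.2)) else 0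

/-- The frequencies `2π (l + 1) |j + x₁|`. -/
def dirP (x : ℚ × ℚ) (p : ℕ × ℤ) : ℝ := 2 * Real.pi * ((p.1 + 1) * |((p.2 + x.1 : ℚ) : ℝ)|)

lemma gT_eq_dirA (m : ℕ) {ε : ℤ} (hε : ε = 1 ∨ ε = -1) (x : ℚ × ℚ) (t : ℝ) (p : ℕ × ℤ) :
    gT m ε x (t * Complex.I) p = dirA m ε x p * Real.exp (-dirP x p * t) := by
  rw [gT, dirA]
  split_ifs with hu
  · rw [mul_assoc]
    congr 1
    rw [dirP, abs_gu hε x p.2 hu, mul_add, e2_add]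
    congr 1
    rw [e2, Complex.ofReal_exp]
    congr 1
    push_cast
    linear_combination (2 * Real.pi * t * (p.1 + 1) * gu ε x p.2) * Complex.I_sq
  · rw [zero_mul]

lemma dirA_div (m : ℕ) {ε : ℤ} (hε : ε = 1 ∨ ε = -1) (x : ℚ × ℚ) (s : ℂ) (hm : 1 ≤ m)
    (p : ℕ × ℤ) :
    dirA m ε x p / (dirP x p : ℂ) ^ s = ((2 * Real.pi : ℝ) : ℂ) ^ (-s) *
      (e2 ((p.1 + 1) * (ε * x.2)) / ((p.1 : ℂ) + 1) ^ s *
        if 0 < gu ε x p.2 then 1 / (gu ε x p.2 : ℂ) ^ (s - m + 1) else 0) := by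
  rw [dirA]
  split_ifs with hu
  · have hu' : (0 : ℝ) < (gu ε x p.2 : ℝ) := by exact_mod_cast hu
    have huc : (gu ε x p.2 : ℂ) ≠ 0 := by exact_mod_cast hu.ne'
    have hl : (0 : ℝ) ≤ (p.1 : ℝ) + 1 := by positivity
    have h2pi : (0 : ℝ) ≤ 2 * Real.pi := by positivity
    have e1 : (dirP x p : ℂ) ^ s = ((2 * Real.pi : ℝ) : ℂ) ^ s *
        (((p.1 : ℂ) + 1) ^ s * (gu ε x p.2 : ℂ) ^ s) := by
      rw [dirP, abs_gu hε x p.2 hu, Complex.ofReal_mul (2 * Real.pi),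
        Complex.mul_cpow_ofReal_nonneg h2pi (by positivity), Complex.ofReal_mul ((p.1 : ℝ) + 1), Complex.mul_cpow_ofReal_nonneg hl hu'.le]
      push_cast
      rfl
    have e3 : s - m + 1 = s - ((m - 1 : ℕ) : ℂ) := by
      rw [Nat.cast_sub hm]
      push_cast
      ring
    have hs : (gu ε x p.2 : ℂ) ^ s ≠ 0 := by simp [Complex.cpow_eq_zero_iff, huc]
    have hl' : ((p.1 : ℂ) + 1) ≠ 0 := by exact_mod_cast Nat.succ_ne_zero p.1
    have hls : ((p.1 : ℂ) + 1) ^ s ≠ 0 := by simp [Complex.cpow_eq_zero_iff, hl']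
    have hpi : ((2 * Real.pi : ℝ) : ℂ) ≠ 0 := by
      have := Real.two_pi_pos.ne'
      exact_mod_cast this
    have hps : ((2 * Real.pi : ℝ) : ℂ) ^ s ≠ 0 := by simp [Complex.cpow_eq_zero_iff]
    rw [e1, e3, Complex.cpow_sub _ _ huc, Complex.cpow_natCast, Complex.cpow_neg]
    have hum := pow_ne_zero (m - 1) huc
    field_simp
  · simp

lemma hasSum_mul_prod {α β : Type*} {f : α → ℂ} {g : β → ℂ} {a b : ℂ} (hf : HasSum f a)
    (hg : HasSum g b) : HasSum (fun p : α × β => f p.1 * g p.2) (a * b) :=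
  hf.mul hg (summable_mul_of_summable_norm hf.summable.norm hg.summable.norm)

/-- The Dirichlet series of `gS`. -/
lemma hasSum_dirA {m : ℕ} (hm : 1 ≤ m) {ε : ℤ} (hε : ε = 1 ∨ ε = -1) (x : ℚ × ℚ) {s : ℂ}
    (hs : m < s.re) : HasSum (fun p => dirA m ε x p / (dirP x p : ℂ) ^ s)
      (((2 * Real.pi : ℝ) : ℂ) ^ (-s) *
        (expZeta (circ (ε * x.2)) s * hurwitzZeta (circ (ε * x.1)) (s - m + 1))) := by
  have hm' : (1 : ℝ) ≤ m := by exact_mod_cast hm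
  have hs1 : 1 < s.re := by linarith
  have hs2 : 1 < (s - m + 1).re := by
    rw [Complex.add_re, Complex.sub_re, Complex.natCast_re, Complex.one_re]
    linarith
  have h3 := (hasSum_mul_prod (hasSum_expZeta_rat ε x hs1) (hasSum_hurwitz hε x hs2)).mul_left
    (((2 * Real.pi : ℝ) : ℂ) ^ (-s))
  have e : (fun p => dirA m ε x p / (dirP x p : ℂ) ^ s) = fun p : ℕ × ℤ => _ :=
    funext fun p => dirA_div m hε x s hm p
  rw [e]
  exact h3

/-- The Dirichlet series on the right hand side of `Λ_fourierPhi`. -/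
def dirL (m : ℕ) (x : ℚ × ℚ) (s : ℂ) : ℂ :=
  expZeta (circ x.2) s * hurwitzZeta (circ x.1) (s - m + 1) +
    (-1) ^ m * (expZeta (circ (-x.2)) s * hurwitzZeta (circ (-x.1)) (s - m + 1))

lemma axis_fourierPhi (m : ℕ) (x : ℚ × ℚ) {y : ℝ} (hy : 0 < y) :
    axis (fourierPhi m x) y - (-((bern m x.1 : ℂ) / m)) =
      gS m 1 x (y * Complex.I) + (-1) ^ m * gS m (-1) x (y * Complex.I) := by
  rw [axis, fourierPhi, coe_ofComplex (mul_I_mem hy)]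
  ring

/-- The Fourier expansion is transformed term by term, each exponential contributing `Γ(s) p^{-s}`.
-/
lemma mellin_fourierPhi {m : ℕ} (hm : 1 ≤ m) (x : ℚ × ℚ) {s : ℂ} (hs : m < s.re) :
    mellin (fun y => axis (fourierPhi m x) y - (-((bern m x.1 : ℂ) / m))) s =
      Complex.Gamma s * (((2 * Real.pi : ℝ) : ℂ) ^ (-s) * dirL m x s) := by
  have hm' : (1 : ℝ) ≤ m := by exact_mod_cast hm
  have hp := hasSum_dirA hm (.inl rfl) x hs (ε := 1)
  have hn := hasSum_dirA hm (.inr rfl) x hs (ε := -1)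
  have hsum := ((hp.add (hn.mul_left ((-1) ^ m))).mul_left (Complex.Gamma s))
  have hmel := hasSum_mellin (a := fun p => dirA m 1 x p + (-1) ^ m * dirA m (-1) x p)
    (p := dirP x) (s := s)
    (F := fun y => axis (fourierPhi m x) y - (-((bern m x.1 : ℂ) / m)))
    (fun p => by
      -- Frequency zero occurs only for `j = -x₁`, where the coefficients vanish for both signs.
      by_cases h0 : (p.2 + x.1 : ℚ) = 0
      · left
        have h1 : ∀ ε : ℤ, gu ε x p.2 = 0 := fun ε => by rw [gu, h0, mul_zero]
        simp [dirA, h1]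
      · right
        have h1 : (0 : ℝ) < |((p.2 + x.1 : ℚ) : ℝ)| := abs_pos.2 (by exact_mod_cast h0)
        have := Real.pi_pos
        rw [dirP]
        positivity)
    (by linarith)
    (by
      intro t ht
      have ht' : 0 < t := ht
      rw [axis_fourierPhi m x ht']
      have h1 := (summable_gT m (.inl rfl) x (mul_I_mem ht') (ε := 1)).hasSum
      have h2 := (summable_gT m (.inr rfl) x (mul_I_mem ht') (ε := -1)).hasSum
      refine (h1.add (h2.mul_left ((-1) ^ m))).congr_fun fun p => ?_
      rw [gT_eq_dirA m (.inl rfl), gT_eq_dirA m (.inr rfl)]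
      ring)
    (by
      refine Summable.of_nonneg_of_le (fun p => ?_) (fun p => ?_)
        (hp.summable.norm.add hn.summable.norm)
      · have : 0 ≤ dirP x p := by
          have := Real.pi_pos
          rw [dirP]
          positivity
        positivity
      · have h0 : 0 ≤ dirP x p := by
          have := Real.pi_pos
          rw [dirP]
          positivity
        have hn0 : ‖(dirP x p : ℂ) ^ s‖ = dirP x p ^ s.re := by
          rcases h0.eq_or_lt with h | h
          · rw [← h, Complex.ofReal_zero, Complex.zero_cpow, Real.zero_rpow, norm_zero]
            · linarith
            · rintro rfl
              simp at hs
              linarith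
          · exact Complex.norm_cpow_eq_rpow_re_of_pos h s
        rw [norm_div, norm_div, hn0, ← add_div]
        gcongr
        refine (norm_add_le _ _).trans ?_
        rw [norm_mul, norm_pow, norm_neg, norm_one, one_pow, one_mul])
  refine (hmel.unique (hsum.congr_fun fun p => ?_)).trans ?_
  · ring
  · rw [dirL]
    simp only [Int.cast_one, one_mul, Int.cast_neg, neg_mul]
    ring

lemma Λ_fourierPhi {m : ℕ} (hm : 0 < m) {x : ℚ × ℚ} {c' : ℂ}
    (hf : GoodWith (fourierPhi m x) (-((bern m x.1 : ℂ) / m)))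
    (hg : GoodWith (slash m matS (fourierPhi m x)) c') {s : ℂ} (hs : m < s.re) :
    (fePair hm hf hg).Λ s = Complex.Gamma s * (((2 * Real.pi : ℝ) : ℂ) ^ (-s) * dirL m x s) := by
  rw [← mellin_fourierPhi hm x hs, ← ((fePair hm hf hg).hasMellin (s := s) hs).2]
  rfl

/-- `dirL` contains only the two products with equal signs of `x₁` and `x₂`. Adding the series for
`(x₁, -x₂)` supplies the mixed products, and since `(-1)^m = (-1)^p (-1)^q` the four terms factor.
-/
lemma dirL_add {m p q : ℕ} (hpq : p + q = m) (x : ℚ × ℚ) (s : ℂ) :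
    dirL m x s + (-1) ^ q * dirL m (x.1, -x.2) s = expC q x.2 s * hurC p x.1 (s - m + 1) := by
  have h1 : ((-1 : ℂ)) ^ q * (-1) ^ q = 1 := by rw [← mul_pow]; simp
  have h2 : ((-1 : ℂ)) ^ m = (-1) ^ p * (-1) ^ q := by rw [← hpq, pow_add]
  simp only [dirL, expC, hurC, neg_neg]
  rw [h2]
  linear_combination ((-1) ^ p * expZeta (circ x.2) s * hurwitzZeta (circ (-x.1)) (s - m + 1)) * h1

/-- The identity theorem on the complement of a finite set, which is connected in the plane. -/
lemma eqOn_compl_of_finite {A B : ℂ → ℂ} {F : Set ℂ} (hF : F.Finite) {r : ℝ}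
    (hA : ∀ s ∉ F, DifferentiableAt ℂ A s) (hB : ∀ s ∉ F, DifferentiableAt ℂ B s)
    (h : ∀ s : ℂ, r < s.re → A s = B s) {s : ℂ} (hs : s ∉ F) : A s = B s := by
  have hopen : IsOpen Fᶜ := hF.isClosed.isOpen_compl
  have hconn : IsPreconnected Fᶜ :=
    (hF.countable.isPathConnected_compl_of_one_lt_rank (by
      rw [Complex.rank_real_complex]; exact Nat.one_lt_ofNat)).isConnected.isPreconnected
  have hAa : AnalyticOnNhd ℂ A Fᶜ :=
    DifferentiableOn.analyticOnNhd (fun s hs => (hA s hs).differentiableWithinAt) hopen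
  have hBa : AnalyticOnNhd ℂ B Fᶜ :=
    DifferentiableOn.analyticOnNhd (fun s hs => (hB s hs).differentiableWithinAt) hopen
  obtain ⟨M, hM⟩ : ∃ M : ℝ, ∀ s ∈ F, s.re ≤ M := by
    obtain ⟨M, hM⟩ := (hF.image Complex.re).bddAbove
    exact ⟨M, fun s hs => hM ⟨s, hs, rfl⟩⟩
  have h0 : ((max M r + 1 : ℝ) : ℂ) ∈ Fᶜ := fun h0 => by
    have := hM _ h0
    rw [Complex.ofReal_re] at this
    linarith [le_max_left M r]
  refine hAa.eqOn_of_preconnected_of_eventuallyEq hBa hconn h0 ?_ hs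
  have hre : {s : ℂ | r < s.re} ∈ 𝓝 ((max M r + 1 : ℝ) : ℂ) := by
    refine (isOpen_lt continuous_const Complex.continuous_re).mem_nhds ?_
    change r < ((max M r + 1 : ℝ) : ℂ).re
    rw [Complex.ofReal_re]
    linarith [le_max_right M r]
  filter_upwards [hre] with s hs using h s hs

/-- After multiplication by the entire function `(2π)^s / Γ(s)`, both sides are holomorphic off a
finite set and agree for `Re s > m`. They therefore agree at `s = q`, where `s - m + 1 = 1 - p` and
both factors have Bernoulli values. -/
lemma Λ_value {m p q : ℕ} (hp : 0 < p) (hq : 0 < q) (hpq : p + q = m) (hm : 0 < m) {x : ℚ × ℚ}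
    {c₁ c₂ : ℂ} (hf : GoodWith (fourierPhi m x) (-((bern m x.1 : ℂ) / m)))
    (hg : GoodWith (slash m matS (fourierPhi m x)) c₁)
    (hf' : GoodWith (fourierPhi m (x.1, -x.2)) (-((bern m x.1 : ℂ) / m)))
    (hg' : GoodWith (slash m matS (fourierPhi m (x.1, -x.2))) c₂) :
    (fePair hm hf hg).Λ q + (-1) ^ q * (fePair hm hf' hg').Λ q =
      2 * Complex.I ^ q * ((bern q x.2 : ℂ) / q) * ((bern p x.1 : ℂ) / p) := by
  set P := fePair hm hf hg
  set P' := fePair hm hf' hg'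
  have hk : ((P.k : ℝ) : ℂ) = m := Complex.ofReal_natCast m
  have hk' : ((P'.k : ℝ) : ℂ) = m := Complex.ofReal_natCast m
  -- The points `0` and `m` are the possible poles of `Λ`, and `m` also that of the Hurwitz factor.
  -- The point `1` is removed only for even `q`, so that `q` itself always stays in the domain.
  set F : Set ℂ := {0, (m : ℂ)} ∪ (if Odd q then ∅ else {1}) with hF
  have hfin : F.Finite := by
    rw [hF]
    refine Set.Finite.union (by simp) ?_
    split_ifs <;> simp
  have hpi : ((2 * Real.pi : ℝ) : ℂ) ≠ 0 := by
    have := Real.two_pi_pos.ne'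
    exact_mod_cast this
  have key := eqOn_compl_of_finite (r := m) (F := F) hfin
    (A := fun s => (Complex.Gamma s)⁻¹ * ((2 * Real.pi : ℝ) : ℂ) ^ s *
      (P.Λ s + (-1) ^ q * P'.Λ s))
    (B := fun s => expC q x.2 s * hurC p x.1 (s - m + 1))
    (by
      intro s hs
      have hs0 : s ≠ 0 := fun h => hs (by simp [hF, h])
      have hsm : s ≠ m := fun h => hs (by simp [hF, h])
      have h1 := Complex.differentiable_one_div_Gamma s
      have h2 : DifferentiableAt ℂ (fun s : ℂ => ((2 * Real.pi : ℝ) : ℂ) ^ s) s :=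
        (differentiableAt_id).const_cpow (.inl hpi)
      have h3 := P.differentiableAt_Λ (s := s) (.inl hs0) (.inl (by rw [hk]; exact hsm))
      have h4 := P'.differentiableAt_Λ (s := s) (.inl hs0) (.inl (by rw [hk']; exact hsm))
      exact (h1.mul h2).mul (h3.add (h4.const_mul _)))
    (by
      intro s hs
      have hsm : s ≠ m := fun h => hs (by simp [hF, h])
      have h1 : s ≠ 1 ∨ Odd q := by
        by_contra! h
        exact hs (by simp [hF, h.1, h.2])
      refine (differentiableAt_expC x.2 h1).mul ?_
      have h2 : s - m + 1 ≠ 1 := fun h => hsm (by linear_combination h)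
      have h3 : DifferentiableAt ℂ (fun s : ℂ => s - m + 1) s := by fun_prop
      exact (differentiableAt_hurC p x.1 h2).comp s h3)
    (by
      intro s hs
      have hG : Complex.Gamma s ≠ 0 := Complex.Gamma_ne_zero_of_re_pos (by
        have : (0 : ℝ) ≤ m := m.cast_nonneg
        linarith)
      have h1 : P.Λ s = _ := Λ_fourierPhi hm hf hg hs
      have h2 : P'.Λ s = _ := Λ_fourierPhi hm hf' hg' hs
      have hps : ((2 * Real.pi : ℝ) : ℂ) ^ s ≠ 0 := by simp [Complex.cpow_eq_zero_iff]
      rw [h1, h2, ← dirL_add hpq, Complex.cpow_neg]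
      field_simp)
    (s := q)
    (by
      have hq0 : (q : ℂ) ≠ 0 := by exact_mod_cast hq.ne'
      have hqm : (q : ℂ) ≠ m := by
        have : q ≠ m := by omega
        exact_mod_cast this
      rw [hF]
      simp only [Set.mem_union, Set.mem_insert_iff, Set.mem_singleton_iff, not_or]
      refine ⟨⟨hq0, hqm⟩, ?_⟩
      split_ifs with h
      · simp
      · intro h1
        have h2 : (q : ℂ) = 1 := by simpa using h1
        have h3 : q = 1 := by exact_mod_cast h2
        rw [h3] at h
        exact h odd_one)
  have e1 : (q : ℂ) - m + 1 = 1 - p := by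
    rw [← hpq]
    push_cast
    ring
  rw [e1, expC_value hq.ne', hurC_value hp.ne', Complex.cpow_natCast] at key
  obtain ⟨r, rfl⟩ : ∃ r, q = r + 1 := ⟨q - 1, by omega⟩
  have hG : Complex.Gamma ((r + 1 : ℕ) : ℂ) = r.factorial := by
    push_cast
    exact Complex.Gamma_nat_eq_factorial r
  have hr : (r.factorial : ℂ) ≠ 0 := by exact_mod_cast r.factorial_ne_zero
  have hr1 : ((r + 1 : ℕ) : ℂ) ≠ 0 := by exact_mod_cast r.succ_ne_zero
  have hp0 : (p : ℂ) ≠ 0 := by exact_mod_cast hp.ne'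
  rw [hG, Nat.factorial_succ, Nat.cast_mul, mul_pow (2 * (Real.pi : ℂ))] at key
  have hpi' : (2 * (Real.pi : ℂ)) ^ (r + 1) ≠ 0 := by
    have : (2 * (Real.pi : ℂ)) ≠ 0 := by simp
    exact pow_ne_zero _ this
  have e2' : ((2 * Real.pi : ℝ) : ℂ) = 2 * (Real.pi : ℂ) := by push_cast; rfl
  rw [e2'] at key
  generalize (2 * (Real.pi : ℂ)) ^ (r + 1) = Q at *
  generalize P.Λ ((r + 1 : ℕ) : ℂ) + (-1) ^ (r + 1) * P'.Λ ((r + 1 : ℕ) : ℂ) = L at *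
  generalize ((r + 1 : ℕ) : ℂ) = R at *
  field_simp at key ⊢
  linear_combination key

/-! ### The real part of the value at `S` -/

lemma rowSL_S (x : ℚ × ℚ) : rowSL x ModularGroup.S = (x.2, -x.1) := by
  refine Prod.ext ?_ ?_ <;> simp [rowSL, ModularGroup.S]

lemma rowSL_neg_one (x : ℚ × ℚ) : rowSL x (-1) = (-x.1, -x.2) := by
  refine Prod.ext ?_ ?_ <;> simp [rowSL]

lemma slash_neg_one (m : ℕ) (f : ℍ → ℂ) (z : ℍ) :
    slash m (ofSL (-1)) f z = (-1) ^ m * f z := by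
  have h : ∀ i j, entry (ofSL (-1)) i j = ((-1 : SL(2, ℤ)) i j : ℚ) := fun i j => rfl
  have hm : moeb (ofSL (-1)) z = z := by
    apply UpperHalfPlane.ext
    rw [coe_moeb, h, h, h, h]
    simp
  rw [slash_apply, hm, realDet_ofSL, denom_toReal, h, h, zpow_neg, zpow_natCast, ← inv_pow]
  simp

lemma fourierPhi_neg {m : ℕ} (hm : 2 ≤ m) {x : ℚ × ℚ} (hx : Adm m x) :
    fourierPhi m (-x.1, -x.2) = fun z => (-1) ^ m * fourierPhi m x z := by
  rw [← rowSL_neg_one, ← slash_fourierPhi hm hx]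
  exact funext fun z => slash_neg_one m _ z

lemma Adm.conj {m : ℕ} {x : ℚ × ℚ} (hx : Adm m x) : Adm m (x.1, -x.2) := by
  rintro hm ⟨p, q, hp, hq⟩
  exact hx hm ⟨p, -q, hp, by push_cast; rw [← hq]; simp⟩

lemma conj_axis_fourierPhi (m : ℕ) (x : ℚ × ℚ) {y : ℝ} (hy : 0 < y) :
    (starRingEnd ℂ) (axis (fourierPhi m x) y) = axis (fourierPhi m (x.1, -x.2)) y := by
  rw [axis, axis, fourierPhi, fourierPhi, coe_ofComplex (mul_I_mem hy), map_add, map_add, map_mul,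
    conj_gS, conj_gS]
  simp

lemma conj_axisInt {f g : ℍ → ℂ} (h : ∀ y : ℝ, 0 < y → (starRingEnd ℂ) (axis f y) = axis g y)
    (c : ℂ) (k : ℕ) :
    (starRingEnd ℂ) (axisInt f c k) = axisInt g ((starRingEnd ℂ) c) k := by
  rw [axisInt, axisInt, ← integral_conj]
  refine setIntegral_congr_fun measurableSet_Ioi fun y hy => ?_
  have hy' : (0 : ℝ) < y := zero_lt_one.trans hy
  simp only [map_mul, map_sub, map_pow, h y hy', Complex.conj_ofReal]

lemma axisInt_const_mul (a : ℂ) (f : ℍ → ℂ) (c : ℂ) (k : ℕ) :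
    axisInt (fun z => a * f z) (a * c) k = a * axisInt f c k := by
  rw [axisInt, axisInt, ← integral_const_mul]
  refine setIntegral_congr_fun measurableSet_Ioi fun y _ => ?_
  simp only [axis]
  ring

lemma slash_matS_fourierPhi {m : ℕ} (hm : 2 ≤ m) {x : ℚ × ℚ} (hx : Adm m x) :
    slash m matS (fourierPhi m x) = fourierPhi m (x.2, -x.1) := by
  rw [matS, slash_fourierPhi hm hx, rowSL_S]

lemma conj_add_I_pow (m k l : ℕ) {A A' B B' c c' : ℂ} (hA : (starRingEnd ℂ) A = A')
    (hB : (starRingEnd ℂ) B = B') (hc : (starRingEnd ℂ) c = c) (hc' : (starRingEnd ℂ) c' = c') :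
    (starRingEnd ℂ) (A + Complex.I ^ m * B - c / (k + 1) - Complex.I ^ m * (c' / (l + 1))) =
      A' + Complex.I ^ m * ((-1) ^ m * B') - c / (k + 1) -
        Complex.I ^ m * ((-1) ^ m * c' / (l + 1)) := by
  simp only [map_sub, map_add, map_mul, map_div₀, map_pow, map_one, map_natCast, Complex.conj_I,
    hA, hB, hc, hc', neg_pow Complex.I]
  ring

/-- On the axis, conjugation sends `φ_x` to `φ_{(x₁,-x₂)}` and `φ_x | S = φ_{(x₂,-x₁)}` to
`φ_{(x₂,x₁)}`. The latter is `(-1)^m` times `φ_{(x₁,-x₂)} | S`, and this sign is absorbed by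
conjugating `i^m`. -/
lemma conj_Λ {m : ℕ} (hm : 2 ≤ m) (hm0 : 0 < m) {x : ℚ × ℚ} (hx : Adm m x)
    (hf : GoodWith (fourierPhi m x) (-((bern m x.1 : ℂ) / m)))
    (hg : GoodWith (slash m matS (fourierPhi m x)) (-((bern m x.2 : ℂ) / m)))
    (hf' : GoodWith (fourierPhi m (x.1, -x.2)) (-((bern m x.1 : ℂ) / m)))
    (hg' : GoodWith (slash m matS (fourierPhi m (x.1, -x.2)))
      ((-1) ^ m * -((bern m x.2 : ℂ) / m))) {k l : ℕ} (hkl : k + l + 2 = m) :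
    (starRingEnd ℂ) ((fePair hm0 hf hg).Λ (k + 1)) = (fePair hm0 hf' hg').Λ (k + 1) := by
  have hx2 : Adm m (x.2, x.1) := by
    rintro h2 ⟨p, q, hp, hq⟩
    exact hx h2 ⟨q, p, hq, hp⟩
  have hs' : slash m matS (fourierPhi m (x.1, -x.2)) =
      fun z => (-1) ^ m * fourierPhi m (x.2, x.1) z := by
    rw [slash_matS_fourierPhi hm hx.conj]
    have h := fourierPhi_neg (x := (x.2, x.1)) hm hx2
    exact h
  have hc : ∀ y : ℚ, (starRingEnd ℂ) (-((y : ℂ) / m)) = -((y : ℂ) / m) := by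
    intro y
    have h : -((y : ℂ) / m) = ((-((y : ℝ) / m) : ℝ) : ℂ) := by push_cast; rfl
    rw [h, Complex.conj_ofReal]
  have h1 := (conj_axisInt (fun y hy => conj_axis_fourierPhi m x hy)
    (-((bern m x.1 : ℂ) / m)) k).trans (congrArg (fun c => axisInt _ c k) (hc _))
  have h2 := (conj_axisInt (fun y hy => conj_axis_fourierPhi m (x.2, -x.1) hy)
    (-((bern m x.2 : ℂ) / m)) l).trans (congrArg (fun c => axisInt _ c l) (hc _))
  rw [← slash_matS_fourierPhi hm hx, neg_neg] at h2
  have h3 : axisInt (slash m matS (fourierPhi m (x.1, -x.2)))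
      ((-1) ^ m * -((bern m x.2 : ℂ) / m)) l =
      (-1) ^ m * axisInt (fourierPhi m (x.2, x.1)) (-((bern m x.2 : ℂ) / m)) l := by
    rw [hs']
    exact axisInt_const_mul _ _ _ _
  have hA := fePair_Λ hm0 hf hg hkl
  have hB := fePair_Λ hm0 hf' hg' hkl
  rw [h3] at hB
  refine (congrArg _ hA).trans (Eq.trans ?_ hB.symm)
  exact conj_add_I_pow m k l h1 h2 (hc _) (hc _)

/-- Multiplied by `-i^q`, the left side of `h` becomes a number plus its conjugate, that is, twice
the real part sought. -/
lemma re_neg_I_pow_mul {q : ℕ} {L L' : ℂ} (hL : (starRingEnd ℂ) L = L') {r : ℝ}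
    (h : L + (-1) ^ q * L' = 2 * Complex.I ^ q * r) :
    (-(Complex.I ^ q * L)).re = -((-1) ^ q * r) := by
  have h1 : (starRingEnd ℂ) (-(Complex.I ^ q * L)) = -((-1) ^ q * Complex.I ^ q * L') := by
    rw [map_neg, map_mul, map_pow, Complex.conj_I, hL, neg_pow]
  have h2 := Complex.add_conj (-(Complex.I ^ q * L))
  rw [h1] at h2
  have h3 : -(Complex.I ^ q * L) + -((-1) ^ q * Complex.I ^ q * L') =
      ((2 * -((-1) ^ q * r) : ℝ) : ℂ) := by
    have h4 : Complex.I ^ q * Complex.I ^ q = (-1) ^ q := by rw [← mul_pow, Complex.I_mul_I]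
    push_cast
    linear_combination (-Complex.I ^ q) * h - 2 * r * h4
  rw [h3] at h2
  have h5 := Complex.ofReal_injective h2
  linarith

lemma re_eval_Psi_matS {m : ℕ} (hm : 2 ≤ m) {x : ℚ × ℚ} (hx : Adm m x) (z₀ : ℍ) (T : Fin 2 → ℝ) :
    (MvPolynomial.eval (cvec T) (Psi m z₀ (fourierPhi m x) matS)).re =
      ∑ k ∈ Finset.range (m - 1), ((m - 2).choose k : ℝ) * T 0 ^ k * T 1 ^ (m - 2 - k) *
        ((-1) ^ k * (((bern (m - k - 1) x.1 : ℝ) / ((m - k - 1 : ℕ) : ℝ)) *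
          ((bern (k + 1) x.2 : ℝ) / (k + 1)))) := by
  have hx2 : Adm m (x.2, x.1) := by
    rintro h2 ⟨p, q, hp, hq⟩
    exact hx h2 ⟨q, p, hq, hp⟩
  have hf := goodWith_fourierPhi m x
  have hf' := goodWith_fourierPhi m (x.1, -x.2)
  have hg : GoodWith (slash m matS (fourierPhi m x)) (-((bern m x.2 : ℂ) / m)) := by
    rw [slash_matS_fourierPhi hm hx]
    exact goodWith_fourierPhi m (x.2, -x.1)
  have hg' : GoodWith (slash m matS (fourierPhi m (x.1, -x.2)))
      ((-1) ^ m * -((bern m x.2 : ℂ) / m)) := by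
    rw [slash_matS_fourierPhi hm hx.conj, fourierPhi_neg hm hx2]
    exact (goodWith_fourierPhi m (x.2, x.1)).const_mul _
  rw [Psi_indep hm (goodAll_fourierPhi hm hx) z₀ I, eval_Psi_matS hm hf hg, Complex.re_sum]
  refine Finset.sum_congr rfl fun k hk => ?_
  obtain ⟨l, hl⟩ := Nat.exists_eq_add_of_le (Nat.le_sub_one_of_lt (Finset.mem_range.1 hk))
  have hkl : k + l + 2 = m := by omega
  have hp : m - k - 1 = l + 1 := by omega
  have hc := conj_Λ hm (by omega) hx hf hg hf' hg' hkl
  have hv := Λ_value (p := l + 1) (q := k + 1) (by omega) (by omega) (by omega) (by omega)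
    hf hg hf' hg'
  push_cast at hv
  have h := re_neg_I_pow_mul hc (q := k + 1)
    (r := ((bern (k + 1) x.2 : ℝ) / (k + 1)) * ((bern (l + 1) x.1 : ℝ) / (l + 1)))
    (by rw [hv]; push_cast; ring)
  have e : ((m - 2).choose k : ℂ) * cvec T 0 ^ k * cvec T 1 ^ (m - 2 - k) =
      ((((m - 2).choose k : ℝ) * T 0 ^ k * T 1 ^ (m - 2 - k) : ℝ) : ℂ) := by
    simp only [cvec]
    push_cast
    rfl
  rw [e, Complex.re_ofReal_mul, h, hp]
  push_cast
  ring

/-! ### Integrals of powers of linear forms -/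

/-- The primitive `∫_0^t (s u + v)^n ds`, over any field. -/
def linPrim {K : Type} [Field K] (n : ℕ) (u v t : K) : K :=
  ∑ k ∈ Finset.range (n + 1), (n.choose k : K) / (k + 1) * t ^ (k + 1) * u ^ k * v ^ (n - k)

lemma fchk_cvec (n : ℕ) (T : Fin 2 → ℝ) (t : ℝ) :
    fchk n (cvec T) (t : ℂ) = (linPrim n (T 0) (T 1) t : ℝ) := by
  simp [fchk, linPrim, cvec]

lemma hasDerivAt_linPrim (n : ℕ) (u v t : ℝ) :
    HasDerivAt (linPrim n u v) ((t * u + v) ^ n) t := by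
  have h := (hasDerivAt_fchk n (cvec ![u, v]) (t : ℂ)).real_of_complex
  refine (h.congr_deriv ?_).congr_of_eventuallyEq (.of_forall fun s => ?_)
  · rw [← Complex.ofReal_re ((t * u + v) ^ n)]
    simp [cvec]
  · simp [fchk_cvec]

lemma linPrim_zero {K : Type} [Field K] (n : ℕ) (u v : K) : linPrim n u v 0 = 0 := by
  simp [linPrim]

lemma integral_linPow (n : ℕ) (u v a b : ℝ) :
    ∫ t in a..b, (t * u + v) ^ n = linPrim n u v b - linPrim n u v a :=
  intervalIntegral.integral_eq_sub_of_hasDerivAt (fun t _ => hasDerivAt_linPrim n u v t)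
    (Continuous.intervalIntegrable (by fun_prop) _ _)

open MvPolynomial in
lemma continuous_coeff_pow (n : ℕ) (L M : MvPolynomial (Fin 2) ℝ) (d : Fin 2 →₀ ℕ) :
    Continuous fun t : ℝ => ((C t * L + M) ^ n).coeff d := by
  have h : (fun t : ℝ => ((C t * L + M) ^ n).coeff d) = fun t =>
      ∑ k ∈ Finset.range (n + 1), t ^ k * (L ^ k * M ^ (n - k) * (n.choose k : ℕ)).coeff d := by
    funext t
    rw [add_pow, coeff_sum]
    refine Finset.sum_congr rfl fun k _ => ?_
    rw [mul_pow, ← C_pow, mul_assoc, mul_assoc, coeff_C_mul, mul_assoc]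
  rw [h]
  fun_prop

open MvPolynomial in
lemma eval_realInt {n : ℕ} {L M : MvPolynomial (Fin 2) ℝ} (hL : L.IsHomogeneous 1)
    (hM : M.IsHomogeneous 1) (a b : ℝ) (T : Fin 2 → ℝ) :
    eval T (realInt n (fun t => (C t * L + M) ^ n) a b) =
      linPrim n (eval T L) (eval T M) b - linPrim n (eval T L) (eval T M) a := by
  rw [realInt, eval_homog, ← integral_linPow]
  have h : ∀ t : ℝ, (t * eval T L + eval T M) ^ n = ∑ k ∈ Finset.range (n + 1),
      ((C t * L + M) ^ n).coeff (expo k (n - k)) * (T 0 ^ k * T 1 ^ (n - k)) := by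
    intro t
    have hP : ((C t * L + M) ^ n).IsHomogeneous n := by
      have h1 := (isHomogeneous_C (Fin 2) t).mul hL
      rw [zero_add] at h1
      simpa using (h1.add hM).pow n
    have h2 := eval_eq_sum hP T
    simpa [mul_assoc] using h2
  simp only [h]
  rw [intervalIntegral.integral_finsetSum]
  · refine Finset.sum_congr rfl fun k _ => ?_
    rw [intervalIntegral.integral_mul_const, mul_assoc]
  · intro k _
    exact ((continuous_coeff_pow n L M _).mul continuous_const).intervalIntegrable _ _

/-! ### The values of `Phi` -/

lemma eval_Phi (m : ℕ) (z₀ : ℍ) (f : ℍ → ℂ) (γ : GL(2, ℚ)⁺) (T : Fin 2 → ℝ) :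
    MvPolynomial.eval T (Phi m z₀ f γ) = (MvPolynomial.eval (cvec T) (Psi m z₀ f γ)).re :=
  eval_rePoly (isHomogeneous_Psi m z₀ f γ) T

lemma eval_Psi_fourierPhi_borel {m : ℕ} (hm : 2 ≤ m) (x : ℚ × ℚ) (z₀ : ℍ) {β : GL(2, ℚ)⁺}
    (hβ : entry β 1 0 = 0) (T : Fin 2 → ℝ) :
    MvPolynomial.eval (cvec T) (Psi m z₀ (fourierPhi m x) β) =
      ((-((bern m x.1 : ℝ) / m) *
        linPrim (m - 2) (T 0) (T 1) ((entry β 0 1 : ℝ) / entry β 1 1) : ℝ) : ℂ) := by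
  rw [eval_Psi_borel hm (goodWith_fourierPhi m x) hβ, fchk_cvec]
  push_cast
  rfl

lemma detFac_ofSL (n : ℕ) (σ : SL(2, ℤ)) : detFac ℂ n (ofSL σ) = 1 := by
  rw [detFac, realDet_ofSL, Real.one_rpow, map_one]

/-- The distribution relation and linearity replace `x` by the points `distPt x a c r`. Summing the
products of Bernoulli values at these points over `r` gives the Dedekind sums. -/
lemma eval_act_upper_matS {m : ℕ} (hm : 2 ≤ m) {x : ℚ × ℚ} (hx : Adm m x) (z₀ : ℍ) (a : ℤ)
    {c : ℕ} (hc : 0 < c) (h : 0 < (1 : ℚ) * c) (T : Fin 2 → ℝ) :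
    (MvPolynomial.eval (cvec T) (act (m - 2) (upper 1 a c h)
      (Psi m z₀ (slash m (upper 1 a c h) (fourierPhi m x)) matS))).re =
    ∑ k ∈ Finset.range (m - 1), (-1) ^ k * ((m - 2).choose k : ℝ) *
      (dedekindS (m - k - 1) (k + 1) x a c : ℝ) * T 0 ^ k *
        ((a : ℝ) * T 0 + (c : ℝ) * T 1) ^ (m - k - 2) := by
  have hc' : (c : ℂ) ≠ 0 := by exact_mod_cast hc.ne'
  obtain ⟨h00, h01, h10, h11⟩ := entry_upper 1 a c h
  have hgood : ∀ r ∈ Finset.range c, GoodAll m (fourierPhi m (distPt x a c r)) :=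
    fun r _ => goodAll_fourierPhi hm (hx.distPt a hc r)
  -- The determinant factor of the action, the automorphy factor and the power of `c` in the
  -- distribution relation cancel exactly.
  have hfac : detFac ℂ (m - 2) (upper 1 a c h) *
      (borelFac m (upper 1 a c h) * (c : ℂ) ^ (m - 1)) = 1 := by
    rw [← mul_assoc, borelFac_detFac hm h10, h00, h11]
    obtain ⟨n, rfl⟩ := Nat.exists_eq_add_of_le' hm
    have e : n + 2 - 1 = n + 1 := by omega
    rw [e, Nat.add_sub_cancel]
    push_cast
    field_simp
    rw [pow_succ']
  rw [slash_upper_fourierPhi hm hx a hc h, Psi_const_mul (GoodAll.sum _ hgood), Psi_sum _ hgood,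
    eval_act, map_mul, MvPolynomial.eval_C, ← mul_assoc, hfac, one_mul, map_sum, rowMul_cvec,
    Complex.re_sum]
  simp only [Finset.sum_congr rfl fun r hr => re_eval_Psi_matS hm (hx.distPt a hc r) z₀ _]
  rw [Finset.sum_comm]
  refine Finset.sum_congr rfl fun k _ => ?_
  rw [dedekindS, Int.toNat_natCast]
  push_cast
  rw [Finset.mul_sum, Finset.sum_mul, Finset.sum_mul]
  refine Finset.sum_congr rfl fun r _ => ?_
  have e : m - 2 - k = m - k - 2 := by omega
  simp only [rowMul, distPt, h00, h01, h10, h11, e, Matrix.cons_val_zero, Matrix.cons_val_one]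
  push_cast
  simp only [one_mul, zero_mul, add_zero]
  ring

/-- The rational value of the generalized Rademacher function at `σ` with lower left entry
`c > 0`. -/
def radVal {K : Type} [Field K] (m : ℕ) (x : ℚ × ℚ) (a b c d : ℤ) (u v : K) : K :=
  -((bern m x.1 : K) / m) * linPrim (m - 2) u v ((a : K) / c) +
    ((bern m (a * x.1 + c * x.2) : K) / m) *
      linPrim (m - 2) (a * u + c * v) (b * u + d * v) (-(d : K) / c) +
    ∑ k ∈ Finset.range (m - 1), (-1) ^ k * ((m - 2).choose k : K) *
      (dedekindS (m - k - 1) (k + 1) x a c : K) * u ^ k * (a * u + c * v) ^ (m - k - 2)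

/-- The cocycle relation is applied to both sides of `hmat`. Apart from `Ψ(σ)`, every term is either
a value on an upper triangular matrix or the value treated in `eval_act_upper_matS`. -/
lemma eval_Phi_ofSL {m : ℕ} (hm : 2 ≤ m) {x : ℚ × ℚ} (hx : Adm m x) (z₀ : ℍ) (σ : SL(2, ℤ))
    (hc : 0 < σ 1 0) (T : Fin 2 → ℝ) :
    MvPolynomial.eval T (Phi m z₀ (fourierPhi m x) (ofSL σ)) =
      radVal m x (σ 0 0) (σ 0 1) (σ 1 0) (σ 1 1) (T 0) (T 1) := by
  obtain ⟨c, hc'⟩ := Int.eq_ofNat_of_zero_le hc.le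
  have hc0 : 0 < c := by omega
  have hpos : 0 < (1 : ℚ) * c := by rw [one_mul]; exact_mod_cast hc0
  have hgood := goodAll_fourierPhi hm hx
  have hdet : (σ 0 0 : ℚ) * σ 1 1 - σ 0 1 * σ 1 0 = 1 := by
    have h := σ.det_coe
    rw [Matrix.det_fin_two] at h
    exact_mod_cast h
  have hmat : ofSL σ * upper 1 ((-σ 1 1 : ℤ) : ℚ) c hpos = upper 1 (σ 0 0 : ℤ) c hpos * matS := by
    obtain ⟨h00, h01, h10, h11⟩ := entry_upper 1 ((-σ 1 1 : ℤ) : ℚ) c hpos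
    obtain ⟨g00, g01, g10, g11⟩ := entry_upper 1 (σ 0 0 : ℚ) c hpos
    obtain ⟨s00, s01, s10, s11⟩ := entry_matS
    have hcq : (σ 1 0 : ℚ) = c := by rw [hc']; simp
    refine glpos_ext fun i j => ?_
    rw [entry_mul, entry_mul, entry_ofSL, entry_ofSL]
    rw [hcq] at hdet
    fin_cases i <;> fin_cases j <;>
      simp only [Fin.zero_eta, Fin.mk_one, h00, h01, h10, h11, g00, g01, g10, g11, s00, s01, s10,
        s11, hcq] <;> push_cast <;> linarith
  have h := Psi_cocycle hm hgood z₀ (ofSL σ) (upper 1 ((-σ 1 1 : ℤ) : ℚ) c hpos)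
  rw [hmat, Psi_cocycle hm hgood z₀, slash_fourierPhi hm hx] at h
  have h2 := congrArg (fun P => (MvPolynomial.eval (cvec T) P).re) h
  simp only [map_add, Complex.add_re] at h2
  rw [eval_act_upper_matS hm hx z₀ _ hc0 hpos T, eval_Psi_fourierPhi_borel hm x z₀ rfl T, eval_act,
    detFac_ofSL, one_mul, rowMul_cvec, eval_Psi_fourierPhi_borel hm (rowSL x σ) z₀ rfl _,
    Complex.ofReal_re, Complex.ofReal_re] at h2
  obtain ⟨h00, h01, h10, h11⟩ := entry_upper 1 ((-σ 1 1 : ℤ) : ℚ) c hpos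
  obtain ⟨g00, g01, g10, g11⟩ := entry_upper 1 (σ 0 0 : ℚ) c hpos
  rw [h01, h11, g01, g11] at h2
  simp only [rowMul, entry_ofSL, rowSL, Matrix.cons_val_zero, Matrix.cons_val_one] at h2
  rw [eval_Phi, radVal, hc']
  rw [hc'] at h2
  push_cast at h2 ⊢
  linarith

/-- The matrix `-1` is upper triangular with `b = 0`, so it contributes nothing. This reduces the
case `c < 0` to `c > 0`. -/
lemma Psi_mul_neg_one {m : ℕ} (hm : 2 ≤ m) {x : ℚ × ℚ} (hx : Adm m x) (z₀ : ℍ) (τ : SL(2, ℤ)) :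
    Psi m z₀ (fourierPhi m x) (ofSL (-τ)) = Psi m z₀ (fourierPhi m x) (ofSL τ) := by
  obtain ⟨c, hc⟩ := ((goodAll_fourierPhi hm hx).slash (ofSL τ)).self
  have h : -τ = τ * -1 := by simp
  have h0 : Psi m z₀ (slash m (ofSL τ) (fourierPhi m x)) (ofSL (-1)) = 0 := by
    refine MvPolynomial.funext fun T => ?_
    have hb : entry (ofSL (-1)) 1 0 = 0 := by simp [entry_ofSL]
    have hb' : entry (ofSL (-1)) 0 1 = 0 := by simp [entry_ofSL]
    rw [eval_Psi_borel hm hc hb, hb']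
    simp
  rw [h, ofSL_mul, Psi_cocycle hm (goodAll_fourierPhi hm hx), h0]
  simp [act]

/-! ### Rationality -/

open MvPolynomial in
/-- The rational polynomial underlying `linPrim`. -/
def linPrimPoly (n : ℕ) (L M : MvPolynomial (Fin 2) ℚ) (q : ℚ) : MvPolynomial (Fin 2) ℚ :=
  ∑ k ∈ Finset.range (n + 1), C ((n.choose k : ℚ) / (k + 1) * q ^ (k + 1)) * L ^ k * M ^ (n - k)

open MvPolynomial in
lemma isHomogeneous_C_mul_pow {L M : MvPolynomial (Fin 2) ℚ} (hL : L.IsHomogeneous 1)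
    (hM : M.IsHomogeneous 1) (q : ℚ) {n k l : ℕ} (h : k + l = n) :
    (C q * L ^ k * M ^ l).IsHomogeneous n := by
  have h1 := ((isHomogeneous_C (Fin 2) q).mul (hL.pow k)).mul (hM.pow l)
  rwa [zero_add, one_mul, one_mul, h] at h1

lemma isHomogeneous_linPrimPoly {L M : MvPolynomial (Fin 2) ℚ} (hL : L.IsHomogeneous 1)
    (hM : M.IsHomogeneous 1) (n : ℕ) (q : ℚ) : (linPrimPoly n L M q).IsHomogeneous n :=
  MvPolynomial.IsHomogeneous.sum _ _ _ fun k hk =>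
    isHomogeneous_C_mul_pow hL hM _ (by have := Finset.mem_range.1 hk; omega)

lemma eval₂_linPrimPoly (n : ℕ) (L M : MvPolynomial (Fin 2) ℚ) (q : ℚ) (T : Fin 2 → ℝ) :
    MvPolynomial.eval₂ (algebraMap ℚ ℝ) T (linPrimPoly n L M q) =
      linPrim n (MvPolynomial.eval₂ (algebraMap ℚ ℝ) T L) (MvPolynomial.eval₂ (algebraMap ℚ ℝ) T M)
        (q : ℝ) := by
  rw [linPrimPoly, linPrim, MvPolynomial.eval₂_sum]
  refine Finset.sum_congr rfl fun k _ => ?_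
  simp [MvPolynomial.eval₂_mul, MvPolynomial.eval₂_pow]

open MvPolynomial in
lemma isHomogeneous_linear {K : Type} [Field K] (a b : K) :
    (C a * X 0 + C b * X 1 : MvPolynomial (Fin 2) K).IsHomogeneous 1 := by
  have h0 := (isHomogeneous_C (Fin 2) a).mul (isHomogeneous_X K (0 : Fin 2))
  have h1 := (isHomogeneous_C (Fin 2) b).mul (isHomogeneous_X K (1 : Fin 2))
  rw [zero_add] at h0 h1
  exact h0.add h1

open MvPolynomial in
lemma exists_rat_radVal {m : ℕ} (hm : 2 ≤ m) (x : ℚ × ℚ) (a b c d : ℤ) :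
    ∃ P : MvPolynomial (Fin 2) ℚ, P.IsHomogeneous (m - 2) ∧ ∀ T : Fin 2 → ℝ,
      eval₂ (algebraMap ℚ ℝ) T P = radVal m x a b c d (T 0) (T 1) := by
  have hC : ∀ {P : MvPolynomial (Fin 2) ℚ} (q : ℚ), P.IsHomogeneous (m - 2) →
      (C q * P).IsHomogeneous (m - 2) := by
    intro P q hP
    have h := (isHomogeneous_C (Fin 2) q).mul hP
    rwa [zero_add] at h
  refine ⟨C (-(bern m x.1 / m)) * linPrimPoly (m - 2) (X 0) (X 1) (a / c) +
    C (bern m (a * x.1 + c * x.2) / m) *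
      linPrimPoly (m - 2) (C (a : ℚ) * X 0 + C (c : ℚ) * X 1) (C (b : ℚ) * X 0 + C (d : ℚ) * X 1)
        (-d / c) +
    ∑ k ∈ Finset.range (m - 1), C ((-1) ^ k * ((m - 2).choose k : ℚ) *
      dedekindS (m - k - 1) (k + 1) x a c) * X 0 ^ k *
        (C (a : ℚ) * X 0 + C (c : ℚ) * X 1) ^ (m - k - 2), ?_, fun T => ?_⟩
  · refine ((hC _ ?_).add (hC _ ?_)).add (IsHomogeneous.sum _ _ _ fun k hk => ?_)
    · exact isHomogeneous_linPrimPoly (isHomogeneous_X _ _) (isHomogeneous_X _ _) _ _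
    · exact isHomogeneous_linPrimPoly (isHomogeneous_linear _ _) (isHomogeneous_linear _ _) _ _
    · refine isHomogeneous_C_mul_pow (isHomogeneous_X _ _) (isHomogeneous_linear _ _) _ ?_
      have := Finset.mem_range.1 hk
      omega
  · simp only [eval₂_add, eval₂_mul, eval₂_sum, eval₂_pow, eval₂_C, eval₂_X, eval₂_linPrimPoly,
      radVal, eq_ratCast]
    push_cast
    rfl

open MvPolynomial in
lemma exists_rat_Phi {m : ℕ} (hm : 2 ≤ m) {x : ℚ × ℚ} (hx : Adm m x) (z₀ : ℍ) (σ : SL(2, ℤ)) :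
    ∃ P : MvPolynomial (Fin 2) ℚ, P.IsHomogeneous (m - 2) ∧
      Phi m z₀ (fourierPhi m x) (ofSL σ) = P.map (algebraMap ℚ ℝ) := by
  rcases lt_trichotomy (σ 1 0) 0 with h | h | h
  · have h' : 0 < (-σ) 1 0 := by simpa using h
    obtain ⟨P, hP, hPT⟩ := exists_rat_radVal hm x ((-σ) 0 0) ((-σ) 0 1) ((-σ) 1 0) ((-σ) 1 1)
    refine ⟨P, hP, MvPolynomial.funext fun T => ?_⟩
    rw [eval_map, hPT, ← eval_Phi_ofSL hm hx z₀ (-σ) h' T, Phi, Phi, Psi_mul_neg_one hm hx]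
  · have hσ : entry (ofSL σ) 1 0 = 0 := by rw [entry_ofSL, h, Int.cast_zero]
    refine ⟨C (-(bern m x.1 / m)) * linPrimPoly (m - 2) (X 0) (X 1)
      (entry (ofSL σ) 0 1 / entry (ofSL σ) 1 1), ?_, MvPolynomial.funext fun T => ?_⟩
    · have h1 := (isHomogeneous_C (Fin 2) (-(bern m x.1 / m))).mul (isHomogeneous_linPrimPoly
        (isHomogeneous_X ℚ (0 : Fin 2)) (isHomogeneous_X ℚ (1 : Fin 2)) (m - 2)
          (entry (ofSL σ) 0 1 / entry (ofSL σ) 1 1))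
      rwa [zero_add] at h1
    · rw [eval_map, eval_Phi, eval_Psi_fourierPhi_borel hm x z₀ hσ, Complex.ofReal_re, eval₂_mul,
        eval₂_C, eval₂_linPrimPoly, eval₂_X, eval₂_X, eq_ratCast]
      push_cast
      rfl
  · obtain ⟨P, hP, hPT⟩ := exists_rat_radVal hm x (σ 0 0) (σ 0 1) (σ 1 0) (σ 1 1)
    refine ⟨P, hP, MvPolynomial.funext fun T => ?_⟩
    rw [eval_map, hPT, eval_Phi_ofSL hm hx z₀ σ h T]

/-! ### The closed formulas -/

open MvPolynomial in
lemma Phi_borel {m : ℕ} (hm : 2 ≤ m) (x : ℚ × ℚ) (z₀ : ℍ) {β : GL(2, ℚ)⁺}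
    (hβ : entry β 1 0 = 0) :
    Phi m z₀ (fourierPhi m x) β = - C ((bern m x.1 : ℝ) / m) *
      realInt (m - 2) (fun t => (C t * X 0 + X 1) ^ (m - 2)) 0
        ((entry β 0 1 : ℝ) / entry β 1 1) := by
  refine MvPolynomial.funext fun T => ?_
  rw [eval_Phi, eval_Psi_fourierPhi_borel hm x z₀ hβ, Complex.ofReal_re, map_mul, map_neg, eval_C,
    eval_realInt (isHomogeneous_X _ _) (isHomogeneous_X _ _), eval_X, eval_X, linPrim_zero,
    sub_zero]

open MvPolynomial in
lemma Phi_ofSL {m : ℕ} (hm : 2 ≤ m) {x : ℚ × ℚ} (hx : Adm m x) (z₀ : ℍ) (σ : SL(2, ℤ))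
    {a b c d : ℤ} (ha : a = σ 0 0) (hb : b = σ 0 1) (hc : c = σ 1 0) (hd : d = σ 1 1)
    (hpos : 0 < c) :
    Phi m z₀ (fourierPhi m x) (ofSL σ) =
      - C ((bern m x.1 : ℝ) / m) *
          realInt (m - 2) (fun t => (C t * X 0 + X 1) ^ (m - 2)) 0 ((a : ℝ) / c)
      - C ((bern m (a * x.1 + c * x.2) : ℝ) / m) *
          realInt (m - 2) (fun t =>
            (C t * (C (a : ℝ) * X 0 + C (c : ℝ) * X 1) + C (b : ℝ) * X 0 + C (d : ℝ) * X 1)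
              ^ (m - 2)) (-(d : ℝ) / c) 0
      + ∑ k ∈ Finset.range (m - 1),
          C ((-1 : ℝ) ^ k * ((m - 2).choose k : ℝ) *
              (dedekindS (m - k - 1) (k + 1) x a c : ℝ)) *
            X 0 ^ k * (C (a : ℝ) * X 0 + C (c : ℝ) * X 1) ^ (m - k - 2) := by
  subst ha hb hc hd
  refine MvPolynomial.funext fun T => ?_
  have hG : (fun t : ℝ => (C t * (C (σ 0 0 : ℝ) * X 0 + C (σ 1 0 : ℝ) * X 1) +
      C (σ 0 1 : ℝ) * X 0 + C (σ 1 1 : ℝ) * X 1 : MvPolynomial (Fin 2) ℝ) ^ (m - 2)) = fun t =>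
      (C t * (C (σ 0 0 : ℝ) * X 0 + C (σ 1 0 : ℝ) * X 1) +
        (C (σ 0 1 : ℝ) * X 0 + C (σ 1 1 : ℝ) * X 1)) ^ (m - 2) := by
    funext t
    rw [add_assoc]
  rw [hG, eval_Phi_ofSL hm hx z₀ σ hpos, radVal, map_add, map_sub, map_mul, map_mul, map_neg,
    eval_C, eval_C, eval_realInt (isHomogeneous_X _ _) (isHomogeneous_X _ _),
    eval_realInt (isHomogeneous_linear _ _) (isHomogeneous_linear _ _), linPrim_zero, linPrim_zero,
    sub_zero, zero_sub, map_sum]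
  simp only [map_add, map_mul, map_pow, eval_C, eval_X]
  ring

/-! ### The Eisenstein series as modular forms -/

lemma toReal_ofSL (σ : SL(2, ℤ)) : toReal (ofSL σ) = Matrix.SpecialLinearGroup.mapGL ℝ σ := by
  apply Units.ext
  ext i j
  simp [toReal_apply, entry_ofSL]

open ModularForm in
lemma modularSlash_eq (m : ℕ) (f : ℍ → ℂ) (σ : SL(2, ℤ)) :
    f ∣[(m : ℤ)] (Matrix.SpecialLinearGroup.mapGL ℝ σ) = slash m (ofSL σ) f := by
  funext z
  have h := congrFun (ModularForm.SL_slash_def f (k := (m : ℤ)) σ) z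
  refine h.trans ?_
  rw [slash_apply, realDet_ofSL, toReal_ofSL, Real.one_rpow, Complex.ofReal_one, one_mul, mul_comm,
    moeb, toReal_ofSL]
  rfl

open CongruenceSubgroup in
-- As `γ ≡ 1 mod N` and `N x` is integral, `x γ - x` lies in `ℤ²`.
lemma fourierPhi_rowSL_of_mem_Gamma {m N : ℕ} {x : ℚ × ℚ}
    (hx : ∃ p q : ℤ, N * x.1 = p ∧ N * x.2 = q) {γ : SL(2, ℤ)} (hγ : γ ∈ Gamma N) :
    fourierPhi m (rowSL x γ) = fourierPhi m x := by
  rw [Gamma_mem] at hγ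
  obtain ⟨p, q, hp, hq⟩ := hx
  obtain ⟨h00, h01, h10, h11⟩ := hγ
  have e : ∀ n : ℤ, (n : ZMod N) = 0 → ∃ k : ℤ, (n : ℚ) = N * k := by
    intro n hn
    obtain ⟨k, hk⟩ := (ZMod.intCast_zmod_eq_zero_iff_dvd n N).1 hn
    exact ⟨k, by exact_mod_cast hk⟩
  obtain ⟨k00, h00⟩ := e (γ 0 0 - 1) (by push_cast; rw [h00, sub_self])
  obtain ⟨k01, h01⟩ := e _ h01
  obtain ⟨k10, h10⟩ := e _ h10
  obtain ⟨k11, h11⟩ := e (γ 1 1 - 1) (by push_cast; rw [h11, sub_self])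
  rw [← fourierPhi_add_int m x (k00 * p + k10 * q) (k01 * p + k11 * q)]
  congr 1
  push_cast at h00 h11 ⊢
  rw [← hp, ← hq]
  refine Prod.ext ?_ ?_ <;> simp only [rowSL]
  · linear_combination x.1 * h00 + x.2 * h10
  · linear_combination x.1 * h01 + x.2 * h11

lemma slash_fourierPhi_of_mem_Gamma {m N : ℕ} (hm : 2 ≤ m) {x : ℚ × ℚ} (hx0 : Adm m x)
    (hx : ∃ p q : ℤ, N * x.1 = p ∧ N * x.2 = q) {γ : SL(2, ℤ)}
    (hγ : γ ∈ CongruenceSubgroup.Gamma N) :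
    slash m (ofSL γ) (fourierPhi m x) = fourierPhi m x := by
  rw [slash_fourierPhi hm hx0, fourierPhi_rowSL_of_mem_Gamma hx hγ]

/-- `fourierPhi m x`, as a modular form for `Γ(N)`. -/
def fourierPhiMF {m N : ℕ} (hm : 2 ≤ m) (hN : 0 < N) {x : ℚ × ℚ} (hx0 : Adm m x)
    (hx : ∃ p q : ℤ, N * x.1 = p ∧ N * x.2 = q) :
    ModularForm ((CongruenceSubgroup.Gamma N).map (Matrix.SpecialLinearGroup.mapGL ℝ)) (m : ℤ) where
  toFun := fourierPhi m x
  slash_action_eq' := by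
    rintro _ ⟨γ, hγ, rfl⟩
    rw [modularSlash_eq, slash_fourierPhi_of_mem_Gamma hm hx0 hx hγ]
  holo' := UpperHalfPlane.mdifferentiable_iff.2 (goodWith_fourierPhi m x).1
  bdd_at_cusps' {c} hc := by
    have : NeZero N := ⟨hN.ne'⟩
    rw [Subgroup.IsArithmetic.isCusp_iff_isCusp_SL2Z] at hc
    rw [OnePoint.isBoundedAt_iff_forall_SL2Z hc]
    intro γ _
    have h := modularSlash_eq m (fourierPhi m x) γ
    rw [slash_fourierPhi hm hx0] at h
    refine (congrArg IsBoundedAtImInfty h).mpr ?_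
    exact (goodWith_fourierPhi m _).tendsto.isBigO_one ℝ

lemma rowSL_rational {N : ℕ} {x : ℚ × ℚ} (hx : ∃ p q : ℤ, N * x.1 = p ∧ N * x.2 = q)
    (σ : SL(2, ℤ)) : ∃ p q : ℤ, N * (rowSL x σ).1 = p ∧ N * (rowSL x σ).2 = q := by
  obtain ⟨p, q, hp, hq⟩ := hx
  refine ⟨σ 0 0 * p + σ 1 0 * q, σ 0 1 * p + σ 1 1 * q, ?_, ?_⟩ <;> push_cast <;>
    rw [← hp, ← hq, rowSL] <;> ring

end
end Transgress
open MvPolynomial Transgress in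
theorem mainTheorem2 (m N : ℕ) (hm : 2 ≤ m) (hN : 0 < N) (x : ℚ × ℚ)
    (hx : ∃ p q : ℤ, N * x.1 = p ∧ N * x.2 = q)
    (hx0 : m = 2 → ¬ ∃ p q : ℤ, x.1 = p ∧ x.2 = q) :
    -- the Eisenstein series is a modular form of weight `m` and level `N`
    (∃ f : ModularForm
        ((CongruenceSubgroup.Gamma N).map (Matrix.SpecialLinearGroup.mapGL ℝ)) (m : ℤ),
      ∀ z : ℍ, f z = eisPhi m N x z) ∧
    -- the cochain `Ψ` does not depend on the base point
    (∀ (z₀ z₁ : ℍ) (γ : GL(2, ℚ)⁺),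
      Psi m z₀ (eisPhi m N x) γ = Psi m z₁ (eisPhi m N x) γ) ∧
    ∀ z₀ : ℍ,
    -- `gv` is the coboundary of `tgv` on the group elements
    (∀ γ₀ γ₁ γ₂ : GL(2, ℚ)⁺, γ₀ * γ₁ * γ₂ = 1 →
      gv m z₀ (eisPhi m N x) (U γ₀) (U γ₁) (U γ₂) =
        hochB (m - 2) (tgv m z₀ (eisPhi m N x)) (U γ₀) (U γ₁) (U γ₂)) ∧
    -- on `Γ(N)`, `Ψ` is, up to the sign, the transgression cochain
    (∀ γ ∈ CongruenceSubgroup.Gamma N,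
      Psi m z₀ (eisPhi m N x) (ofSL γ) =
        - tgv m z₀ (eisPhi m N x) (U (ofSL γ)) (U (ofSL γ)⁻¹)) ∧
    -- the cocycle relation on `GL⁺(2, ℚ)`
    (∀ α β : GL(2, ℚ)⁺,
      Psi m z₀ (eisPhi m N x) (α * β) =
        Psi m z₀ (eisPhi m N x) α + act (m - 2) α (Psi m z₀ (slash m α (eisPhi m N x)) β)) ∧
    (∀ α : SL(2, ℤ),
      slash m (ofSL α) (eisPhi m N x) =
        eisPhi m N (α 0 0 * x.1 + α 1 0 * x.2, α 0 1 * x.1 + α 1 1 * x.2)) ∧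
    -- `Φ` restricts to a cocycle on `Γ(N)`
    (∀ α ∈ CongruenceSubgroup.Gamma N, ∀ β ∈ CongruenceSubgroup.Gamma N,
      Phi m z₀ (eisPhi m N x) (ofSL (α * β)) =
        Phi m z₀ (eisPhi m N x) (ofSL α) +
          act (m - 2) (ofSL α) (Phi m z₀ (eisPhi m N x) (ofSL β))) ∧
    -- rationality
    (∀ σ : SL(2, ℤ), ∃ P : MvPolynomial (Fin 2) ℚ, P.IsHomogeneous (m - 2) ∧
      Phi m z₀ (eisPhi m N x) (ofSL σ) = P.map (algebraMap ℚ ℝ)) ∧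
    -- the values on the Borel subgroup
    (∀ β : GL(2, ℚ)⁺, entry β 1 0 = 0 →
      Phi m z₀ (eisPhi m N x) β =
        - C ((bern m x.1 : ℝ) / m) *
          realInt (m - 2) (fun t => (C t * X 0 + X 1) ^ (m - 2)) 0
            ((entry β 0 1 : ℝ) / entry β 1 1)) ∧
    -- the values on `SL(2, ℤ)`
    (∀ (σ : SL(2, ℤ)) (a b c d : ℤ), a = σ 0 0 → b = σ 0 1 → c = σ 1 0 → d = σ 1 1 → 0 < c →
      Phi m z₀ (eisPhi m N x) (ofSL σ) =
        - C ((bern m x.1 : ℝ) / m) *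
            realInt (m - 2) (fun t => (C t * X 0 + X 1) ^ (m - 2)) 0 ((a : ℝ) / c)
        - C ((bern m (a * x.1 + c * x.2) : ℝ) / m) *
            realInt (m - 2) (fun t =>
              (C t * (C (a : ℝ) * X 0 + C (c : ℝ) * X 1) + C (b : ℝ) * X 0 + C (d : ℝ) * X 1)
                ^ (m - 2)) (-(d : ℝ) / c) 0
        + ∑ k ∈ Finset.range (m - 1),
            C ((-1 : ℝ) ^ k * ((m - 2).choose k : ℝ) *
                (dedekindS (m - k - 1) (k + 1) x a c : ℝ)) *
              X 0 ^ k * (C (a : ℝ) * X 0 + C (c : ℝ) * X 1) ^ (m - k - 2)) := by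
  -- Every claim is proved for the Fourier expansion; the series itself enters only through this
  -- identity, here and at the parameter `x α`.
  have hE : eisPhi m N x = fourierPhi m x := eisPhi_eq hm hN hx hx0
  have hgood : GoodAll m (fourierPhi m x) := goodAll_fourierPhi hm hx0
  rw [hE]
  refine ⟨⟨fourierPhiMF hm hN hx0 hx, fun z => rfl⟩, Psi_indep hm hgood, fun z₀ =>
    ⟨fun γ₀ γ₁ γ₂ h => hochB_tgv (fun δ α β => Psi_cocycle hm (hgood.slash δ) z₀ α β)
        (Psi_one hgood z₀) h, fun γ hγ => Psi_eq_neg_tgv ?_, Psi_cocycle hm hgood z₀, fun α => ?_,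
      fun α hα β _ => ?_, exists_rat_Phi hm hx0 z₀, fun β hβ => Phi_borel hm x z₀ hβ,
      fun σ a b c d ha hb hc hd hpos => Phi_ofSL hm hx0 z₀ σ ha hb hc hd hpos⟩⟩
  · rw [← ofSL_inv]
    exact slash_fourierPhi_of_mem_Gamma hm hx0 hx (inv_mem hγ)
  · rw [slash_fourierPhi hm hx0]
    exact (eisPhi_eq hm hN (rowSL_rational hx α) (Adm.rowSL hx0 α)).symm
  · rw [Phi, ofSL_mul, Psi_cocycle hm hgood, slash_fourierPhi_of_mem_Gamma hm hx0 hx hα, rePoly_add,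
      rePoly_act (isHomogeneous_Psi _ _ _ _)]
    rfl
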